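/- Let $n\ge 1$ and let $\mathbb H^n$ be the Heisenberg group, i.e. $\mathbb R^n\times\mathbb R^n\times\mathbb R$ with the group law $(x,y,t)\circ(x',y',t')=(x+x',\,y+y',\,t+t'+\tfrac12(x\cdot y'-x'\cdot y))$ and Lebesgue measure. Let $$\mathcal L=\sum_{j=1}^n (X_j^2+Y_j^2),\qquad X_j=\partial_{x_j}-\tfrac{y_j}{2}\partial_t,\quad Y_j=\partial_{y_j}+\tfrac{x_j}{2}\partial_t,$$ be the sub-Laplacian. Denote also by $-\mathcal L$ the non-negative self-adjoint operator on $L^2(\mathbb H^n)$ (complex-valued functions) that extends $-\mathcal L$ on $C_c^\infty(\mathbb H^n)$, and let $H^1_{\mathcal L}(\mathbb H^n)$ be the domain of $(I-\mathcal L)^{1/2}$ with the norm $\|u\|_{H^1_{\mathcal L}}=\|(I-\mathcal L)^{1/2}u\|_{L^2}$. Let $b>0$, $m>0$ and $1<p\le 1+\tfrac1n$. Let $f:\mathbb C\to\mathbb C$ satisfy $f(0)=0$ and, for some constant $C$, $$|f(u)-f(v)|\le C\,(|u|^{p-1}+|v|^{p-1})\,|u-v|\qquad(u,v\in\mathbb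 C).$$ Then there exist $\varepsilon_0>0$, $\delta_0>0$ and a constant $K$ such that for all $u_0\in H^1_{\mathcal L}(\mathbb H^n)$ and $u_1\in L^2(\mathbb H^n)$ with $$\|u_0\|_{H^1_{\mathcal L}(\mathbb H^n)}+\|u_1\|_{L^2(\mathbb H^n)}\le\varepsilon_0$$ the Cauchy problem $$\partial_t^2u(t)-\mathcal L u(t)+b\,\partial_tu(t)+m\,u(t)=f(u(t))\quad(t>0),\qquad u(0)=u_0,\qquad \partial_tu(0)=u_1,$$ where the equation is understood for each $t>0$ in the sense of distributions on $\mathbb H^n$, has a unique global solution $u\in C([0,\infty);H^1_{\mathcal L}(\mathbb H^n))\cap C^1([0,\infty);L^2(\mathbb H^n))$, and this solution satisfies, for all $t\ge0$, $$\|u(t)\|_{L^2}\le K e^{-\delta_0t},\qquad \|(-\mathcal L)^{1/2}u(t)\|_{L^2}\le Ke^{-\delta_0t},\qquad \|\partial_tu(t)\|_{L^2}\le Ke^{-\delta_0t}.$$ -/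

import Mathlib

open MeasureTheory Set
open scoped ContDiff

noncomputable section

namespace Heisenberg

/-- The underlying manifold `ℝⁿ × ℝⁿ × ℝ` of the Heisenberg group `ℍⁿ`, with points `(x, y, t)`.
The group law is `(x, y, t) ∘ (x', y', t') = (x + x', y + y', t + t' + (x ⬝ y' - x' ⬝ y) / 2)`; it
enters only through the left-invariant vector fields `X j`, `Y j` below and through the Haar
measure, which is Lebesgue measure `volume`. -/
abbrev Heis (n : ℕ) : Type := (Fin n → ℝ) × (Fin n → ℝ) × ℝ

/-- The left-invariant vector field `X_j = ∂_{x_j} - (y_j / 2) ∂_t`. -/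
def X {n : ℕ} (j : Fin n) (φ : Heis n → ℂ) (z : Heis n) : ℂ :=
  fderiv ℝ φ z (Pi.single j 1, 0, -(z.2.1 j) / 2)

/-- The left-invariant vector field `Y_j = ∂_{y_j} + (x_j / 2) ∂_t`. -/
def Y {n : ℕ} (j : Fin n) (φ : Heis n → ℂ) (z : Heis n) : ℂ :=
  fderiv ℝ φ z (0, Pi.single j 1, z.1 j / 2)

/-- The sub-Laplacian `𝓛 = ∑ j, (X_j² + Y_j²)` on smooth functions. -/
def subLaplacian {n : ℕ} (φ : Heis n → ℂ) (z : Heis n) : ℂ :=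
  ∑ j, (X j (X j φ) z + Y j (Y j φ) z)

/-- The test functions `C_c^∞(ℍⁿ)` (complex valued). -/
def IsTest {n : ℕ} (φ : Heis n → ℂ) : Prop :=
  ContDiff ℝ ∞ φ ∧ HasCompactSupport φ

/-- The complex Hilbert space `L²(ℍⁿ)`. -/
abbrev L2 (n : ℕ) : Type := Lp ℂ 2 (volume : Measure (Heis n))

/-- The Hilbert sum of `2n + 1` copies of `L²(ℍⁿ)`: one slot (`none`) for a function and one slot
for each component of its horizontal gradient. -/
abbrev GradSpace (n : ℕ) : Type := PiLp 2 (fun _ : Option (Fin n ⊕ Fin n) => L2 n)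

/-- The domain of the closure of the quadratic form
`φ ↦ ⟨(I - 𝓛) φ, φ⟩ = ‖φ‖² + ∑ j, (‖X_j φ‖² + ‖Y_j φ‖²)` on `C_c^∞(ℍⁿ)`, realised as
the closure in `GradSpace n` of the set of tuples `(φ, X φ, Y φ)`; it is a Hilbert space. -/
def formDomain (n : ℕ) : Submodule ℂ (GradSpace n) :=
  (Submodule.span ℂ {w : GradSpace n | ∃ φ : Heis n → ℂ, IsTest φ ∧
    w none =ᵐ[volume] φ ∧
    ∀ j : Fin n, w (some (Sum.inl j)) =ᵐ[volume] X j φ ∧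
      w (some (Sum.inr j)) =ᵐ[volume] Y j φ}).topologicalClosure

instance (n : ℕ) : CompleteSpace (formDomain n) :=
  inferInstanceAs (CompleteSpace (Submodule.topologicalClosure _))

/-- The inclusion of the form domain into `L²(ℍⁿ)`. -/
def formEmbedding (n : ℕ) : formDomain n →L[ℂ] L2 n :=
  (PiLp.proj 2 (fun _ : Option (Fin n ⊕ Fin n) => L2 n) none : GradSpace n →L[ℂ] L2 n) ∘L
    (formDomain n).subtypeL

/-- The bounded positive operator `(I - 𝓛)⁻¹` on `L²(ℍⁿ)`, where `-𝓛` is the (unique) non-negative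
self-adjoint operator extending `-𝓛` on `C_c^∞(ℍⁿ)`, i.e. the operator of the closed form above:
`u = (I - 𝓛)⁻¹ g` iff `u` is in the form domain and
`⟨u, v⟩ + ∑ j, (⟨X_j u, X_j v⟩ + ⟨Y_j u, Y_j v⟩) = ⟨g, v⟩` for all `v` in the form domain. If `J` is
the inclusion of the form domain, this says that `u = J (J† g)`. -/
def resolvent (n : ℕ) : L2 n →L[ℂ] L2 n :=
  formEmbedding n ∘L ContinuousLinearMap.adjoint (formEmbedding n)

/-- The positive square root of a bounded positive operator on a complex Hilbert space, given by
the continuous functional calculus. -/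
def opSqrt {H : Type*} [NormedAddCommGroup H] [InnerProductSpace ℂ H] [CompleteSpace H]
    (T : H →L[ℂ] H) : H →L[ℂ] H := CFC.sqrt T

/-- The operator `(I - 𝓛)^{-1/2}`, the positive square root of `(I - 𝓛)⁻¹`; it is bounded, positive
and injective. -/
def invSqrt (n : ℕ) : L2 n →L[ℂ] L2 n := opSqrt (resolvent n)

/-- Membership in `H¹_𝓛(ℍⁿ) = {u : (I - 𝓛)^{1/2} u ∈ L²}`, the range of `(I - 𝓛)^{-1/2}`
on `L²(ℍⁿ)`. -/
def MemH1 {n : ℕ} (u : L2 n) : Prop := u ∈ range (invSqrt n)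

/-- `(I - 𝓛)^{1/2} u` for `u` in `H¹_𝓛(ℍⁿ)`: the inverse of `(I - 𝓛)^{-1/2}`. -/
def sqrtOneSub {n : ℕ} (u : L2 n) : L2 n := Function.invFun (invSqrt n) u

/-- The norm `‖u‖_{H¹_𝓛} = ‖(I - 𝓛)^{1/2} u‖_{L²}`, for `u` in `H¹_𝓛(ℍⁿ)`. -/
def normH1 {n : ℕ} (u : L2 n) : ℝ := ‖sqrtOneSub u‖

/-- `(-𝓛)^{1/2} u` for `u` in `H¹_𝓛(ℍⁿ)`. If `R = (I - 𝓛)⁻¹` then `-𝓛 = (I - R) R⁻¹`, hence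
`(-𝓛)^{1/2} = (I - R)^{1/2} R^{-1/2}`, with domain the range of `R^{1/2}`. -/
def sqrtNeg {n : ℕ} (u : L2 n) : L2 n := opSqrt (1 - resolvent n) (sqrtOneSub u)

/-- The time derivative `∂_t u(t)` in `L²(ℍⁿ)` on `[0, ∞)`, one-sided at `t = 0`. -/
def dt {n : ℕ} (u : ℝ → L2 n) (t : ℝ) : L2 n := derivWithin u (Ici 0) t

/-- `u ∈ C([0, ∞); H¹_𝓛) ∩ C¹([0, ∞); L²)` is a global solution of
`∂_t² u - 𝓛 u + b ∂_t u + m u = f(u)` for `t > 0`, `u(0) = u₀`, `∂_t u(0) = u₁`. The equation is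
understood at each time `t > 0` in the sense of distributions on `ℍⁿ`. -/
structure IsSolution {n : ℕ} (b m : ℝ) (f : ℂ → ℂ) (u₀ u₁ : L2 n) (u : ℝ → L2 n) : Prop where
  memH1 : ∀ t, 0 ≤ t → MemH1 (u t)
  continuous_H1 : ContinuousOn (fun t => sqrtOneSub (u t)) (Ici 0)
  contDiff_L2 : ContDiffOn ℝ 1 u (Ici 0)
  locallyIntegrable : ∀ t, 0 < t → LocallyIntegrable (fun z => f (u t z)) volume
  equation : ∀ φ : Heis n → ℂ, IsTest φ → ∀ t, 0 < t →
    HasDerivAt (fun s => ∫ z, dt u s z * φ z)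
      ((∫ z, u t z * subLaplacian φ z) - b * (∫ z, dt u t z * φ z)
        - m * (∫ z, u t z * φ z) + ∫ z, f (u t z) * φ z) t
  initial : u 0 = u₀
  initial_dt : dt u 0 = u₁

end Heisenberg

end

/-!
Put `S = (I - 𝓛)^{-1/2}`, a positive injective contraction of `L²(ℍⁿ)`, and use the energy variables
`σ = (I - 𝓛)^{1/2} u` and `v = ∂_t u`. The Cauchy problem becomes the integrated form of
`(S σ)' = v`, `(S v)' = -P σ - b S v + S N(σ)`, where `P = S (m - 𝓛) S = I - (1 - m) S²` is bounded
and bounded below by `min 1 m`, and `N σ = f ∘ (S σ)`. Only bounded operators occur, so the linear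
and semilinear theory takes place in an abstract real Hilbert space (namespace `DampedWave`).

*Linear decay.* Replacing `S⁻¹` by the bounded operator `(S + ε)⁻¹` gives a group of exponentials of
bounded operators. The energy `⟪P σ, σ⟫ + ‖v‖²`, perturbed by a small multiple of `⟪(S + ε) σ, v⟫`,
decays exponentially at a rate independent of `ε` (`exists_energy_decay`): the damping controls `v`
and the cross term, by `m > 0`, controls `σ`. As `ε → 0` these groups converge to a propagator with
Duhamel's formula (`exists_isPropagator`). Uniqueness for the linear equation holds for merely
continuous `(σ, v)` because the lower-order energy `‖S v‖² + ⟪P S σ, S σ⟫` can be differentiated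
(`eq_zero_of_linear`); hence every solution of the integrated equation is given by Duhamel's formula.

*Semilinear equation.* If `‖N σ - N τ‖ ≤ L (‖σ‖^q + ‖τ‖^q) ‖σ - τ‖` with `q > 0` and `N 0 = 0`, the
Duhamel map is a contraction on a small ball of an exponentially weighted space of continuous
functions (`exists_global_solution`), and solutions are unique without any restriction on their size
(`IsIntegralSolution.eqOn`).

*Nonlinear estimate.* With `q = p - 1` the bound on `N` follows from Hölder's inequality and the
embedding `H¹_𝓛 ⊆ L^{2p}`, where `2p ≤ 2 + 2/n` is at most the critical exponent. The critical
Sobolev inequality (`exists_sobolev`) is obtained from the invariance of Lebesgue measure under the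
group translations: translation in `L²` by an element of homogeneous size `r` moves a function by at
most `5 r` times the norm of its horizontal gradient, since central elements are commutators
(`shiftNorm_le`). Averaging over a box gives a weak-type inequality, which truncation at dyadic
levels turns into the strong one. It passes to all of `H¹_𝓛` through the form domain: the
factorisation `S = J ∘ formLift`, with `J` the inclusion of the form domain into `L²`
(`formEmbedding_formLift`), identifies the range of `S` with the form domain.

*Translation.* Integration by parts gives `(I - 𝓛)⁻¹ (φ - 𝓛 φ) = φ` for test functions
(`resolvent_helmholtz`), so testing against `φ` is pairing with the vector `S (φ̄ - 𝓛 φ̄)`. These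
vectors are total (`eq_zero_of_inner_probe`), which makes the distributional equation at every time
`t > 0` equivalent to the integrated system.
-/

/-! ### Energy decay for the regularised damped wave equation -/

namespace DampedWave

open Filter
open scoped RealInnerProductSpace Topology

variable {H : Type*} [NormedAddCommGroup H] [InnerProductSpace ℝ H]

/-- `S` is a positive injective contraction of a real Hilbert space. It plays the role of
`(I + A)^{-1/2}` for a non-negative self-adjoint operator `A`. -/
structure IsPosContraction (S : H →L[ℝ] H) : Prop where
  symm : ∀ x y, ⟪S x, y⟫ = ⟪x, S y⟫
  nonneg : ∀ x, 0 ≤ ⟪S x, x⟫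
  norm_le : ∀ x, ‖S x‖ ≤ ‖x‖
  inj : Function.Injective S

/-- The bounded operator `S (A + m) S = I - (1 - m) S²`, where `S = (I + A)^{-1/2}`. -/
def stiffness (S : H →L[ℝ] H) (m : ℝ) : H →L[ℝ] H := 1 - (1 - m) • (S * S)

lemma stiffness_apply (S : H →L[ℝ] H) (m : ℝ) (x : H) :
    stiffness S m x = x - (1 - m) • S (S x) := rfl

section Stiffness

variable {S : H →L[ℝ] H} (hS : IsPosContraction S) {m : ℝ}
include hS

lemma inner_stiffness (x y : H) : ⟪stiffness S m x, y⟫ = ⟪x, y⟫ - (1 - m) * ⟪S x, S y⟫ := by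
  rw [stiffness_apply, inner_sub_left, real_inner_smul_left, hS.symm (S x) y]

lemma stiffness_symm (x y : H) : ⟪stiffness S m x, y⟫ = ⟪x, stiffness S m y⟫ := by
  rw [inner_stiffness hS, real_inner_comm (stiffness S m y) x, inner_stiffness hS, real_inner_comm x,
    real_inner_comm (S x)]

lemma le_inner_stiffness (x : H) :
    min 1 m * ‖x‖ ^ 2 ≤ ⟪stiffness S m x, x⟫ := by
  rw [inner_stiffness hS, real_inner_self_eq_norm_sq, real_inner_self_eq_norm_sq]
  have h : ‖S x‖ ^ 2 ≤ ‖x‖ ^ 2 := by have := hS.norm_le x; gcongr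
  rcases le_total 1 m with h1 | h1
  · rw [min_eq_left h1]; nlinarith [sq_nonneg ‖S x‖]
  · rw [min_eq_right h1]; nlinarith [sq_nonneg ‖S x‖]

lemma inner_stiffness_le (hm : 0 < m) (x : H) :
    ⟪stiffness S m x, x⟫ ≤ (1 + m) * ‖x‖ ^ 2 := by
  rw [inner_stiffness hS, real_inner_self_eq_norm_sq, real_inner_self_eq_norm_sq]
  have h : ‖S x‖ ^ 2 ≤ ‖x‖ ^ 2 := by have := hS.norm_le x; gcongr
  nlinarith [sq_nonneg ‖S x‖]

end Stiffness

/-- `Λ` is the inverse of `S + ε`. -/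
structure IsInvAdd (S : H →L[ℝ] H) (ε : ℝ) (Λ : H →L[ℝ] H) : Prop where
  add_apply : ∀ x, S (Λ x) + ε • Λ x = x
  apply_add : ∀ x, Λ (S x + ε • x) = x

lemma exists_isInvAdd [CompleteSpace H] {S : H →L[ℝ] H} (hS : IsPosContraction S) {ε : ℝ}
    (hε : 0 < ε) : ∃ Λ, IsInvAdd S ε Λ := by
  let B : H →L[ℝ] H →L[ℝ] ℝ := (innerSL ℝ).comp (S + ε • 1)
  have hB : ∀ x y, B x y = ⟪S x + ε • x, y⟫ := fun x y => rfl
  have hc : IsCoercive B := by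
    refine ⟨ε, hε, fun x => ?_⟩
    rw [hB, inner_add_left, real_inner_smul_left, real_inner_self_eq_norm_sq]
    nlinarith [hS.nonneg x]
  have he : ∀ x, hc.continuousLinearEquivOfBilin x = S x + ε • x := fun x =>
    (hc.unique_continuousLinearEquivOfBilin (fun w => (hB x w).symm)).symm
  refine ⟨hc.continuousLinearEquivOfBilin.symm, fun x => ?_, fun x => ?_⟩
  · exact (he _).symm.trans (hc.continuousLinearEquivOfBilin.apply_symm_apply x)
  · rw [← he]; exact hc.continuousLinearEquivOfBilin.symm_apply_apply x

section Inv

variable {S Λ : H →L[ℝ] H} (hS : IsPosContraction S) {ε : ℝ} (h : IsInvAdd S ε Λ)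
include h

lemma IsInvAdd.comm (x : H) : Λ (S x) = S (Λ x) := by
  conv_lhs => rw [← h.add_apply x]
  rw [map_add S, map_smul S, h.apply_add]

lemma IsInvAdd.comm_stiffness (m : ℝ) (x : H) :
    Λ (stiffness S m x) = stiffness S m (Λ x) := by
  simp only [stiffness_apply, map_sub, map_smul, h.comm]

include hS

lemma IsInvAdd.symm (x y : H) : ⟪Λ x, y⟫ = ⟪x, Λ y⟫ := by
  conv_lhs => rw [← h.add_apply y]
  conv_rhs => rw [← h.add_apply x]
  simp only [inner_add_left, inner_add_right, real_inner_smul_left, real_inner_smul_right, hS.symm]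

lemma IsInvAdd.norm_comp_le (hε : 0 < ε) (x : H) : ‖S (Λ x)‖ ≤ ‖x‖ := by
  conv_rhs => rw [← h.add_apply x]
  refine abs_le_of_sq_le_sq' ?_ (norm_nonneg _) |>.2
  rw [norm_add_sq_real, real_inner_smul_right]
  have := mul_nonneg hε.le (hS.nonneg (Λ x))
  rw [hS.symm, real_inner_comm] at this
  nlinarith [sq_nonneg ‖ε • Λ x‖]

end Inv

/-- The uniform exponential energy decay of the regularised damped wave equation
`σ' = Λ v`, `v' = -P Λ σ - b v`, where `Λ = (S + ε)⁻¹`. The functional that decays is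
`⟪P σ, σ⟫ + ‖v‖² + 2 κ ⟪(S + ε) σ, v⟫`, for a small `κ` that does not depend on `ε`. -/
lemma exists_energy_decay {S : H →L[ℝ] H} (hS : IsPosContraction S) {b m : ℝ} (hb : 0 < b)
    (hm : 0 < m) :
    ∃ δ : ℝ, 0 < δ ∧ ∃ M : ℝ, 0 < M ∧ ∀ ε : ℝ, 0 < ε → ε ≤ 1 → ∀ Λ : H →L[ℝ] H,
      IsInvAdd S ε Λ → ∀ σ v : ℝ → H, (∀ t, HasDerivAt σ (Λ (v t)) t) →
      (∀ t, HasDerivAt v (-stiffness S m (Λ (σ t)) - b • v t) t) →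
      ∀ t, 0 ≤ t → ‖(σ t, v t)‖ ≤ M * Real.exp (-δ * t) * ‖(σ 0, v 0)‖ := by
  set c := min 1 m with hc
  have hc0 : 0 < c := lt_min one_pos hm
  have hc1 : c ≤ 1 := min_le_left _ _
  obtain ⟨κ, hκ0, hκ1, hκ2⟩ : ∃ κ : ℝ, 0 < κ ∧ κ ≤ c / 4 ∧ 2 * κ + 4 * κ * b ^ 2 / c ≤ b := by
    have hq : 0 < 2 + 4 * b ^ 2 / c := by positivity
    refine ⟨min (c / 4) (b / (2 + 4 * b ^ 2 / c)), by positivity, min_le_left _ _, ?_⟩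
    calc _ = min (c / 4) (b / (2 + 4 * b ^ 2 / c)) * (2 + 4 * b ^ 2 / c) := by ring
      _ ≤ b / (2 + 4 * b ^ 2 / c) * (2 + 4 * b ^ 2 / c) := by gcongr; exact min_le_right _ _
      _ = b := by field_simp
  set δ := min b κ / 3 with hδ
  have hδ0 : 0 < δ := by have := lt_min hb hκ0; positivity
  have hδb : 3 * δ ≤ b := by have := min_le_left b κ; rw [hδ]; linarith
  have hδκ : 3 * δ ≤ κ := by have := min_le_right b κ; rw [hδ]; linarith
  refine ⟨δ, hδ0, Real.sqrt (6 * (1 + m) / c), by positivity, ?_⟩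
  intro ε hε hε1 Λ hΛ σ v hσ hv t ht
  set P := stiffness S m with hP
  set W : H →L[ℝ] H := S + ε • 1 with hW
  have hWa : ∀ x, W x = S x + ε • x := fun x => rfl
  have hWn : ∀ x, ‖W x‖ ≤ 2 * ‖x‖ := fun x => by
    rw [hWa]
    refine (norm_add_le _ _).trans ?_
    rw [norm_smul, Real.norm_of_nonneg hε.le]
    nlinarith [hS.norm_le x, norm_nonneg x]
  have hWs : ∀ x y, ⟪W x, y⟫ = ⟪x, W y⟫ := fun x y => by
    simp only [hWa, inner_add_left, inner_add_right, real_inner_smul_left, real_inner_smul_right,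
      hS.symm]
  have hcross : ∀ x y, |⟪W x, y⟫| ≤ 2 * ‖x‖ * ‖y‖ := fun x y =>
    (abs_real_inner_le_norm _ _).trans (by have := hWn x; gcongr)
  let En : ℝ → ℝ := fun t => ⟪P (σ t), σ t⟫ + ⟪v t, v t⟫ + 2 * κ * ⟪W (σ t), v t⟫
  have hEd : ∀ t, HasDerivAt En (-(2 * (b - κ)) * ‖v t‖ ^ 2 - 2 * κ * ⟪P (σ t), σ t⟫
      - 2 * κ * b * ⟪W (σ t), v t⟫) t := by
    intro t
    have h1 := (P.hasFDerivAt.comp_hasDerivAt t (hσ t)).inner ℝ (hσ t)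
    have h2 := (hv t).inner ℝ (hv t)
    have h3 := ((W.hasFDerivAt.comp_hasDerivAt t (hσ t)).inner ℝ (hv t)).const_mul (2 * κ)
    refine ((h1.add h2).add h3).congr_deriv ?_
    have e1 : W (Λ (v t)) = v t := hΛ.add_apply _
    have e2 : ⟪W (σ t), P (Λ (σ t))⟫ = ⟪P (σ t), σ t⟫ := by
      rw [← hΛ.comm_stiffness, hWs, hWa, hΛ.add_apply, real_inner_comm]
    have e3 : ⟪P (Λ (v t)), σ t⟫ = ⟪v t, P (Λ (σ t))⟫ := by
      rw [hP, stiffness_symm hS, hΛ.symm hS, hΛ.comm_stiffness]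
    have e4 : ⟪P (σ t), Λ (v t)⟫ = ⟪v t, P (Λ (σ t))⟫ := by
      rw [hP, real_inner_comm, hΛ.symm hS, hΛ.comm_stiffness]
    simp only [Function.comp, inner_sub_left, inner_sub_right, inner_neg_left, inner_neg_right,
      real_inner_smul_left, real_inner_smul_right, e1, e2, e3, e4, real_inner_self_eq_norm_sq]
    rw [real_inner_comm (v t) (P (Λ (σ t)))]
    ring
  have hPl : ∀ x, c * ‖x‖ ^ 2 ≤ ⟪P x, x⟫ := le_inner_stiffness hS
  have hPu : ∀ x, ⟪P x, x⟫ ≤ (1 + m) * ‖x‖ ^ 2 := inner_stiffness_le hS hm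
  have hcr : ∀ t, |2 * κ * ⟪W (σ t), v t⟫| ≤ (⟪P (σ t), σ t⟫ + ‖v t‖ ^ 2) / 2 := by
    intro t
    rw [abs_mul, abs_of_pos (by positivity)]
    have h1 := hcross (σ t) (v t)
    have h2 := hPl (σ t)
    have h3 : 2 * κ * |⟪W (σ t), v t⟫| ≤ 2 * κ * (2 * ‖σ t‖ * ‖v t‖) := by gcongr
    have h4 : 2 * κ * (2 * ‖σ t‖ * ‖v t‖) ≤ 2 * κ * (‖σ t‖ ^ 2 + ‖v t‖ ^ 2) := by
      gcongr; nlinarith [sq_nonneg (‖σ t‖ - ‖v t‖)]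
    nlinarith [sq_nonneg ‖σ t‖, sq_nonneg ‖v t‖]
  have hE1 : ∀ t, (⟪P (σ t), σ t⟫ + ‖v t‖ ^ 2) / 2 ≤ En t := fun t => by
    have := (abs_le.1 (hcr t)).1
    simp only [En, real_inner_self_eq_norm_sq]; linarith
  have hE2 : ∀ t, En t ≤ 3 / 2 * (⟪P (σ t), σ t⟫ + ‖v t‖ ^ 2) := fun t => by
    have := (abs_le.1 (hcr t)).2
    simp only [En, real_inner_self_eq_norm_sq]; linarith
  have hEle : ∀ t, -(2 * (b - κ)) * ‖v t‖ ^ 2 - 2 * κ * ⟪P (σ t), σ t⟫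
      - 2 * κ * b * ⟪W (σ t), v t⟫ ≤ -(2 * δ) * En t := by
    intro t
    have h0 := hPl (σ t)
    have h1 := (abs_le.1 (hcross (σ t) (v t))).1
    -- Young's inequality absorbs the cross term into the two good terms.
    have h2 : b * (2 * ‖σ t‖ * ‖v t‖) ≤ c / 2 * ‖σ t‖ ^ 2 + 2 * b ^ 2 / c * ‖v t‖ ^ 2 := by
      have : c / 2 * ‖σ t‖ ^ 2 + 2 * b ^ 2 / c * ‖v t‖ ^ 2 - b * (2 * ‖σ t‖ * ‖v t‖)
          = (c * ‖σ t‖ - 2 * b * ‖v t‖) ^ 2 / (2 * c) := by field_simp; ring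
      have : 0 ≤ (c * ‖σ t‖ - 2 * b * ‖v t‖) ^ 2 / (2 * c) := by positivity
      linarith
    have h3 : -(b * ⟪W (σ t), v t⟫) ≤ b * (2 * ‖σ t‖ * ‖v t‖) := by nlinarith
    have h4 : 2 * κ * (-(b * ⟪W (σ t), v t⟫)) ≤
        2 * κ * (⟪P (σ t), σ t⟫ / 2 + 2 * b ^ 2 / c * ‖v t‖ ^ 2) := by
      gcongr; linarith
    have h5 : (2 * κ + 4 * κ * b ^ 2 / c) * ‖v t‖ ^ 2 ≤ b * ‖v t‖ ^ 2 := by gcongr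
    have h6 : -(2 * (b - κ)) * ‖v t‖ ^ 2 - 2 * κ * ⟪P (σ t), σ t⟫ - 2 * κ * b * ⟪W (σ t), v t⟫
        ≤ -b * ‖v t‖ ^ 2 - κ * ⟪P (σ t), σ t⟫ := by
      have : 2 * κ * (2 * b ^ 2 / c * ‖v t‖ ^ 2) = 4 * κ * b ^ 2 / c * ‖v t‖ ^ 2 := by ring
      nlinarith
    have h7 : 2 * δ * En t ≤ 2 * δ * (3 / 2 * (⟪P (σ t), σ t⟫ + ‖v t‖ ^ 2)) := by
      gcongr; exact hE2 t
    have h8 : 0 ≤ ⟪P (σ t), σ t⟫ := le_trans (by positivity) h0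
    have h9 : 3 * δ * ‖v t‖ ^ 2 ≤ b * ‖v t‖ ^ 2 := by gcongr
    have h10 : 3 * δ * ⟪P (σ t), σ t⟫ ≤ κ * ⟪P (σ t), σ t⟫ := by gcongr
    linarith
  have hanti : Antitone fun t => En t * Real.exp (2 * δ * t) := by
    have hd : ∀ t, HasDerivAt (fun t => En t * Real.exp (2 * δ * t)) _ t := fun t =>
      (hEd t).mul ((((hasDerivAt_id t).const_mul (2 * δ))).exp)
    refine antitone_of_deriv_nonpos (fun t => (hd t).differentiableAt) fun t => ?_
    rw [(hd t).deriv]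
    have := mul_le_mul_of_nonneg_right (hEle t) (Real.exp_pos (2 * δ * t)).le
    simp only [id, mul_one]
    nlinarith
  have hfin := hanti ht
  simp only [mul_zero, Real.exp_zero, mul_one] at hfin
  set N := ‖(σ 0, v 0)‖ with hN
  have hN0 : 0 ≤ N := norm_nonneg _
  have n1 : ‖σ 0‖ ≤ N := norm_fst_le (σ 0, v 0)
  have n2 : ‖v 0‖ ≤ N := norm_snd_le (σ 0, v 0)
  have hEN : En 0 ≤ 3 * (1 + m) * N ^ 2 := by
    have h1 := hE2 0
    have h2 := hPu (σ 0)
    have h3 : ‖σ 0‖ ^ 2 ≤ N ^ 2 := by gcongr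
    have h4 : ‖v 0‖ ^ 2 ≤ N ^ 2 := by gcongr
    nlinarith [sq_nonneg N]
  have hEt : En t ≤ 3 * (1 + m) * N ^ 2 * Real.exp (-δ * t) ^ 2 := by
    have h1 : En t = (En t * Real.exp (2 * δ * t)) * Real.exp (-δ * t) ^ 2 := by
      rw [mul_assoc, ← Real.exp_nat_mul, ← Real.exp_add]
      push_cast
      rw [show 2 * δ * t + 2 * (-δ * t) = 0 by ring, Real.exp_zero, mul_one]
    rw [h1]; exact mul_le_mul_of_nonneg_right (hfin.trans hEN) (by positivity)
  have hsq : ∀ y : ℝ, 0 ≤ y → c / 2 * y ^ 2 ≤ En t →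
      y ≤ Real.sqrt (6 * (1 + m) / c) * Real.exp (-δ * t) * N := by
    intro y hy h
    refine abs_le_of_sq_le_sq' ?_ (by positivity) |>.2
    rw [mul_pow, mul_pow, Real.sq_sqrt (by positivity)]
    have h1 := h.trans hEt
    have h2 : y ^ 2 ≤ 2 / c * (3 * (1 + m) * N ^ 2 * Real.exp (-δ * t) ^ 2) := by
      calc y ^ 2 = 2 / c * (c / 2 * y ^ 2) := by field_simp
        _ ≤ _ := by gcongr
    refine h2.trans (le_of_eq ?_)
    ring
  have h0 := hPl (σ t)
  have h1 := hE1 t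
  refine max_le (hsq _ (norm_nonneg _) ?_) (hsq _ (norm_nonneg _) ?_)
  · show c / 2 * ‖σ t‖ ^ 2 ≤ _
    nlinarith [sq_nonneg ‖v t‖]
  · show c / 2 * ‖v t‖ ^ 2 ≤ _
    nlinarith [sq_nonneg ‖v t‖, sq_nonneg ‖σ t‖]

end DampedWave

/-! ### Evolution generated by a bounded operator -/

namespace DampedWave

open Filter
open scoped RealInnerProductSpace Topology

variable {H : Type*} [NormedAddCommGroup H] [InnerProductSpace ℝ H]

/-- The operator `A ⊕ A` on `H × H`. -/
def diag (A : H →L[ℝ] H) : H × H →L[ℝ] H × H := A.prodMap A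

@[simp] lemma diag_apply (A : H →L[ℝ] H) (x : H × H) : diag A x = (A x.1, A x.2) := rfl

/-- The operator `(σ, v) ↦ (v, -P σ - b S v)`. The damped wave equation for `u = S σ`, `v = u'`
reads `(S ⊕ S) U' = B U` with this operator `B` and `U = (σ, v)`. -/
def waveOp (S : H →L[ℝ] H) (b m : ℝ) : H × H →L[ℝ] H × H :=
  (ContinuousLinearMap.snd ℝ H H).prod
    (-((stiffness S m).comp (ContinuousLinearMap.fst ℝ H H))
      - b • S.comp (ContinuousLinearMap.snd ℝ H H))

@[simp] lemma waveOp_apply (S : H →L[ℝ] H) (b m : ℝ) (x : H × H) :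
    waveOp S b m x = (x.2, -stiffness S m x.1 - b • S x.2) := rfl

/-- The bounded generator `(σ, v) ↦ (Λ v, -P Λ σ - b v)` of the regularised evolution, in which
`Λ = (S + ε)⁻¹` replaces the unbounded operator `S⁻¹`. -/
def regGen (S Λ : H →L[ℝ] H) (b m : ℝ) : H × H →L[ℝ] H × H :=
  (Λ.comp (ContinuousLinearMap.snd ℝ H H)).prod
    (-((stiffness S m).comp (Λ.comp (ContinuousLinearMap.fst ℝ H H)))
      - b • ContinuousLinearMap.snd ℝ H H)

@[simp] lemma regGen_apply (S Λ : H →L[ℝ] H) (b m : ℝ) (x : H × H) :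
    regGen S Λ b m x = (Λ x.2, -stiffness S m (Λ x.1) - b • x.2) := rfl

lemma IsPosContraction.denseRange [CompleteSpace H] {S : H →L[ℝ] H} (hS : IsPosContraction S) :
    DenseRange S := by
  have h : (LinearMap.range (S : H →ₗ[ℝ] H))ᗮ = ⊥ := by
    rw [Submodule.eq_bot_iff]
    intro x hx
    apply hS.inj
    rw [map_zero]
    refine ext_inner_left ℝ fun y => ?_
    rw [inner_zero_right, ← hS.symm]
    exact hx _ ⟨y, rfl⟩
  have h2 := (Submodule.topologicalClosure_eq_top_iff).2 h
  intro x
  have : x ∈ (LinearMap.range (S : H →ₗ[ℝ] H)).topologicalClosure := h2 ▸ Submodule.mem_top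
  exact this

section Flow

variable {E : Type*} [NormedAddCommGroup E] [NormedSpace ℝ E]

/-- The one-parameter group `exp (t G)` generated by a bounded operator `G`. -/
noncomputable def expFlow (G : E →L[ℝ] E) (t : ℝ) : E →L[ℝ] E := NormedSpace.exp (t • G)

@[simp] lemma expFlow_zero (G : E →L[ℝ] E) (x : E) : expFlow G 0 x = x := by
  simp [expFlow]

lemma Commute.expFlow_apply {A G : E →L[ℝ] E} (h : Commute A G) (t : ℝ) (x : E) :
    A (expFlow G t x) = expFlow G t (A x) :=
  DFunLike.congr_fun ((h.smul_right t).exp_right).eq x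

variable [CompleteSpace E]

lemma expFlow_add (G : E →L[ℝ] E) (r s : ℝ) (y : E) :
    expFlow G r (expFlow G s y) = expFlow G (r + s) y := by
  let _ : NormedAlgebra ℚ (E →L[ℝ] E) := NormedAlgebra.restrictScalars ℚ ℝ _
  rw [expFlow, expFlow, expFlow, add_smul,
    NormedSpace.exp_add_of_commute ((Commute.refl G).smul_left r |>.smul_right s)]
  rfl

lemma hasDerivAt_expFlow (G : E →L[ℝ] E) (t : ℝ) :
    HasDerivAt (expFlow G) (G * expFlow G t) t :=
  hasDerivAt_exp_smul_const' (𝕂 := ℝ) G t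

lemma continuous_expFlow (G : E →L[ℝ] E) : Continuous (expFlow G) :=
  continuous_iff_continuousAt.2 fun t => (hasDerivAt_expFlow G t).continuousAt

lemma hasDerivAt_expFlow_apply (G : E →L[ℝ] E) (x : E) (t : ℝ) :
    HasDerivAt (fun t : ℝ => expFlow G t x) (G (expFlow G t x)) t := by
  simpa using (hasDerivAt_expFlow G t).clm_apply (hasDerivAt_const t x)

lemma hasDerivAt_expFlow_sub_apply (G G' : E →L[ℝ] E) (y : E) (t s : ℝ) :
    HasDerivAt (fun s : ℝ => expFlow G (t - s) (expFlow G' s y))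
      (expFlow G (t - s) ((G' - G) (expFlow G' s y))) s := by
  have h1 : HasDerivAt (fun s : ℝ => expFlow G (t - s))
      ((-1 : ℝ) • (expFlow G (t - s) * G)) s :=
    (hasDerivAt_exp_smul_const (𝕂 := ℝ) G (t - s)).scomp s ((hasDerivAt_id s).const_sub t)
  refine (h1.clm_apply (hasDerivAt_expFlow_apply G' y s)).congr_deriv ?_
  simp [sub_eq_add_neg, add_comm]

/-- Variation of constants for a bounded generator. -/
lemma hasDerivAt_expFlow_duhamel (G : E →L[ℝ] E) (x : E) {F : ℝ → E} (hF : Continuous F) (t : ℝ) :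
    HasDerivAt (fun t => expFlow G t x + ∫ s in (0:ℝ)..t, expFlow G (t - s) (F s))
      (G (expFlow G t x + ∫ s in (0:ℝ)..t, expFlow G (t - s) (F s)) + F t) t := by
  have hic : Continuous fun s : ℝ => expFlow G (-s) (F s) :=
    ((continuous_expFlow G).comp continuous_neg).clm_apply hF
  have hId : HasDerivAt (fun t => x + ∫ s in (0:ℝ)..t, expFlow G (-s) (F s))
      (expFlow G (-t) (F t)) t := (hic.integral_hasStrictDerivAt 0 t).hasDerivAt.const_add x
  have heq : ∀ t, expFlow G t x + ∫ s in (0:ℝ)..t, expFlow G (t - s) (F s)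
      = expFlow G t (x + ∫ s in (0:ℝ)..t, expFlow G (-s) (F s)) := by
    intro t
    rw [map_add, ← ContinuousLinearMap.intervalIntegral_comp_comm _ (hic.intervalIntegrable _ _)]
    simp only [expFlow_add, sub_eq_add_neg]
  simp only [heq]
  refine ((hasDerivAt_expFlow G t).clm_apply hId).congr_deriv ?_
  rw [expFlow_add, add_neg_cancel, expFlow_zero]
  rfl

end Flow

section Reg

variable {S : H →L[ℝ] H} {b m : ℝ}

lemma IsInvAdd.comm_of {Λ A : H →L[ℝ] H} {ε : ℝ} (h : IsInvAdd S ε Λ)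
    (hA : ∀ x, A (S x) = S (A x)) (x : H) : A (Λ x) = Λ (A x) := by
  conv_rhs => rw [← h.add_apply x]
  rw [map_add A, map_smul A, hA, h.apply_add]

lemma regGen_commute {Λ A : H →L[ℝ] H} {ε : ℝ} (h : IsInvAdd S ε Λ)
    (hA : ∀ x, A (S x) = S (A x)) : Commute (diag A) (regGen S Λ b m) := by
  have h1 : ∀ x, A (Λ x) = Λ (A x) := h.comm_of hA
  have h2 : ∀ x, A (stiffness S m x) = stiffness S m (A x) := fun x => by
    simp only [stiffness_apply, map_sub, map_smul, hA]
  refine ContinuousLinearMap.ext fun x => ?_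
  show diag A (regGen S Λ b m x) = regGen S Λ b m (diag A x)
  simp only [diag_apply, regGen_apply, map_sub, map_neg, map_smul, h1, h2]

variable [CompleteSpace H]

/-- The energy decay in terms of the exponential of the generator, uniformly in `ε`. -/
lemma exists_norm_exp_regGen_le (hS : IsPosContraction S) (hb : 0 < b) (hm : 0 < m) :
    ∃ δ : ℝ, 0 < δ ∧ ∃ M : ℝ, 0 < M ∧ ∀ ε : ℝ, 0 < ε → ε ≤ 1 → ∀ Λ : H →L[ℝ] H,
      IsInvAdd S ε Λ → ∀ x : H × H, ∀ t, 0 ≤ t →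
        ‖expFlow (regGen S Λ b m) t x‖ ≤ M * Real.exp (-δ * t) * ‖x‖ := by
  obtain ⟨δ, hδ, M, hM, h⟩ := exists_energy_decay hS hb hm
  refine ⟨δ, hδ, M, hM, fun ε hε hε1 Λ hΛ x t ht => ?_⟩
  have hd := hasDerivAt_expFlow_apply (regGen S Λ b m) x
  have := h ε hε hε1 Λ hΛ (fun t => (expFlow (regGen S Λ b m) t x).1)
    (fun t => (expFlow (regGen S Λ b m) t x).2) (fun t => (hd t).fst)
    (fun t => (hd t).snd) t ht
  simpa using this

/-- The regularised evolutions form a Cauchy family, uniformly in time, on the dense range of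
`S² ⊕ S²`. -/
lemma exists_norm_exp_sub_exp_le (hS : IsPosContraction S) {δ M : ℝ} (hδ : 0 < δ) (hM : 0 < M)
    (hbd : ∀ ε : ℝ, 0 < ε → ε ≤ 1 → ∀ Λ : H →L[ℝ] H,
      IsInvAdd S ε Λ → ∀ x : H × H, ∀ t, 0 ≤ t →
        ‖expFlow (regGen S Λ b m) t x‖ ≤ M * Real.exp (-δ * t) * ‖x‖) :
    ∃ C : ℝ, 0 ≤ C ∧ ∀ ε : ℝ, 0 < ε → ε ≤ 1 → ∀ ε' : ℝ, 0 < ε' → ε' ≤ 1 → ∀ Λ Λ' : H →L[ℝ] H,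
      IsInvAdd S ε Λ → IsInvAdd S ε' Λ' → ∀ z : H × H, ∀ t, 0 ≤ t →
        ‖expFlow (regGen S Λ b m) t (diag (S * S) z)
          - expFlow (regGen S Λ' b m) t (diag (S * S) z)‖ ≤ C * |ε - ε'| * ‖z‖ := by
  set J : H × H →L[ℝ] H × H := (ContinuousLinearMap.snd ℝ H H).prod
    (-((stiffness S m).comp (ContinuousLinearMap.fst ℝ H H))) with hJ
  refine ⟨M ^ 2 * ‖J‖ / δ, by positivity, ?_⟩
  intro ε hε hε1 ε' hε' hε1' Λ Λ' hΛ hΛ' z t ht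
  set G := regGen S Λ b m with hG
  set G' := regGen S Λ' b m with hG'
  have hΛc : ∀ x, Λ (S x) = S (Λ x) := hΛ.comm
  have hΛc' : ∀ x, Λ' (S x) = S (Λ' x) := hΛ'.comm
  have hdiff : ∀ y, (G' - G) y = J (diag (Λ' - Λ) y) := by
    intro y
    simp only [hJ, hG, hG', sub_apply, regGen_apply, diag_apply,
      ContinuousLinearMap.prod_apply, neg_apply, ContinuousLinearMap.comp_apply,
      ContinuousLinearMap.coe_fst', ContinuousLinearMap.coe_snd', map_sub, Prod.mk_sub_mk]
    congr 1; abel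
  have hres : ∀ x, (Λ' - Λ) (S (S x)) = (ε - ε') • Λ' (S (Λ (S x))) := by
    intro x
    have h1 : Λ' (S (S x)) = Λ' (S (S (Λ (S x)) + ε • Λ (S x))) := by rw [hΛ.add_apply]
    have h2 : Λ (S (S x)) = Λ' (S (S (Λ (S x))) + ε' • S (Λ (S x))) := by
      rw [hΛ'.apply_add, hΛc]
    rw [sub_apply, h1, h2]
    simp only [map_add, map_smul, sub_smul]
    abel
  have hresn : ‖diag (Λ' - Λ) (diag (S * S) z)‖ ≤ |ε - ε'| * ‖z‖ := by
    have key : ∀ x, ‖(Λ' - Λ) (S (S x))‖ ≤ |ε - ε'| * ‖x‖ := by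
      intro x
      rw [hres, norm_smul, Real.norm_eq_abs, hΛc', hΛc]
      gcongr
      exact (hΛ'.norm_comp_le hS hε' _).trans (hΛ.norm_comp_le hS hε _)
    refine max_le ?_ ?_
    · exact (key z.1).trans (by gcongr; exact norm_fst_le z)
    · exact (key z.2).trans (by gcongr; exact norm_snd_le z)
  have hcomm : Commute (diag (Λ' - Λ)) G' := regGen_commute hΛ' fun x => by
    simp only [sub_apply, hΛc, hΛc', map_sub]
  set f : ℝ → H × H := fun s => expFlow G (t - s)
    (expFlow G' s (diag (S * S) z)) with hf
  have hbound : ∀ s ∈ Ico (0:ℝ) t, ‖expFlow G (t - s) ((G' - G)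
      (expFlow G' s (diag (S * S) z)))‖
      ≤ M ^ 2 * ‖J‖ * Real.exp (-δ * t) * (|ε - ε'| * ‖z‖) := by
    intro s hs
    have hc : diag (Λ' - Λ) (expFlow G' s (diag (S * S) z))
        = expFlow G' s (diag (Λ' - Λ) (diag (S * S) z)) :=
      Commute.expFlow_apply hcomm s _
    rw [hdiff, hc]
    calc _ ≤ M * Real.exp (-δ * (t - s)) * (‖J‖ * (M * Real.exp (-δ * s) * (|ε - ε'| * ‖z‖))) := by
            refine (hbd ε hε hε1 Λ hΛ _ (t - s) (by linarith [hs.2])).trans ?_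
            gcongr
            refine (J.le_opNorm _).trans ?_
            gcongr
            refine (hbd ε' hε' hε1' Λ' hΛ' _ s hs.1).trans ?_
            gcongr
      _ = M ^ 2 * ‖J‖ * (Real.exp (-δ * (t - s)) * Real.exp (-δ * s)) * (|ε - ε'| * ‖z‖) := by ring
      _ = _ := by rw [← Real.exp_add]; ring_nf
  have hmv := norm_image_sub_le_of_norm_deriv_le_segment' (f := f) (a := 0) (b := t)
    (fun s _ => (hasDerivAt_expFlow_sub_apply G G' _ t s).hasDerivWithinAt) hbound t ⟨ht, le_rfl⟩
  simp only [hf, sub_self, sub_zero, expFlow_zero] at hmv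
  rw [norm_sub_rev]
  refine hmv.trans ?_
  have hexp : t * Real.exp (-δ * t) ≤ 1 / δ := by
    rw [neg_mul, Real.exp_neg, ← div_eq_mul_inv, div_le_div_iff₀ (Real.exp_pos _) hδ]
    linarith [Real.add_one_le_exp (δ * t)]
  calc _ = M ^ 2 * ‖J‖ * (|ε - ε'| * ‖z‖) * (t * Real.exp (-δ * t)) := by ring
    _ ≤ M ^ 2 * ‖J‖ * (|ε - ε'| * ‖z‖) * (1 / δ) := by gcongr
    _ = _ := by ring

/-- Variation of constants for the regularised evolution. -/
lemma regularized_duhamel {Λ : H →L[ℝ] H} {ε : ℝ} (hΛ : IsInvAdd S ε Λ) (x : H × H)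
    {F : ℝ → H × H} (hF : Continuous F) {U : ℝ → H × H}
    (hU : ∀ t, 0 ≤ t → U t = expFlow (regGen S Λ b m) t x
      + ∫ s in (0:ℝ)..t, expFlow (regGen S Λ b m) (t - s) (F s)) {t : ℝ} (ht : 0 ≤ t) :
    diag S (U t) + ε • U t = diag S x + ε • x
      + ∫ s in (0:ℝ)..t, ((waveOp S b m (U s) + ε • ((0 : H), -b • (U s).2))
        + (diag S (F s) + ε • F s)) := by
  set G := regGen S Λ b m with hG
  set V : ℝ → H × H := fun t => expFlow G t x + ∫ s in (0:ℝ)..t, expFlow G (t - s) (F s) with hV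
  have hVd : ∀ t, HasDerivAt V (G (V t) + F t) t := hasDerivAt_expFlow_duhamel G x hF
  have hUV : ∀ t, 0 ≤ t → U t = V t := hU
  have hVc : Continuous V := continuous_iff_continuousAt.2 fun t => (hVd t).continuousAt
  set W : H × H →L[ℝ] H × H := diag S + ε • 1 with hW
  have hWG : ∀ y, W (G y) = waveOp S b m y + ε • ((0 : H), -b • y.2) := by
    intro y
    have e1 := hΛ.add_apply y.2
    have e2 : S (stiffness S m (Λ y.1)) + ε • stiffness S m (Λ y.1) = stiffness S m y.1 := by
      rw [← hΛ.comm_stiffness, hΛ.add_apply]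
    simp only [hW, hG, add_apply, smul_apply,
      one_apply_eq_self, diag_apply, regGen_apply, waveOp_apply, Prod.smul_mk,
      Prod.mk_add_mk, e1, smul_zero, add_zero]
    congr 1
    rw [← e2]
    simp only [map_sub, map_neg, map_smul, smul_sub, smul_neg, neg_smul]
    abel
  have hint : ∫ s in (0:ℝ)..t, W (G (V s) + F s) = W (V t) - W (V 0) := by
    have hc : Continuous fun s => G (V s) + F s := (G.continuous.comp hVc).add hF
    rw [ContinuousLinearMap.intervalIntegral_comp_comm _ (hc.intervalIntegrable _ _),
      intervalIntegral.integral_eq_sub_of_hasDerivAt (fun s _ => hVd s)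
        (hc.intervalIntegrable _ _), map_sub]
  have hV0 : V 0 = x := by simp [hV]
  have hWa : ∀ y, W y = diag S y + ε • y := fun y => rfl
  rw [hV0] at hint
  have hint2 : ∫ s in (0:ℝ)..t, W (G (V s) + F s) =
      ∫ s in (0:ℝ)..t, ((waveOp S b m (U s) + ε • ((0 : H), -b • (U s).2))
        + (diag S (F s) + ε • F s)) := by
    refine intervalIntegral.integral_congr fun s hs => ?_
    rw [uIcc_of_le ht] at hs
    show W (G (V s) + F s) = _
    rw [map_add, hWG, hUV s hs.1, hWa]
  rw [← hint2, hint, hUV t ht, ← hWa, ← hWa]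
  abel

end Reg

end DampedWave

/-! ### The propagator of the damped wave equation -/

namespace DampedWave

open Filter
open scoped RealInnerProductSpace Topology

variable {H : Type*} [NormedAddCommGroup H] [InnerProductSpace ℝ H]

/-- `T` is the propagator of the linear damped wave equation `(S ⊕ S) U' = B U + (S ⊕ S) F`, in
integrated form, with exponential decay at rate `δ`; the field `duhamel` says that Duhamel's
formula solves the equation with forcing `F` and initial value `x`. -/
structure IsPropagator (S : H →L[ℝ] H) (b m δ M : ℝ) (T : ℝ → H × H → H × H) : Prop where
  map_sub : ∀ t x y, T t (x - y) = T t x - T t y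
  norm_le : ∀ t x, 0 ≤ t → ‖T t x‖ ≤ M * Real.exp (-δ * t) * ‖x‖
  continuous : Continuous fun p : ℝ × (H × H) => T p.1 p.2
  duhamel : ∀ (x : H × H) (F : ℝ → H × H), Continuous F → ∀ U : ℝ → H × H,
    (∀ t, 0 ≤ t → U t = T t x + ∫ s in (0:ℝ)..t, T (t - s) (F s)) → ∀ t, 0 ≤ t →
    diag S (U t) = diag S x + ∫ s in (0:ℝ)..t, (waveOp S b m (U s) + diag S (F s))

lemma IsPropagator.continuous_comp {S : H →L[ℝ] H} {b m δ M : ℝ} {T : ℝ → H × H → H × H}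
    (hT : IsPropagator S b m δ M T) {α : Type*} [TopologicalSpace α] {f : α → ℝ} {g : α → H × H}
    (hf : Continuous f) (hg : Continuous g) : Continuous fun a => T (f a) (g a) :=
  hT.continuous.comp (hf.prodMk hg)

section Limit

variable [CompleteSpace H] {S : H →L[ℝ] H} {b m : ℝ}

/-- The strong limit of the regularised evolutions as `ε → 0`. Times are cut off at `0`, so that
the limit is continuous on all of `ℝ`. -/
lemma exists_limit_flow (hS : IsPosContraction S) {δ M : ℝ} (hδ : 0 < δ) (hM : 0 < M)
    {Λ : ℕ → H →L[ℝ] H} {ε : ℕ → ℝ} (hε : ∀ k, 0 < ε k) (hε1 : ∀ k, ε k ≤ 1)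
    (hε0 : Tendsto ε atTop (𝓝 0)) (hΛ : ∀ k, IsInvAdd S (ε k) (Λ k))
    (hbd : ∀ ε : ℝ, 0 < ε → ε ≤ 1 → ∀ Λ : H →L[ℝ] H,
      IsInvAdd S ε Λ → ∀ x : H × H, ∀ t, 0 ≤ t →
        ‖expFlow (regGen S Λ b m) t x‖ ≤ M * Real.exp (-δ * t) * ‖x‖) :
    ∃ T : ℝ → H × H → H × H,
      (∀ t x, Tendsto (fun k => expFlow (regGen S (Λ k) b m) (max t 0) x) atTop (𝓝 (T t x))) ∧
      ∀ x, Continuous fun t => T t x := by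
  obtain ⟨C, hC, hdiff⟩ := exists_norm_exp_sub_exp_le (b := b) (m := m) hS hδ hM hbd
  set E : ℕ → ℝ → H × H →L[ℝ] H × H := fun k t => expFlow (regGen S (Λ k) b m) (max t 0) with hE
  have hEn : ∀ k t x, ‖E k t x‖ ≤ M * ‖x‖ := fun k t x => by
    refine (hbd _ (hε k) (hε1 k) _ (hΛ k) x _ (le_max_right t 0)).trans ?_
    have : Real.exp (-δ * max t 0) ≤ 1 := Real.exp_le_one_iff.2 (by
      have := mul_nonneg hδ.le (le_max_right t 0); linarith)
    have h2 : M * Real.exp (-δ * max t 0) ≤ M := by nlinarith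
    gcongr
  have hEc : ∀ k x, Continuous fun t => E k t x := fun k x =>
    ((continuous_expFlow _).comp (continuous_id.max continuous_const)).clm_apply continuous_const
  have hdense : DenseRange (diag (S * S) : H × H → H × H) := by
    have h := hS.denseRange.comp hS.denseRange S.continuous
    exact h.prodMap h
  have hcau : ∀ x, UniformCauchySeqOn (fun k t => E k t x) atTop univ := by
    intro x
    rw [Metric.uniformCauchySeqOn_iff]
    intro η hη
    obtain ⟨z, hz⟩ := hdense.exists_dist_lt x (ε := η / (4 * M)) (by positivity)
    have hq : 0 < η / (4 * (C * ‖z‖ + 1)) := by positivity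
    obtain ⟨N, hN⟩ := (Metric.cauchySeq_iff.1 hε0.cauchySeq) _ hq
    refine ⟨N, fun j hj k hk t _ => ?_⟩
    have h1 : ‖E j t (x - diag (S * S) z)‖ ≤ η / 4 := by
      refine (hEn j t _).trans ?_
      rw [dist_eq_norm] at hz
      calc _ ≤ M * (η / (4 * M)) := by gcongr
        _ = η / 4 := by field_simp
    have h2 : ‖E k t (x - diag (S * S) z)‖ ≤ η / 4 := by
      refine (hEn k t _).trans ?_
      rw [dist_eq_norm] at hz
      calc _ ≤ M * (η / (4 * M)) := by gcongr
        _ = η / 4 := by field_simp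
    have h3 : ‖E j t (diag (S * S) z) - E k t (diag (S * S) z)‖ ≤ η / 4 := by
      refine (hdiff _ (hε j) (hε1 j) _ (hε k) (hε1 k) _ _ (hΛ j) (hΛ k) z _
        (le_max_right t 0)).trans ?_
      have h := (hN j hj k hk).le
      rw [Real.dist_eq] at h
      calc _ ≤ C * (η / (4 * (C * ‖z‖ + 1))) * ‖z‖ := by gcongr
        _ = η / 4 * (C * ‖z‖ / (C * ‖z‖ + 1)) := by field_simp
        _ ≤ η / 4 * 1 := by
          gcongr
          rw [div_le_one (by positivity)]; linarith
        _ = η / 4 := mul_one _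
    rw [dist_eq_norm]
    have h4 : E j t x - E k t x = E j t (x - diag (S * S) z) - E k t (x - diag (S * S) z)
        + (E j t (diag (S * S) z) - E k t (diag (S * S) z)) := by
      simp only [map_sub]; abel
    rw [h4]
    have h5 := norm_add_le (E j t (x - diag (S * S) z) - E k t (x - diag (S * S) z))
      (E j t (diag (S * S) z) - E k t (diag (S * S) z))
    have h6 := norm_sub_le (E j t (x - diag (S * S) z)) (E k t (x - diag (S * S) z))
    linarith
  have hlim : ∀ t x, ∃ y, Tendsto (fun k => E k t x) atTop (𝓝 y) := fun t x =>
    cauchySeq_tendsto_of_complete ((hcau x).cauchySeq (mem_univ t))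
  choose T hT using hlim
  refine ⟨T, hT, fun x => ?_⟩
  have hu := (hcau x).tendstoUniformlyOn_of_tendsto (f := fun t => T t x) fun t _ => hT t x
  rw [tendstoUniformlyOn_univ] at hu
  exact hu.continuous (Frequently.of_forall fun k => hEc k x)

theorem exists_isPropagator (hS : IsPosContraction S) (hb : 0 < b) (hm : 0 < m) :
    ∃ δ : ℝ, 0 < δ ∧ ∃ M : ℝ, 0 < M ∧ ∃ T : ℝ → H × H → H × H, IsPropagator S b m δ M T := by
  obtain ⟨δ, hδ, M, hM, hbd⟩ := exists_norm_exp_regGen_le hS hb hm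
  set ε : ℕ → ℝ := fun k => 1 / ((k : ℝ) + 1) with hεd
  have hε : ∀ k, 0 < ε k := fun k => by positivity
  have hε1 : ∀ k, ε k ≤ 1 := fun k => by
    rw [hεd]; simp only
    rw [div_le_one (by positivity)]; linarith [k.cast_nonneg (α := ℝ)]
  have hε0 : Tendsto ε atTop (𝓝 0) := tendsto_one_div_add_atTop_nhds_zero_nat
  have hex : ∀ k, ∃ Λ, IsInvAdd S (ε k) Λ := fun k => exists_isInvAdd hS (hε k)
  choose Λ hΛ using hex
  obtain ⟨T, hT, hTc⟩ := exists_limit_flow hS hδ hM hε hε1 hε0 hΛ hbd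
  set E : ℕ → ℝ → H × H →L[ℝ] H × H := fun k t => expFlow (regGen S (Λ k) b m) t with hE
  have hT' : ∀ t, 0 ≤ t → ∀ x, Tendsto (fun k => E k t x) atTop (𝓝 (T t x)) := by
    intro t ht x
    have := hT t x
    rwa [max_eq_left ht] at this
  have hTsub : ∀ t x y, T t (x - y) = T t x - T t y := fun t x y => by
    refine tendsto_nhds_unique (hT t (x - y)) ?_
    simp only [map_sub]
    exact (hT t x).sub (hT t y)
  have hexp1 : ∀ t, 0 ≤ t → Real.exp (-δ * t) ≤ 1 := fun t ht =>
    Real.exp_le_one_iff.2 (by have := mul_nonneg hδ.le ht; linarith)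
  have hEn : ∀ k t x, 0 ≤ t → ‖E k t x‖ ≤ M * ‖x‖ := fun k t x ht => by
    refine (hbd _ (hε k) (hε1 k) _ (hΛ k) x _ ht).trans ?_
    have h2 : M * Real.exp (-δ * t) ≤ M := by nlinarith [hexp1 t ht]
    gcongr
  have hTn' : ∀ t x, ‖T t x‖ ≤ M * ‖x‖ := fun t x =>
    le_of_tendsto (hT t x).norm (Eventually.of_forall fun k => hEn k _ x (le_max_right t 0))
  have hTn : ∀ t x, 0 ≤ t → ‖T t x‖ ≤ M * Real.exp (-δ * t) * ‖x‖ := fun t x ht =>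
    le_of_tendsto (hT' t ht x).norm
      (Eventually.of_forall fun k => hbd _ (hε k) (hε1 k) _ (hΛ k) x _ ht)
  have hjoint : Continuous fun p : ℝ × (H × H) => T p.1 p.2 := by
    rw [continuous_iff_continuousAt]
    rintro ⟨t, x⟩
    have h1 : Tendsto (fun p : ℝ × (H × H) => T p.1 x) (𝓝 (t, x)) (𝓝 (T t x)) :=
      ((hTc x).comp continuous_fst).tendsto (t, x)
    have h2 : Tendsto (fun p : ℝ × (H × H) => T p.1 (p.2 - x)) (𝓝 (t, x)) (𝓝 0) := by
      refine squeeze_zero_norm (a := fun p => M * ‖p.2 - x‖) (fun p => hTn' _ _) ?_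
      have : Continuous fun p : ℝ × (H × H) => M * ‖p.2 - x‖ := by fun_prop
      simpa using this.tendsto (t, x)
    have h3 := h1.add h2
    rw [add_zero] at h3
    refine h3.congr fun p => ?_
    rw [hTsub]; abel
  refine ⟨δ, hδ, M, hM, T, hTsub, hTn, hjoint, ?_⟩
  intro x F hF U hU t ht
  obtain ⟨K, hK⟩ := (isCompact_Icc (a := (0:ℝ)) (b := t)).exists_bound_of_continuousOn
    hF.continuousOn
  have hK0 : 0 ≤ K := (norm_nonneg _).trans (hK 0 ⟨le_rfl, ht⟩)
  set V : ℕ → ℝ → H × H := fun k s => E k s x + ∫ r in (0:ℝ)..s, E k (s - r) (F r) with hV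
  have hVb : ∀ k, ∀ s ∈ Icc 0 t, ‖V k s‖ ≤ M * ‖x‖ + M * K * t := by
    intro k s hs
    refine (norm_add_le _ _).trans (add_le_add (hEn k s x hs.1) ?_)
    refine (intervalIntegral.norm_integral_le_of_norm_le_const (C := M * K) fun r hr => ?_).trans ?_
    · rw [uIoc_of_le hs.1] at hr
      refine (hEn k _ _ (by linarith [hr.2])).trans ?_
      gcongr
      exact hK r ⟨hr.1.le, hr.2.trans hs.2⟩
    · rw [sub_zero, abs_of_nonneg hs.1]
      have := hs.2
      gcongr
  have hVlim : ∀ s ∈ Icc 0 t, Tendsto (fun k => V k s) atTop (𝓝 (U s)) := by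
    intro s hs
    rw [hU s hs.1]
    refine (hT' s hs.1 x).add ?_
    refine intervalIntegral.tendsto_integral_filter_of_dominated_convergence (fun _ => M * K)
      (Eventually.of_forall fun k => ?_) (Eventually.of_forall fun k => ae_of_all _ fun r hr => ?_)
      intervalIntegrable_const (ae_of_all _ fun r hr => ?_)
    · exact (((continuous_expFlow _).comp (continuous_const.sub continuous_id)).clm_apply
        hF).aestronglyMeasurable
    · rw [uIoc_of_le hs.1] at hr
      refine (hEn k _ _ (by linarith [hr.2])).trans ?_
      gcongr
      exact hK r ⟨hr.1.le, hr.2.trans hs.2⟩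
    · rw [uIoc_of_le hs.1] at hr
      exact hT' _ (by linarith [hr.2]) _
  have hVc : ∀ k, Continuous (V k) := fun k =>
    continuous_iff_continuousAt.2 fun s => (hasDerivAt_expFlow_duhamel _ x hF s).continuousAt
  have hreg : ∀ k, diag S (V k t) + ε k • V k t = diag S x + ε k • x
      + ∫ s in (0:ℝ)..t, ((waveOp S b m (V k s) + ε k • ((0 : H), -b • (V k s).2))
        + (diag S (F s) + ε k • F s)) := fun k =>
    regularized_duhamel (hΛ k) x hF (fun s _ => rfl) ht
  have hεs : ∀ {u : ℕ → H × H} {y : H × H}, Tendsto u atTop (𝓝 y) →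
      Tendsto (fun k => ε k • u k) atTop (𝓝 0) := fun {u y} hu => by
    simpa using hε0.smul hu
  have htt : t ∈ Icc 0 t := ⟨ht, le_rfl⟩
  have hlhs : Tendsto (fun k => diag S (V k t) + ε k • V k t) atTop (𝓝 (diag S (U t))) := by
    simpa only [add_zero, Function.comp_def] using
      (((diag S).continuous.tendsto _).comp (hVlim t htt)).add (hεs (hVlim t htt))
  refine tendsto_nhds_unique hlhs ?_
  simp only [hreg]
  have hrhs1 : Tendsto (fun k => diag S x + ε k • x) atTop (𝓝 (diag S x)) := by
    simpa only [add_zero] using tendsto_const_nhds.add (hεs (tendsto_const_nhds (x := x)))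
  refine hrhs1.add ?_
  set Y := M * ‖x‖ + M * K * t with hY
  have hY0 : 0 ≤ Y := by positivity
  refine intervalIntegral.tendsto_integral_filter_of_dominated_convergence
    (fun _ => (‖waveOp S b m‖ * Y + 1 * (|b| * Y)) + (‖diag S‖ * K + 1 * K))
    (Eventually.of_forall fun k => ?_) (Eventually.of_forall fun k => ae_of_all _ fun r hr => ?_)
    intervalIntegrable_const (ae_of_all _ fun r hr => ?_)
  · have h1 := hVc k
    have h2 : Continuous fun s => waveOp S b m (V k s) := (waveOp S b m).continuous.comp h1
    have h3 : Continuous fun s => diag S (F s) := (diag S).continuous.comp hF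
    exact Continuous.aestronglyMeasurable (by fun_prop)
  · rw [uIoc_of_le ht] at hr
    have hr' : r ∈ Icc 0 t := ⟨hr.1.le, hr.2⟩
    have h1 := hVb k r hr'
    refine (norm_add_le _ _).trans (add_le_add ((norm_add_le _ _).trans (add_le_add ?_ ?_))
      ((norm_add_le _ _).trans (add_le_add ?_ ?_)))
    · exact ((waveOp S b m).le_opNorm _).trans (by gcongr)
    · rw [norm_smul, Real.norm_of_nonneg (hε k).le]
      gcongr
      · exact hε1 k
      · refine max_le (by simp; positivity) ?_
        show ‖-b • (V k r).2‖ ≤ _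
        rw [norm_smul, norm_neg, Real.norm_eq_abs]
        gcongr
        exact (norm_snd_le _).trans h1
    · exact ((diag S).le_opNorm _).trans (by gcongr; exact hK r hr')
    · rw [norm_smul, Real.norm_of_nonneg (hε k).le]
      gcongr
      · exact hε1 k
      · exact hK r hr'
  · rw [uIoc_of_le ht] at hr
    have hr' : r ∈ Icc 0 t := ⟨hr.1.le, hr.2⟩
    have h1 := hVlim r hr'
    have h2 : Tendsto (fun k => ((0 : H), -b • (V k r).2)) atTop (𝓝 ((0 : H), -b • (U r).2)) :=
      tendsto_const_nhds.prodMk_nhds (((continuous_snd.tendsto _).comp h1).const_smul _)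
    simpa only [add_zero, Function.comp_def] using ((((waveOp S b m).continuous.tendsto _).comp h1).add
      (hεs h2)).add ((tendsto_const_nhds (x := diag S (F r))).add
        (hεs (tendsto_const_nhds (x := F r))))

end Limit

/-- Uniqueness for the linear equation, from the energy `‖S v‖² + ⟪P S σ, S σ⟫`, which is finite
for weak solutions and does not increase. -/
lemma eq_zero_of_linear {S : H →L[ℝ] H} {b m : ℝ} [CompleteSpace H] (hS : IsPosContraction S)
    (hb : 0 < b) (hm : 0 < m) {U : ℝ → H × H} (hU : Continuous U)
    (h : ∀ t, 0 ≤ t → diag S (U t) = ∫ s in (0:ℝ)..t, waveOp S b m (U s)) {t : ℝ} (ht : 0 ≤ t) :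
    U t = 0 := by
  set P := stiffness S m with hP
  have hBc : Continuous fun s => waveOp S b m (U s) := (waveOp S b m).continuous.comp hU
  set D : ℝ → H × H := fun t => ∫ s in (0:ℝ)..t, waveOp S b m (U s) with hD
  have hDd : ∀ t, HasDerivAt D (waveOp S b m (U t)) t := fun t =>
    (hBc.integral_hasStrictDerivAt 0 t).hasDerivAt
  let En : ℝ → ℝ := fun t => ⟪(D t).2, (D t).2⟫ + ⟪P (D t).1, (D t).1⟫
  have hD1 : ∀ t, HasDerivAt (fun t => (D t).1) (waveOp S b m (U t)).1 t := fun t => (hDd t).fst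
  have hD2 : ∀ t, HasDerivAt (fun t => (D t).2) (waveOp S b m (U t)).2 t := fun t => (hDd t).snd
  have hEd := fun t => ((hD2 t).inner ℝ (hD2 t)).add
    ((P.hasFDerivAt.comp_hasDerivAt t (hD1 t)).inner ℝ (hD1 t))
  have hEc : Continuous En := continuous_iff_continuousAt.2 fun t => (hEd t).continuousAt
  have hanti : AntitoneOn En (Ici 0) := by
    refine antitoneOn_of_deriv_nonpos (convex_Ici 0) hEc.continuousOn
      (fun t _ => (hEd t).differentiableAt.differentiableWithinAt) fun t ht => ?_
    rw [interior_Ici] at ht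
    rw [show deriv En t = _ from (hEd t).deriv]
    have e : D t = diag S (U t) := (h t (le_of_lt ht)).symm
    simp only [Function.comp, e, diag_apply, waveOp_apply]
    have e1 : ⟪S (U t).2, P (U t).1⟫ = ⟪P (S (U t).1), (U t).2⟫ := by
      rw [hS.symm, real_inner_comm]
      congr 1
      simp only [hP, stiffness_apply, map_sub, map_smul]
    have e2 : ⟪P (U t).1, S (U t).2⟫ = ⟪P (S (U t).1), (U t).2⟫ := by
      rw [real_inner_comm, e1]
    have e3 : ⟪P (U t).2, S (U t).1⟫ = ⟪P (S (U t).1), (U t).2⟫ := by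
      rw [hP, stiffness_symm hS, real_inner_comm]
    rw [hP] at e1 e2 e3
    simp only [inner_sub_left, inner_sub_right, inner_neg_left, inner_neg_right,
      real_inner_smul_left, real_inner_smul_right, hP, e1, e2, e3, real_inner_self_eq_norm_sq]
    nlinarith [mul_nonneg hb.le (sq_nonneg ‖S (U t).2‖)]
  have h0 : En 0 = 0 := by simp [En, hD]
  have hle := hanti (mem_Ici.2 le_rfl) (mem_Ici.2 ht) ht
  rw [h0] at hle
  have hl := le_inner_stiffness hS (m := m) (D t).1
  have hc : 0 < min 1 m := lt_min one_pos hm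
  have hle' : ‖(D t).2‖ ^ 2 + min 1 m * ‖(D t).1‖ ^ 2 ≤ 0 := by
    have : En t = ‖(D t).2‖ ^ 2 + ⟪P (D t).1, (D t).1⟫ := by
      simp only [En, real_inner_self_eq_norm_sq]
    linarith
  have z2 : (D t).2 = 0 := by
    have : 0 ≤ min 1 m * ‖(D t).1‖ ^ 2 := by positivity
    rw [← norm_eq_zero]; nlinarith [sq_nonneg ‖(D t).2‖]
  have z1 : (D t).1 = 0 := by
    have h1 : min 1 m * ‖(D t).1‖ ^ 2 ≤ 0 := by linarith [sq_nonneg ‖(D t).2‖]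
    have h2 : ‖(D t).1‖ ^ 2 ≤ 0 := by
      by_contra hcon
      push Not at hcon
      linarith [mul_pos hc hcon]
    rw [← norm_eq_zero]; nlinarith [norm_nonneg (D t).1]
  have e : D t = diag S (U t) := (h t ht).symm
  rw [e] at z1 z2
  ext
  · exact hS.inj (z1.trans (map_zero S).symm)
  · exact hS.inj (z2.trans (map_zero S).symm)

end DampedWave

/-! ### The semilinear equation with small data -/

namespace DampedWave

open Filter
open scoped RealInnerProductSpace Topology

/-- Grönwall's lemma in integral form, with zero initial value. -/
lemma eq_zero_of_le_mul_integral {g : ℝ → ℝ} (hg : Continuous g) (hg0 : ∀ t, 0 ≤ g t) {c τ : ℝ}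
    (h : ∀ t ∈ Icc 0 τ, g t ≤ c * ∫ s in (0:ℝ)..t, g s) {t : ℝ} (ht : t ∈ Icc 0 τ) : g t = 0 := by
  set I : ℝ → ℝ := fun t => ∫ s in (0:ℝ)..t, g s with hI
  have hId : ∀ t, HasDerivAt I (g t) t := fun t => (hg.integral_hasStrictDerivAt 0 t).hasDerivAt
  have hd : ∀ t, HasDerivAt (fun t => I t * Real.exp (-c * t))
      (g t * Real.exp (-c * t) + I t * (Real.exp (-c * t) * (-c * 1))) t := fun t =>
    (hId t).mul ((((hasDerivAt_id t).const_mul (-c))).exp)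
  have hanti : AntitoneOn (fun t => I t * Real.exp (-c * t)) (Icc 0 τ) := by
    refine antitoneOn_of_deriv_nonpos (convex_Icc 0 τ)
      (fun t _ => (hd t).continuousAt.continuousWithinAt)
      (fun t _ => (hd t).differentiableAt.differentiableWithinAt) fun t ht => ?_
    rw [(hd t).deriv]
    have h1 := h t (interior_subset ht)
    have h2 := mul_le_mul_of_nonneg_right h1 (Real.exp_pos (-c * t)).le
    simp only [hI] at *
    linarith
  have hle : I t * Real.exp (-c * t) ≤ I 0 * Real.exp (-c * 0) :=
    hanti ⟨le_rfl, ht.1.trans ht.2⟩ ht ht.1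
  have hI0 : I 0 = 0 := by simp [hI]
  rw [hI0, zero_mul] at hle
  have h1 : I t ≤ 0 := by
    by_contra hcon
    push Not at hcon
    linarith [mul_pos hcon (Real.exp_pos (-c * t))]
  have h2 : 0 ≤ I t := intervalIntegral.integral_nonneg ht.1 fun s _ => hg0 s
  have h3 : I t = 0 := le_antisymm h1 h2
  have h4 := h t ht
  simp only [hI] at h3
  rw [h3, mul_zero] at h4
  exact le_antisymm h4 (hg0 t)

section PowerLipschitz

variable {E : Type*} [NormedAddCommGroup E] {N : E → E} {L q : ℝ}

lemma continuous_of_power_lipschitz (hq : 0 < q)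
    (hN : ∀ x y, ‖N x - N y‖ ≤ L * (‖x‖ ^ q + ‖y‖ ^ q) * ‖x - y‖) : Continuous N := by
  rw [continuous_iff_continuousAt]
  intro x
  rw [ContinuousAt, tendsto_iff_norm_sub_tendsto_zero]
  refine squeeze_zero (fun _ => norm_nonneg _) (fun y => hN y x) ?_
  have : Continuous fun y : E => L * (‖y‖ ^ q + ‖x‖ ^ q) * ‖y - x‖ := by
    have h : Continuous fun y : E => ‖y‖ ^ q := continuous_norm.rpow_const fun _ => Or.inr hq.le
    fun_prop
  simpa using this.tendsto x

lemma norm_sub_le_of_power_lipschitz (hL : 0 ≤ L) (hq : 0 < q)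
    (hN : ∀ x y, ‖N x - N y‖ ≤ L * (‖x‖ ^ q + ‖y‖ ^ q) * ‖x - y‖) {R : ℝ} {x y : E}
    (hx : ‖x‖ ≤ R) (hy : ‖y‖ ≤ R) : ‖N x - N y‖ ≤ 2 * L * R ^ q * ‖x - y‖ := by
  refine (hN x y).trans ?_
  have h1 : ‖x‖ ^ q ≤ R ^ q := Real.rpow_le_rpow (norm_nonneg _) hx hq.le
  have h2 : ‖y‖ ^ q ≤ R ^ q := Real.rpow_le_rpow (norm_nonneg _) hy hq.le
  calc L * (‖x‖ ^ q + ‖y‖ ^ q) * ‖x - y‖ ≤ L * (R ^ q + R ^ q) * ‖x - y‖ := by gcongr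
    _ = _ := by ring

end PowerLipschitz

variable {H : Type*} [NormedAddCommGroup H] [InnerProductSpace ℝ H]

/-- Continuous solutions `U = (σ, v)` of the damped wave equation with nonlinearity `N`, in the form
`(S ⊕ S) U' = B U + (S ⊕ S) (0, N σ)` integrated in time. -/
structure IsIntegralSolution (S : H →L[ℝ] H) (b m : ℝ) (N : H → H) (x : H × H)
    (U : ℝ → H × H) : Prop where
  continuousOn : ContinuousOn U (Ici 0)
  eq : ∀ t, 0 ≤ t → diag S (U t) = diag S x
    + ∫ s in (0:ℝ)..t, (waveOp S b m (U s) + diag S (0, N (U s).1))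

section Duhamel

variable {S : H →L[ℝ] H} {b m δ M : ℝ} {T : ℝ → H × H → H × H}

lemma IsPropagator.continuous_mild [CompleteSpace H] (hT : IsPropagator S b m δ M T) (x : H × H)
    {F : ℝ → H × H} (hF : Continuous F) :
    Continuous fun t => T t x + ∫ s in (0:ℝ)..t, T (t - s) (F s) := by
  have h1 : Continuous fun t => T t x := hT.continuous_comp continuous_id continuous_const
  have h2 : Continuous (Function.uncurry fun t s : ℝ => T (t - s) (F s)) :=
    hT.continuous_comp (continuous_fst.sub continuous_snd) (hF.comp continuous_snd)
  have h3 := intervalIntegral.continuous_parametric_primitive_of_continuous (μ := volume)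
    (a₀ := (0:ℝ)) h2
  exact h1.add (h3.comp (continuous_id.prodMk continuous_id))

lemma continuous_comp_max {α : Type*} [TopologicalSpace α] {f : ℝ → α}
    (hf : ContinuousOn f (Ici 0)) : Continuous fun t => f (max t 0) :=
  hf.comp_continuous (continuous_id.max continuous_const) fun t => le_max_right t 0

/-- Every solution of the integrated equation is given by Duhamel's formula. -/
lemma IsIntegralSolution.eq_mild [CompleteSpace H] (hS : IsPosContraction S) (hb : 0 < b)
    (hm : 0 < m) (hT : IsPropagator S b m δ M T) {N : H → H} (hN : Continuous N) {x : H × H}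
    {U : ℝ → H × H} (hU : IsIntegralSolution S b m N x U) {t : ℝ} (ht : 0 ≤ t) :
    U t = T t x + ∫ s in (0:ℝ)..t, T (t - s) ((0 : H), N (U (max s 0)).1) := by
  have hUc := continuous_comp_max hU.continuousOn
  set F : ℝ → H × H := fun s => ((0 : H), N (U (max s 0)).1) with hF
  have hFc : Continuous F := continuous_const.prodMk (hN.comp (continuous_fst.comp hUc))
  set V : ℝ → H × H := fun t => T t x + ∫ s in (0:ℝ)..t, T (t - s) (F s) with hV
  have hVc : Continuous V := hT.continuous_mild x hFc
  have hVeq := hT.duhamel x F hFc V fun t _ => rfl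
  have key := eq_zero_of_linear (b := b) (m := m) hS hb hm (U := fun t => U (max t 0) - V t)
    (hUc.sub hVc) (fun t ht => ?_) ht
  · simp only [max_eq_left ht] at key
    exact sub_eq_zero.1 key
  · have h1 := hU.eq t ht
    have h2 : ∫ s in (0:ℝ)..t, (waveOp S b m (U s) + diag S (0, N (U s).1))
        = ∫ s in (0:ℝ)..t, (waveOp S b m (U (max s 0)) + diag S (F s)) := by
      refine intervalIntegral.integral_congr fun s hs => ?_
      rw [uIcc_of_le ht] at hs
      simp only [hF, max_eq_left hs.1]
    rw [h2] at h1
    have c1 : Continuous fun s => waveOp S b m (U (max s 0)) + diag S (F s) :=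
      ((waveOp S b m).continuous.comp hUc).add ((diag S).continuous.comp hFc)
    have c2 : Continuous fun s => waveOp S b m (V s) + diag S (F s) :=
      ((waveOp S b m).continuous.comp hVc).add ((diag S).continuous.comp hFc)
    rw [map_sub, max_eq_left ht, h1, hVeq t ht, add_sub_add_left_eq_sub,
      ← intervalIntegral.integral_sub (c1.intervalIntegrable _ _) (c2.intervalIntegrable _ _)]
    simp only [map_sub, add_sub_add_right_eq_sub]

/-- A forcing term decaying at half the rate of the propagator passes its decay on to the Duhamel
integral. -/
lemma IsPropagator.norm_duhamel_le (hT : IsPropagator S b m (2 * δ) M T) (hδ : 0 < δ) (hM : 0 < M)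
    {F : ℝ → H × H} {c : ℝ} (hc : 0 ≤ c) {t : ℝ}
    (ht : 0 ≤ t) (h : ∀ s ∈ Icc 0 t, ‖F s‖ ≤ c * Real.exp (-δ * s)) :
    ‖∫ s in (0:ℝ)..t, T (t - s) (F s)‖ ≤ M * c / δ * Real.exp (-δ * t) := by
  have hd : ∀ s : ℝ, HasDerivAt (fun s => M * c * Real.exp (-δ * t) / δ * Real.exp (-δ * (t - s)))
      (M * c * Real.exp (-δ * t) * Real.exp (-δ * (t - s))) s := by
    intro s
    have h1 := ((((hasDerivAt_id s).const_sub t).const_mul (-δ)).exp).const_mul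
      (M * c * Real.exp (-δ * t) / δ)
    refine h1.congr_deriv ?_
    simp only [id]
    field_simp
  have hcont : Continuous fun s => M * c * Real.exp (-δ * t) * Real.exp (-δ * (t - s)) := by fun_prop
  have hint := intervalIntegral.integral_eq_sub_of_hasDerivAt (a := 0) (b := t) (fun s _ => hd s)
    (hcont.intervalIntegrable _ _)
  refine (intervalIntegral.norm_integral_le_of_norm_le ht (ae_of_all _ fun s hs => ?_)
    (hcont.intervalIntegrable _ _)).trans ?_
  · refine (hT.norm_le _ _ (by linarith [hs.2])).trans ?_
    calc _ ≤ M * Real.exp (-(2 * δ) * (t - s)) * (c * Real.exp (-δ * s)) := by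
            gcongr; exact h s ⟨hs.1.le, hs.2⟩
      _ = M * c * (Real.exp (-(2 * δ) * (t - s)) * Real.exp (-δ * s)) := by ring
      _ = M * c * (Real.exp (-δ * t) * Real.exp (-δ * (t - s))) := by
        rw [← Real.exp_add, ← Real.exp_add]; ring_nf
      _ = _ := by ring
  · rw [hint, sub_self, mul_zero, Real.exp_zero, mul_one]
    have : 0 ≤ M * c * Real.exp (-δ * t) / δ * Real.exp (-δ * (t - 0)) := by positivity
    have h2 : M * c / δ * Real.exp (-δ * t) = M * c * Real.exp (-δ * t) / δ := by ring
    linarith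

end Duhamel

section Nonlinear

variable {N : H → H} {L q : ℝ}

variable [CompleteSpace H] {S : H →L[ℝ] H} {b m : ℝ}

/-- Uniqueness, by Grönwall's argument applied to the difference of two Duhamel formulas. -/
lemma IsIntegralSolution.eqOn (hS : IsPosContraction S) (hb : 0 < b) (hm : 0 < m) (hL : 0 ≤ L)
    (hq : 0 < q) (hN : ∀ x y, ‖N x - N y‖ ≤ L * (‖x‖ ^ q + ‖y‖ ^ q) * ‖x - y‖) {x : H × H}
    {U V : ℝ → H × H} (hU : IsIntegralSolution S b m N x U) (hV : IsIntegralSolution S b m N x V) :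
    EqOn U V (Ici 0) := by
  obtain ⟨δ, hδ, M, hM, T, hT⟩ := exists_isPropagator hS hb hm
  have hNc := continuous_of_power_lipschitz hq hN
  intro τ hτ
  have hUc := continuous_comp_max hU.continuousOn
  have hVc := continuous_comp_max hV.continuousOn
  obtain ⟨R, hR⟩ := (isCompact_Icc (a := (0:ℝ)) (b := τ)).exists_bound_of_continuousOn
    (hUc.prodMk hVc).continuousOn
  have hR0 : 0 ≤ R := (norm_nonneg _).trans (hR 0 ⟨le_rfl, hτ⟩)
  set g : ℝ → ℝ := fun t => ‖U (max t 0) - V (max t 0)‖ with hg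
  have hgc : Continuous g := (hUc.sub hVc).norm
  have key : g τ = 0 := by
    refine eq_zero_of_le_mul_integral (c := M * (2 * L * R ^ q)) (τ := τ) hgc
      (fun _ => norm_nonneg _) (fun t ht => ?_) ⟨hτ, le_rfl⟩
    have i1 : Continuous fun s => T (t - s) ((0 : H), N (U (max s 0)).1) :=
      hT.continuous_comp (continuous_const.sub continuous_id)
        (continuous_const.prodMk (hNc.comp (continuous_fst.comp hUc)))
    have i2 : Continuous fun s => T (t - s) ((0 : H), N (V (max s 0)).1) :=
      hT.continuous_comp (continuous_const.sub continuous_id)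
        (continuous_const.prodMk (hNc.comp (continuous_fst.comp hVc)))
    simp only [hg, max_eq_left ht.1]
    rw [hU.eq_mild hS hb hm hT hNc ht.1, hV.eq_mild hS hb hm hT hNc ht.1, add_sub_add_left_eq_sub,
      ← intervalIntegral.integral_sub (i1.intervalIntegrable _ _) (i2.intervalIntegrable _ _),
      ← intervalIntegral.integral_const_mul]
    refine intervalIntegral.norm_integral_le_of_norm_le ht.1 (ae_of_all _ fun s hs => ?_)
      ((continuous_const.mul hgc).intervalIntegrable _ _)
    rw [← hT.map_sub]
    refine (hT.norm_le _ _ (by linarith [hs.2])).trans ?_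
    have hb' := hR s ⟨hs.1.le, hs.2.trans ht.2⟩
    have hbU : ‖(U (max s 0)).1‖ ≤ R := (norm_fst_le _).trans ((norm_fst_le _).trans hb')
    have hbV : ‖(V (max s 0)).1‖ ≤ R := (norm_fst_le _).trans ((norm_snd_le _).trans hb')
    have he : Real.exp (-δ * (t - s)) ≤ 1 := Real.exp_le_one_iff.2 (by
      have := mul_nonneg hδ.le (sub_nonneg.2 hs.2); linarith)
    have hn : ‖((0 : H), N (U (max s 0)).1) - ((0 : H), N (V (max s 0)).1)‖
        ≤ 2 * L * R ^ q * g s := by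
      rw [Prod.mk_sub_mk, sub_self]
      refine max_le (by simp only [norm_zero]; positivity) ?_
      refine (norm_sub_le_of_power_lipschitz hL hq hN hbU hbV).trans ?_
      gcongr
      exact norm_fst_le (U (max s 0) - V (max s 0))
    calc _ ≤ M * 1 * (2 * L * R ^ q * g s) := by gcongr
      _ = _ := by ring
  simp only [hg, max_eq_left (mem_Ici.1 hτ)] at key
  exact sub_eq_zero.1 (norm_eq_zero.1 key)

/-- Global existence and exponential decay for small data. The solution is the fixed
point of Duhamel's formula among the functions `e^{-δ₀ t} y(t)` with `y` in a small ball of the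
bounded continuous functions. -/
theorem exists_global_solution (hS : IsPosContraction S) (hb : 0 < b) (hm : 0 < m) (hL : 0 ≤ L)
    (hq : 0 < q) (hN0 : N 0 = 0)
    (hN : ∀ x y, ‖N x - N y‖ ≤ L * (‖x‖ ^ q + ‖y‖ ^ q) * ‖x - y‖) :
    ∃ ε₀ : ℝ, 0 < ε₀ ∧ ∃ δ₀ : ℝ, 0 < δ₀ ∧ ∃ K : ℝ, 0 ≤ K ∧ ∀ x : H × H, ‖x‖ ≤ ε₀ →
      ∃ U : ℝ → H × H, IsIntegralSolution S b m N x U ∧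
        ∀ t, 0 ≤ t → ‖U t‖ ≤ K * Real.exp (-δ₀ * t) := by
  obtain ⟨δ', hδ', M, hM, T, hT'⟩ := exists_isPropagator hS hb hm
  set δ := δ' / 2 with hδd
  have hδ : 0 < δ := by positivity
  have hT : IsPropagator S b m (2 * δ) M T := by rw [hδd]; convert hT' using 1; ring
  have hNc := continuous_of_power_lipschitz hq hN
  set η := δ / (4 * M * (L + 1)) with hη
  have hη0 : 0 < η := by positivity
  set ρ := η ^ (1 / q) with hρ
  have hρ0 : 0 < ρ := Real.rpow_pos_of_pos hη0 _
  have hρq : ρ ^ q = η := by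
    rw [hρ, ← Real.rpow_mul hη0.le, one_div_mul_cancel hq.ne', Real.rpow_one]
  have hcontr : M * (2 * L * ρ ^ q) / δ ≤ 1 / 2 := by
    rw [hρq, hη]
    have : M * (2 * L * (δ / (4 * M * (L + 1)))) / δ = 1 / 2 * (L / (L + 1)) := by
      field_simp; ring
    rw [this]
    have : L / (L + 1) ≤ 1 := by rw [div_le_one (by positivity)]; linarith
    linarith
  refine ⟨ρ / (2 * M), by positivity, δ, hδ, ρ, hρ0.le, fun x hx => ?_⟩
  have hMx : M * ‖x‖ ≤ ρ / 2 := by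
    calc M * ‖x‖ ≤ M * (ρ / (2 * M)) := by gcongr
      _ = ρ / 2 := by field_simp
  -- The state is `U s = exp (-δ s) • y s`; negative times are frozen at `0`, for continuity on `ℝ`.
  let F : (BoundedContinuousFunction ℝ (H × H)) → ℝ → H × H := fun y s =>
    ((0 : H), N (Real.exp (-δ * max s 0) • (y s).1))
  have hFc : ∀ y, Continuous (F y) := fun y => by
    have h1 : Continuous fun s : ℝ => Real.exp (-δ * max s 0) := by fun_prop
    exact continuous_const.prodMk (hNc.comp (h1.smul (continuous_fst.comp y.continuous)))
  have hFd : ∀ (R : ℝ) (y z : BoundedContinuousFunction ℝ (H × H)), ‖y‖ ≤ R → ‖z‖ ≤ R →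
      ∀ s, 0 ≤ s → ‖F y s - F z s‖ ≤ 2 * L * R ^ q * ‖y - z‖ * Real.exp (-δ * s) := by
    intro R y z hy hz s hs
    have hR0 : 0 ≤ R := (norm_nonneg _).trans hy
    simp only [F, max_eq_left hs]
    have he : Real.exp (-δ * s) ≤ 1 := Real.exp_le_one_iff.2 (by
      have := mul_nonneg hδ.le hs; linarith)
    have hb' : ∀ w : BoundedContinuousFunction ℝ (H × H), ‖w‖ ≤ R →
        ‖Real.exp (-δ * s) • (w s).1‖ ≤ R := by
      intro w hw
      rw [norm_smul, Real.norm_of_nonneg (Real.exp_pos _).le]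
      have h1 : ‖(w s).1‖ ≤ R := (norm_fst_le _).trans ((w.norm_coe_le_norm s).trans hw)
      nlinarith [norm_nonneg (w s).1, Real.exp_pos (-δ * s)]
    rw [Prod.mk_sub_mk, sub_self]
    refine max_le (by simp only [norm_zero]; positivity) ?_
    refine (norm_sub_le_of_power_lipschitz hL hq hN (hb' y hy) (hb' z hz)).trans ?_
    rw [← smul_sub, norm_smul, Real.norm_of_nonneg (Real.exp_pos _).le]
    have h2 : ‖(y s).1 - (z s).1‖ ≤ ‖y - z‖ :=
      (norm_fst_le (y s - z s)).trans ((y - z).norm_coe_le_norm s)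
    calc _ ≤ 2 * L * R ^ q * (Real.exp (-δ * s) * ‖y - z‖) := by gcongr
      _ = _ := by ring
  have hF0 : F 0 = 0 := by
    funext s
    simp [F, hN0]
  let D : (BoundedContinuousFunction ℝ (H × H)) → ℝ → H × H := fun y t =>
    T t x + ∫ s in (0:ℝ)..t, T (t - s) (F y s)
  have hDc : ∀ y, Continuous (D y) := fun y => hT.continuous_mild x (hFc y)
  have hexp : ∀ t, Real.exp (δ * t) * Real.exp (-δ * t) = 1 := fun t => by
    rw [← Real.exp_add]; simp
  have hlin : ∀ t, 0 ≤ t → ‖T t x‖ ≤ M * ‖x‖ * Real.exp (-δ * t) := by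
    intro t ht
    refine (hT.norm_le t x ht).trans ?_
    have : Real.exp (-(2 * δ) * t) ≤ Real.exp (-δ * t) := by
      apply Real.exp_le_exp.2; nlinarith [mul_nonneg hδ.le ht]
    calc _ ≤ M * Real.exp (-δ * t) * ‖x‖ := by gcongr
      _ = _ := by ring
  have hDb : ∀ (R : ℝ) y, ‖y‖ ≤ R → ∀ t, 0 ≤ t →
      ‖D y t‖ ≤ (M * ‖x‖ + M * (2 * L * R ^ q * ‖y‖) / δ) * Real.exp (-δ * t) := by
    intro R y hy t ht
    have hR0 : 0 ≤ R := (norm_nonneg _).trans hy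
    refine (norm_add_le _ _).trans ?_
    rw [add_mul]
    refine add_le_add (hlin t ht) (hT.norm_duhamel_le hδ hM (by positivity) ht fun s hs => ?_)
    have := hFd R y 0 hy (by simpa using hR0) s hs.1
    rwa [hF0, Pi.zero_apply, sub_zero, sub_zero] at this
  have hDd : ∀ y z, ‖y‖ ≤ ρ → ‖z‖ ≤ ρ → ∀ t, 0 ≤ t →
      ‖D y t - D z t‖ ≤ 1 / 2 * ‖y - z‖ * Real.exp (-δ * t) := by
    intro y z hy hz t ht
    have i1 : ∀ y, Continuous fun s => T (t - s) (F y s) := fun y =>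
      hT.continuous_comp (continuous_const.sub continuous_id) (hFc y)
    simp only [D]
    rw [add_sub_add_left_eq_sub, ← intervalIntegral.integral_sub ((i1 y).intervalIntegrable _ _)
      ((i1 z).intervalIntegrable _ _)]
    simp only [← hT.map_sub]
    refine (hT.norm_duhamel_le hδ hM (c := 2 * L * ρ ^ q * ‖y - z‖) (by positivity) ht
      fun s hs => hFd ρ y z hy hz s hs.1).trans ?_
    gcongr
    calc _ = M * (2 * L * ρ ^ q) / δ * ‖y - z‖ := by ring
      _ ≤ _ := by gcongr
  have hwc : Continuous fun t : ℝ => Real.exp (δ * max t 0) := by fun_prop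
  have hΦb : ∀ y t, ‖Real.exp (δ * max t 0) • D y (max t 0)‖
      ≤ M * ‖x‖ + M * (2 * L * ‖y‖ ^ q * ‖y‖) / δ := by
    intro y t
    rw [norm_smul, Real.norm_of_nonneg (Real.exp_pos _).le]
    have h1 := hDb ‖y‖ y le_rfl (max t 0) (le_max_right _ _)
    calc _ ≤ Real.exp (δ * max t 0) * ((M * ‖x‖ + M * (2 * L * ‖y‖ ^ q * ‖y‖) / δ)
              * Real.exp (-δ * max t 0)) := by gcongr
      _ = (M * ‖x‖ + M * (2 * L * ‖y‖ ^ q * ‖y‖) / δ)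
          * (Real.exp (δ * max t 0) * Real.exp (-δ * max t 0)) := by ring
      _ = _ := by rw [hexp, mul_one]
  let Φ : BoundedContinuousFunction ℝ (H × H) → BoundedContinuousFunction ℝ (H × H) := fun y =>
    BoundedContinuousFunction.ofNormedAddCommGroup
      (fun t => Real.exp (δ * max t 0) • D y (max t 0))
      (hwc.smul ((hDc y).comp (continuous_id.max continuous_const))) _ (hΦb y)
  have hΦa : ∀ y t, Φ y t = Real.exp (δ * max t 0) • D y (max t 0) := fun _ _ => rfl
  have hmaps : MapsTo Φ (Metric.closedBall 0 ρ) (Metric.closedBall 0 ρ) := by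
    intro y hy
    rw [mem_closedBall_zero_iff] at hy ⊢
    refine (BoundedContinuousFunction.norm_le hρ0.le).2 fun t => ?_
    rw [hΦa, norm_smul, Real.norm_of_nonneg (Real.exp_pos _).le]
    have h1 := hDb ρ y hy (max t 0) (le_max_right _ _)
    have h2 : M * (2 * L * ρ ^ q * ‖y‖) / δ ≤ ρ / 2 := by
      calc _ = M * (2 * L * ρ ^ q) / δ * ‖y‖ := by ring
        _ ≤ 1 / 2 * ρ := by gcongr
        _ = _ := by ring
    calc _ ≤ Real.exp (δ * max t 0) * ((ρ / 2 + ρ / 2) * Real.exp (-δ * max t 0)) := by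
            gcongr
            exact h1.trans (by gcongr)
      _ = ρ * (Real.exp (δ * max t 0) * Real.exp (-δ * max t 0)) := by ring
      _ = ρ := by rw [hexp, mul_one]
  have hcw : ContractingWith (1 / 2) (hmaps.restrict Φ _ _) := by
    refine ⟨by
      rw [← NNReal.coe_lt_coe]; norm_num, LipschitzWith.of_dist_le_mul fun y z => ?_⟩
    rw [Subtype.dist_eq, Subtype.dist_eq, dist_eq_norm, dist_eq_norm]
    refine (BoundedContinuousFunction.norm_le (by positivity)).2 fun t => ?_
    have h1 := hDd y z (mem_closedBall_zero_iff.1 y.2) (mem_closedBall_zero_iff.1 z.2) (max t 0)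
      (le_max_right _ _)
    show ‖Φ y t - Φ z t‖ ≤ _
    rw [hΦa, hΦa, ← smul_sub, norm_smul, Real.norm_of_nonneg (Real.exp_pos _).le]
    calc _ ≤ Real.exp (δ * max t 0) * (1 / 2 * ‖(y : BoundedContinuousFunction ℝ (H × H)) - z‖
              * Real.exp (-δ * max t 0)) := by gcongr
      _ = 1 / 2 * ‖(y : BoundedContinuousFunction ℝ (H × H)) - z‖
          * (Real.exp (δ * max t 0) * Real.exp (-δ * max t 0)) := by ring
      _ = _ := by rw [hexp, mul_one]; simp
  obtain ⟨y, hy, hfix, -⟩ := hcw.exists_fixedPoint' Metric.isClosed_closedBall.isComplete hmaps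
    (x := 0) (by simpa using hρ0.le) (edist_ne_top _ _)
  rw [mem_closedBall_zero_iff] at hy
  have hyD : ∀ t, 0 ≤ t → D y t = Real.exp (-δ * t) • y t := by
    intro t ht
    have h1 : Φ y t = y t := by rw [hfix.eq]
    rw [hΦa, max_eq_left ht] at h1
    rw [← h1, smul_smul, mul_comm, hexp, one_smul]
  refine ⟨D y, ⟨(hDc y).continuousOn, fun t ht => ?_⟩, fun t ht => ?_⟩
  · rw [hT.duhamel x (F y) (hFc y) (D y) (fun t _ => rfl) t ht]
    congr 1
    refine intervalIntegral.integral_congr fun s hs => ?_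
    rw [uIcc_of_le ht] at hs
    simp only [F, max_eq_left hs.1, hyD s hs.1, Prod.smul_fst]
  · rw [hyD t ht, norm_smul, Real.norm_of_nonneg (Real.exp_pos _).le, mul_comm]
    gcongr
    exact (y.norm_coe_le_norm t).trans hy

end Nonlinear

end DampedWave

/-! ### Translations and the pseudo-Poincaré inequality -/

namespace Heisenberg

open Filter
open scoped RealInnerProductSpace Topology ENNReal

variable {n : ℕ}

/-- The group law of the Heisenberg group. -/
noncomputable def hmul (z g : Heis n) : Heis n :=
  (z.1 + g.1, z.2.1 + g.2.1, z.2.2 + g.2.2 + (z.1 ⬝ᵥ g.2.1 - g.1 ⬝ᵥ z.2.1) / 2)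

lemma hmul_assoc (z g h : Heis n) : hmul (hmul z g) h = hmul z (hmul g h) := by
  refine Prod.ext ?_ (Prod.ext ?_ ?_)
  · simp only [hmul, add_assoc]
  · simp only [hmul, add_assoc]
  · simp only [hmul, add_dotProduct, dotProduct_add]; ring

lemma continuous_dotProduct : Continuous fun p : (Fin n → ℝ) × (Fin n → ℝ) => p.1 ⬝ᵥ p.2 := by
  simp only [dotProduct]; fun_prop

lemma continuous_hmul : Continuous fun p : Heis n × Heis n => hmul p.1 p.2 := by
  have h1 : Continuous fun p : Heis n × Heis n => p.1.1 ⬝ᵥ p.2.2.1 :=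
    continuous_dotProduct.comp (f := fun p : Heis n × Heis n => (p.1.1, p.2.2.1)) (by fun_prop)
  have h2 : Continuous fun p : Heis n × Heis n => p.2.1 ⬝ᵥ p.1.2.1 :=
    continuous_dotProduct.comp (f := fun p : Heis n × Heis n => (p.2.1, p.1.2.1)) (by fun_prop)
  unfold hmul
  fun_prop

/-- Both the left and the right translations are maps of this form. -/
lemma measurePreserving_shear (a b : Fin n → ℝ) (τ : ℝ) {l : (Fin n → ℝ) → (Fin n → ℝ) → ℝ}
    (hl : Measurable (Function.uncurry l)) :
    MeasurePreserving (fun z : Heis n => (z.1 + a, z.2.1 + b, z.2.2 + τ + l z.1 z.2.1))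
      volume volume := by
  have h1 : ∀ x, MeasurePreserving (fun p : (Fin n → ℝ) × ℝ => (p.1 + b, p.2 + τ + l x p.1))
      volume volume := by
    intro x
    refine MeasurePreserving.skew_product (measurePreserving_add_right volume b)
      (g := fun y t => t + τ + l x y) ?_ (ae_of_all _ fun y => ?_)
    · have : Measurable fun p : (Fin n → ℝ) × ℝ => l x p.1 :=
        hl.comp (measurable_const.prodMk measurable_fst)
      exact (measurable_snd.add_const τ).add this
    · have := (measurePreserving_add_right (volume : Measure ℝ) (τ + l x y)).map_eq
      simpa only [add_assoc] using this
  refine MeasurePreserving.skew_product (measurePreserving_add_right volume a)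
    (g := fun x (p : (Fin n → ℝ) × ℝ) => (p.1 + b, p.2 + τ + l x p.1)) ?_
    (ae_of_all _ fun x => (h1 x).map_eq)
  have : Measurable fun q : (Fin n → ℝ) × ((Fin n → ℝ) × ℝ) => l q.1 q.2.1 :=
    hl.comp (measurable_fst.prodMk (measurable_fst.comp measurable_snd))
  exact (((measurable_fst.comp measurable_snd).add_const b).prodMk
    (((measurable_snd.comp measurable_snd).add_const τ).add this))

lemma measurePreserving_hmul_right (g : Heis n) :
    MeasurePreserving (fun z => hmul z g) volume volume := by
  refine measurePreserving_shear g.1 g.2.1 g.2.2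
    (l := fun x y => (x ⬝ᵥ g.2.1 - g.1 ⬝ᵥ y) / 2) ?_
  apply Continuous.measurable
  simp only [Function.uncurry_def, dotProduct]
  fun_prop

lemma measurePreserving_hmul_left (z : Heis n) :
    MeasurePreserving (fun g => hmul z g) volume volume := by
  have := measurePreserving_shear z.1 z.2.1 z.2.2
    (l := fun x y => (z.1 ⬝ᵥ y - x ⬝ᵥ z.2.1) / 2) (by
      apply Continuous.measurable
      simp only [Function.uncurry_def, dotProduct]
      fun_prop)
  convert this using 2 with g
  simp only [hmul, add_comm]

section Gradient

variable {E : Type*} [NormedAddCommGroup E] [NormedSpace ℝ E]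

/-- The `ℓ¹` length `∑ j, (‖X_j F‖ + ‖Y_j F‖)` of the horizontal gradient. -/
noncomputable def hgrad (F : Heis n → E) (z : Heis n) : ℝ :=
  ∑ j, (‖fderiv ℝ F z (Pi.single j 1, 0, -(z.2.1 j) / 2)‖
    + ‖fderiv ℝ F z (0, Pi.single j 1, z.1 j / 2)‖)

lemma hgrad_nonneg (F : Heis n → E) (z : Heis n) : 0 ≤ hgrad F z := by
  unfold hgrad; positivity

lemma continuous_hgrad {F : Heis n → E} (hF : ContDiff ℝ 1 F) : Continuous (hgrad F) := by
  have := hF.continuous_fderiv one_ne_zero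
  unfold hgrad
  fun_prop

/-- The value at `z` of the left-invariant vector field `∑ j, (a_j X_j + b_j Y_j)`. -/
noncomputable def horiz (a b : Fin n → ℝ) (z : Heis n) : Heis n :=
  (a, b, (z.1 ⬝ᵥ b - a ⬝ᵥ z.2.1) / 2)

lemma horiz_eq_sum (a b : Fin n → ℝ) (z : Heis n) :
    horiz a b z = ∑ j, (a j • ((Pi.single j 1, 0, -(z.2.1 j) / 2) : Heis n)
      + b j • ((0, Pi.single j 1, z.1 j / 2) : Heis n)) := by
  refine Prod.ext ?_ (Prod.ext ?_ ?_)
  · simp [horiz, Prod.fst_sum, ← Pi.single_smul, Finset.univ_sum_single]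
  · simp [horiz, Prod.fst_sum, Prod.snd_sum, ← Pi.single_smul, Finset.univ_sum_single]
  · simp only [horiz, dotProduct, Prod.snd_sum, Prod.snd_add, Prod.smul_snd, smul_eq_mul,
      ← Finset.sum_sub_distrib, Finset.sum_div]
    exact Finset.sum_congr rfl fun j _ => by ring

lemma norm_fderiv_horiz_le (F : Heis n → E) (z : Heis n) {a b : Fin n → ℝ} {r : ℝ}
    (ha : ∀ j, |a j| ≤ r) (hb : ∀ j, |b j| ≤ r) :
    ‖fderiv ℝ F z (horiz a b z)‖ ≤ r * hgrad F z := by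
  rw [horiz_eq_sum, map_sum, hgrad, Finset.mul_sum]
  refine (norm_sum_le _ _).trans (Finset.sum_le_sum fun j _ => ?_)
  rw [map_add, map_smul, map_smul, mul_add]
  refine (norm_add_le _ _).trans (add_le_add ?_ ?_)
  · rw [norm_smul]; gcongr; exact ha j
  · rw [norm_smul]; gcongr; exact hb j

lemma hmul_horizontal (z : Heis n) (a b : Fin n → ℝ) (s : ℝ) :
    hmul z (s • a, s • b, 0) = z + s • horiz a b z := by
  refine Prod.ext rfl (Prod.ext rfl ?_)
  simp [hmul, horiz, dotProduct_smul, smul_dotProduct]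
  ring

lemma horiz_hmul (z : Heis n) (a b : Fin n → ℝ) (s : ℝ) :
    horiz a b (hmul z (s • a, s • b, 0)) = horiz a b z := by
  refine Prod.ext rfl (Prod.ext rfl ?_)
  simp [hmul, horiz, dotProduct_add, add_dotProduct, dotProduct_smul, smul_dotProduct]

end Gradient

lemma sq_lintegral_le {α : Type*} [MeasurableSpace α] {μ : Measure α} [IsProbabilityMeasure μ]
    {f : α → ℝ≥0∞} (hf : AEMeasurable f μ) : (∫⁻ x, f x ∂μ) ^ 2 ≤ ∫⁻ x, f x ^ 2 ∂μ := by
  have h := ENNReal.lintegral_mul_le_Lp_mul_Lq μ Real.HolderConjugate.two_two hf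
    (aemeasurable_const (b := (1:ℝ≥0∞)))
  simp only [Pi.mul_apply, mul_one, one_pow, ENNReal.one_rpow, lintegral_const, measure_univ,
    ENNReal.rpow_two] at h
  have h2 := pow_le_pow_left' h 2
  refine h2.trans (le_of_eq ?_)
  rw [← ENNReal.rpow_natCast, ← ENNReal.rpow_mul]
  norm_num

/-- The `L²` distance between a function and its right translate. -/
noncomputable def shiftNorm (F : Heis n → ℝ) (g : Heis n) : ℝ≥0∞ :=
  eLpNorm (fun z => F (hmul z g) - F z) 2 volume

lemma eLpNorm_two_sq {α E : Type*} [MeasurableSpace α] [NormedAddCommGroup E] (μ : Measure α)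
    (f : α → E) : eLpNorm f 2 μ ^ 2 = ∫⁻ x, ‖f x‖ₑ ^ 2 ∂μ := by
  have := eLpNorm_nnreal_pow_eq_lintegral (f := f) (μ := μ) (p := 2) two_ne_zero
  simpa using this

lemma shiftNorm_hmul_le {F : Heis n → ℝ} (hF : Continuous F) (g h : Heis n) :
    shiftNorm F (hmul g h) ≤ shiftNorm F g + shiftNorm F h := by
  have hc : ∀ g, Continuous fun z => F (hmul z g) := fun g =>
    hF.comp (continuous_hmul.comp (continuous_id.prodMk continuous_const))
  have h1 : eLpNorm (fun z => F (hmul (hmul z g) h) - F (hmul z g)) 2 volume = shiftNorm F h :=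
    eLpNorm_comp_measurePreserving (g := fun z => F (hmul z h) - F z)
      (((hc h).sub hF).aestronglyMeasurable) (measurePreserving_hmul_right g)
  rw [add_comm, ← h1]
  have h2 : (fun z => F (hmul z (hmul g h)) - F z)
      = (fun z => F (hmul (hmul z g) h) - F (hmul z g)) + fun z => F (hmul z g) - F z := by
    funext z
    simp [hmul_assoc]
  have hc2 : Continuous fun z => F (hmul (hmul z g) h) := by
    simp only [hmul_assoc]; exact hc _
  rw [shiftNorm, h2]
  exact eLpNorm_add_le (hc2.sub (hc g)).aestronglyMeasurable
    ((hc g).sub hF).aestronglyMeasurable (by norm_num)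

/-- Translation along a horizontal direction: the translate of a function differs from it by an
integral of horizontal derivatives along a straight line. -/
lemma shiftNorm_horizontal_le {F : Heis n → ℝ} (hF : ContDiff ℝ 1 F) {a b : Fin n → ℝ} {r : ℝ}
    (hr : 0 ≤ r) (ha : ∀ j, |a j| ≤ r) (hb : ∀ j, |b j| ≤ r) :
    shiftNorm F (a, b, 0) ≤ ENNReal.ofReal r * eLpNorm (hgrad F) 2 volume := by
  rw [← ENNReal.pow_le_pow_left_iff two_ne_zero, mul_pow, shiftNorm, eLpNorm_two_sq, eLpNorm_two_sq]
  have hg := continuous_hgrad hF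
  set μ : Measure ℝ := volume.restrict (Ioc 0 1) with hμ
  have : IsProbabilityMeasure μ := ⟨by simp [hμ]⟩
  have hGc : Continuous fun q : Heis n × ℝ => hgrad F (hmul q.1 (q.2 • a, q.2 • b, 0)) :=
    hg.comp (continuous_hmul.comp
      (f := fun q : Heis n × ℝ => (q.1, ((q.2 • a, q.2 • b, 0) : Heis n))) (by fun_prop))
  have hpt : ∀ z, ‖F (hmul z (a, b, 0)) - F z‖ₑ ^ 2
      ≤ ENNReal.ofReal r ^ 2 * ∫⁻ s, ‖hgrad F (hmul z (s • a, s • b, 0))‖ₑ ^ 2 ∂μ := by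
    intro z
    have hd : ∀ s : ℝ, HasDerivAt (fun s : ℝ => F (hmul z (s • a, s • b, 0)))
        (fderiv ℝ F (hmul z (s • a, s • b, 0)) (horiz a b (hmul z (s • a, s • b, 0)))) s := by
      intro s
      rw [horiz_hmul]
      have h1 : HasDerivAt (fun s : ℝ => hmul z (s • a, s • b, 0)) (horiz a b z) s := by
        simp only [hmul_horizontal]
        simpa using ((hasDerivAt_id s).smul_const (horiz a b z)).const_add z
      exact ((hF.differentiable one_ne_zero).differentiableAt.hasFDerivAt).comp_hasDerivAt s h1
    have hc : Continuous fun s : ℝ => fderiv ℝ F (hmul z (s • a, s • b, 0))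
        (horiz a b (hmul z (s • a, s • b, 0))) := by
      simp only [horiz_hmul]
      have h1 : Continuous fun s : ℝ => hmul z (s • a, s • b, 0) :=
        continuous_hmul.comp (f := fun s : ℝ => (z, ((s • a, s • b, 0) : Heis n))) (by fun_prop)
      exact ((hF.continuous_fderiv one_ne_zero).comp h1).clm_apply continuous_const
    have hint := intervalIntegral.integral_eq_sub_of_hasDerivAt (a := 0) (b := 1)
      (fun s _ => hd s) (hc.intervalIntegrable _ _)
    have e0 : hmul z ((0:ℝ) • a, (0:ℝ) • b, 0) = z := by rw [hmul_horizontal]; simp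
    rw [e0, one_smul, one_smul, intervalIntegral.integral_of_le zero_le_one] at hint
    rw [← hint]
    calc _ ≤ (∫⁻ s, ‖fderiv ℝ F (hmul z (s • a, s • b, 0))
            (horiz a b (hmul z (s • a, s • b, 0)))‖ₑ ∂μ) ^ 2 := by
            gcongr; exact enorm_integral_le_lintegral_enorm _
      _ ≤ (∫⁻ s, ENNReal.ofReal r * ‖hgrad F (hmul z (s • a, s • b, 0))‖ₑ ∂μ) ^ 2 := by
            gcongr with s
            rw [← ofReal_norm, ← ofReal_norm, ← ENNReal.ofReal_mul hr]
            apply ENNReal.ofReal_le_ofReal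
            rw [Real.norm_of_nonneg (hgrad_nonneg _ _)]
            exact norm_fderiv_horiz_le F _ ha hb
      _ ≤ ENNReal.ofReal r ^ 2 * ∫⁻ s, ‖hgrad F (hmul z (s • a, s • b, 0))‖ₑ ^ 2 ∂μ := by
            rw [lintegral_const_mul' _ _ ENNReal.ofReal_ne_top, mul_pow]
            gcongr
            exact sq_lintegral_le
              ((hGc.comp (continuous_const.prodMk continuous_id)).enorm.aemeasurable)
  calc _ ≤ ∫⁻ z, ENNReal.ofReal r ^ 2 * ∫⁻ s, ‖hgrad F (hmul z (s • a, s • b, 0))‖ₑ ^ 2 ∂μ :=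
        lintegral_mono hpt
    _ = ENNReal.ofReal r ^ 2 * ∫⁻ s, (∫⁻ z, ‖hgrad F (hmul z (s • a, s • b, 0))‖ₑ ^ 2) ∂μ := by
        rw [lintegral_const_mul' _ _ (by finiteness), lintegral_lintegral_swap]
        exact (hGc.enorm.measurable.pow_const 2).aemeasurable
    _ = ENNReal.ofReal r ^ 2 * ∫⁻ z, ‖hgrad F z‖ₑ ^ 2 := by
        congr 1
        have : ∀ s : ℝ, ∫⁻ z : Heis n, ‖hgrad F (hmul z (s • a, s • b, 0))‖ₑ ^ 2
            = ∫⁻ z, ‖hgrad F z‖ₑ ^ 2 := fun s =>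
          (measurePreserving_hmul_right _).lintegral_comp (f := fun z => ‖hgrad F z‖ₑ ^ 2)
            (hg.enorm.measurable.pow_const 2)
        simp only [this, lintegral_const, measure_univ, mul_one]

/-- The pseudo-Poincaré inequality. An element of the box of size `r` is a product of five horizontal
elements of size `r`; the central coordinate is produced by a commutator. -/
lemma shiftNorm_le {F : Heis n → ℝ} (hn : 1 ≤ n) (hF : ContDiff ℝ 1 F) {g : Heis n} {r : ℝ}
    (hr : 0 < r) (ha : ∀ j, |g.1 j| ≤ r) (hb : ∀ j, |g.2.1 j| ≤ r) (hτ : |g.2.2| ≤ r ^ 2) :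
    shiftNorm F g ≤ 5 * (ENNReal.ofReal r * eLpNorm (hgrad F) 2 volume) := by
  set e : Fin n := ⟨0, hn⟩ with he
  set w := g.2.2 / r with hw
  have hwr : |w| ≤ r := by
    rw [hw, abs_div, abs_of_pos hr, div_le_iff₀ hr]; linarith [hτ, pow_two r]
  have hrr : |r| ≤ r := (abs_of_pos hr).le
  have hsingle : ∀ u : ℝ, |u| ≤ r → ∀ j, |(Pi.single e u : Fin n → ℝ) j| ≤ r := by
    intro u hu j
    by_cases h : j = e
    · subst h; simpa using hu
    · simpa [Pi.single_eq_of_ne h] using hr.le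
  have hzero : ∀ j, |(0 : Fin n → ℝ) j| ≤ r := fun j => by simpa using hr.le
  set g₁ : Heis n := (g.1, g.2.1, 0)
  set g₂ : Heis n := (Pi.single e r, 0, 0)
  set g₃ : Heis n := (0, Pi.single e w, 0)
  set g₄ : Heis n := (Pi.single e (-r), 0, 0)
  set g₅ : Heis n := (0, Pi.single e (-w), 0)
  have hprod : g = hmul g₁ (hmul g₂ (hmul g₃ (hmul g₄ g₅))) := by
    have hrw : r * w = g.2.2 := by rw [hw]; field_simp
    refine Prod.ext ?_ (Prod.ext ?_ ?_)
    · simp [hmul, g₁, g₂, g₃, g₄, g₅, ← Pi.single_add]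
    · simp [hmul, g₁, g₂, g₃, g₄, g₅, ← Pi.single_add]
    · simp [hmul, g₁, g₂, g₃, g₄, g₅]
      linarith
  set D := ENNReal.ofReal r * eLpNorm (hgrad F) 2 volume with hD
  have h1 : shiftNorm F g₁ ≤ D := shiftNorm_horizontal_le hF hr.le ha hb
  have h2 : shiftNorm F g₂ ≤ D := shiftNorm_horizontal_le hF hr.le (hsingle r hrr) hzero
  have h3 : shiftNorm F g₃ ≤ D := shiftNorm_horizontal_le hF hr.le hzero (hsingle w hwr)
  have h4 : shiftNorm F g₄ ≤ D :=
    shiftNorm_horizontal_le hF hr.le (hsingle (-r) (by rwa [abs_neg])) hzero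
  have h5 : shiftNorm F g₅ ≤ D :=
    shiftNorm_horizontal_le hF hr.le hzero (hsingle (-w) (by rwa [abs_neg]))
  have hs := fun g h => shiftNorm_hmul_le hF.continuous g h
  rw [hprod]
  calc _ ≤ D + (D + (D + (D + D))) :=
        (hs _ _).trans (add_le_add h1 ((hs _ _).trans (add_le_add h2
          ((hs _ _).trans (add_le_add h3 ((hs _ _).trans (add_le_add h4 h5)))))))
    _ = 5 * D := by ring

/-- The box of size `r` around the origin. -/
def box (n : ℕ) (r : ℝ) : Set (Heis n) :=
  Icc (fun _ => -r) (fun _ => r) ×ˢ Icc (fun _ => -r) (fun _ => r) ×ˢ Icc (-r ^ 2) (r ^ 2)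

lemma volume_box {r : ℝ} (hr : 0 ≤ r) :
    volume (box n r) = ENNReal.ofReal (2 * 4 ^ n * r ^ (2 * (n + 1))) := by
  rw [box, Measure.volume_eq_prod, Measure.prod_prod, Measure.volume_eq_prod, Measure.prod_prod,
    Real.volume_Icc_pi, Real.volume_Icc]
  simp only [Finset.prod_const, Finset.card_univ, Fintype.card_fin]
  have hr2 : 0 ≤ r - -r := by linarith
  rw [← ENNReal.ofReal_pow hr2, ← ENNReal.ofReal_mul (by positivity),
    ← ENNReal.ofReal_mul (by positivity)]
  congr 1
  rw [show r - -r = 2 * r by ring, show r ^ 2 - -r ^ 2 = 2 * r ^ 2 by ring, mul_pow,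
    show (4 : ℝ) = 2 * 2 by norm_num, mul_pow]
  ring

lemma measurableSet_box (r : ℝ) : MeasurableSet (box n r) :=
  measurableSet_Icc.prod (measurableSet_Icc.prod measurableSet_Icc)

/-- A function whose support has at most half the measure of the box of size `r` can be equal to `1`
only on a set of measure controlled by its horizontal gradient. -/
lemma volume_eq_one_le_of_box {F : Heis n → ℝ} (hn : 1 ≤ n) (hF : ContDiff ℝ 1 F) {r : ℝ}
    (hr : 0 < r) (hbox : 2 * volume {z | F z ≠ 0} ≤ volume (box n r)) :
    volume {z | F z = 1} ≤ 50 * ENNReal.ofReal (r ^ 2) * ∫⁻ z, ‖hgrad F z‖ₑ ^ 2 := by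
  set B := box n r with hB
  set V := volume B with hV
  set G := ∫⁻ z, ‖hgrad F z‖ₑ ^ 2 with hG
  have hV0 : V ≠ 0 := by
    rw [hV, hB, volume_box hr.le]
    simp only [ne_eq, ENNReal.ofReal_eq_zero, not_le]; positivity
  have hVt : V ≠ ⊤ := by rw [hV, hB, volume_box hr.le]; exact ENNReal.ofReal_ne_top
  have hFc := hF.continuous
  have hmeas1 : MeasurableSet {z | F z = 1} := (isClosed_eq hFc continuous_const).measurableSet
  have hmeas0 : MeasurableSet {z | F z ≠ 0} := (isOpen_ne_fun hFc continuous_const).measurableSet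
  have hlow : ∀ z ∈ {z | F z = 1}, V / 2 ≤ ∫⁻ g in B, ‖F (hmul z g) - F z‖ₑ ^ 2 := by
    intro z hz
    have hz : F z = 1 := hz
    set A := (fun g => hmul z g) ⁻¹' {z | F z ≠ 0} with hA
    have hAv : volume A = volume {z | F z ≠ 0} :=
      (measurePreserving_hmul_left z).measure_preimage hmeas0.nullMeasurableSet
    have h1 : V / 2 ≤ volume (B \ A) := by
      have h2 : V ≤ volume A + volume (B \ A) := by
        rw [hV]
        calc volume B ≤ volume (A ∪ (B \ A)) := by
              apply measure_mono; rw [union_sdiff_self]; exact subset_union_right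
          _ ≤ _ := measure_union_le _ _
      have h3 : volume A ≤ V / 2 := by
        rw [hAv, ENNReal.le_div_iff_mul_le (by simp) (by simp), mul_comm]; exact hbox
      have h4 : V / 2 + V / 2 ≤ V / 2 + volume (B \ A) := by
        rw [ENNReal.add_halves]; exact h2.trans (by gcongr)
      exact (ENNReal.add_le_add_iff_left (by
        simp [ENNReal.div_eq_top, hVt])).1 h4
    refine h1.trans ?_
    have hAm : MeasurableSet A := (measurePreserving_hmul_left z).measurable hmeas0
    calc volume (B \ A) = ∫⁻ _ in B \ A, 1 := by simp
      _ ≤ ∫⁻ g in B \ A, ‖F (hmul z g) - F z‖ₑ ^ 2 := by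
          refine setLIntegral_mono' ((measurableSet_box r).diff hAm) fun g hg => ?_
          have : F (hmul z g) = 0 := by
            by_contra hcon; exact hg.2 hcon
          rw [this, hz]; simp
      _ ≤ _ := lintegral_mono_set sdiff_subset
  have hcont : Measurable fun q : Heis n × Heis n => ‖F (hmul q.1 q.2) - F q.1‖ₑ ^ 2 :=
    ((hFc.comp continuous_hmul).sub (hFc.comp continuous_fst)).enorm.measurable.pow_const 2
  have hup : ∫⁻ z, ∫⁻ g in B, ‖F (hmul z g) - F z‖ₑ ^ 2
      ≤ V * (25 * ENNReal.ofReal (r ^ 2) * G) := by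
    rw [lintegral_lintegral_swap hcont.aemeasurable]
    calc _ ≤ ∫⁻ _ in B, 25 * ENNReal.ofReal (r ^ 2) * G := by
          refine setLIntegral_mono' (measurableSet_box r) fun g hg => ?_
          have h1 := shiftNorm_le hn hF (g := g) hr
            (fun j => abs_le.2 ⟨hg.1.1 j, hg.1.2 j⟩)
            (fun j => abs_le.2 ⟨hg.2.1.1 j, hg.2.1.2 j⟩) (abs_le.2 hg.2.2)
          have h2 := pow_le_pow_left' h1 2
          rw [mul_pow, mul_pow, eLpNorm_two_sq, shiftNorm, eLpNorm_two_sq,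
            ← ENNReal.ofReal_pow hr.le] at h2
          refine h2.trans (le_of_eq ?_)
          rw [← hG]; ring
      _ = _ := by rw [setLIntegral_const, mul_comm]
  have h1 : V / 2 * volume {z | F z = 1} ≤ V * (25 * ENNReal.ofReal (r ^ 2) * G) := by
    calc _ = ∫⁻ _ in {z | F z = 1}, V / 2 := by rw [setLIntegral_const]
      _ ≤ ∫⁻ z in {z | F z = 1}, ∫⁻ g in B, ‖F (hmul z g) - F z‖ₑ ^ 2 :=
          setLIntegral_mono' hmeas1 hlow
      _ ≤ _ := (setLIntegral_le_lintegral _ _).trans hup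
  have h2 : V * volume {z | F z = 1} ≤ V * (50 * ENNReal.ofReal (r ^ 2) * G) := by
    calc _ = 2 * (V / 2 * volume {z | F z = 1}) := by
            rw [← mul_assoc, ENNReal.mul_div_cancel two_ne_zero ENNReal.ofNat_ne_top]
      _ ≤ 2 * (V * (25 * ENNReal.ofReal (r ^ 2) * G)) := by gcongr
      _ = _ := by ring
  exact (ENNReal.mul_le_mul_iff_right hV0 hVt).1 h2

/-- The preceding estimate for the box whose measure is twice that of the support. -/
lemma volume_eq_one_le {F : Heis n → ℝ} (hn : 1 ≤ n) (hF : ContDiff ℝ 1 F)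
    (hfin : volume {z | F z ≠ 0} ≠ ⊤) :
    volume {z | F z = 1} ≤ 50 * volume {z | F z ≠ 0} ^ (1 / ((n : ℝ) + 1))
      * ∫⁻ z, ‖hgrad F z‖ₑ ^ 2 := by
  set a := volume {z | F z ≠ 0} with ha
  have hle : volume {z | F z = 1} ≤ a := measure_mono fun z hz => by
    have : F z = 1 := hz
    simp [this]
  rcases eq_or_ne a 0 with h0 | h0
  · rw [h0] at hle
    rw [nonpos_iff_eq_zero.1 hle]; exact zero_le
  have hα : 0 < a.toReal := ENNReal.toReal_pos h0 hfin
  set r : ℝ := (a.toReal / 4 ^ n) ^ (1 / (2 * ((n : ℝ) + 1))) with hr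
  have hr0 : 0 < r := Real.rpow_pos_of_pos (by positivity) _
  have hrp : r ^ (2 * (n + 1)) = a.toReal / 4 ^ n := by
    rw [hr, ← Real.rpow_natCast, ← Real.rpow_mul (by positivity)]
    push_cast
    rw [one_div_mul_cancel (by positivity), Real.rpow_one]
  have hr2 : r ^ 2 ≤ a.toReal ^ (1 / ((n : ℝ) + 1)) := by
    rw [hr, ← Real.rpow_natCast, ← Real.rpow_mul (by positivity)]
    have : 1 / (2 * ((n : ℝ) + 1)) * ((2 : ℕ) : ℝ) = 1 / ((n : ℝ) + 1) := by
      push_cast; field_simp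
    rw [this]
    refine Real.rpow_le_rpow (by positivity) ?_ (by positivity)
    exact div_le_self hα.le (one_le_pow₀ (by norm_num))
  refine (volume_eq_one_le_of_box hn hF hr0 ?_).trans ?_
  · rw [volume_box hr0.le, hrp, ← ha]
    rw [show 2 * 4 ^ n * (a.toReal / 4 ^ n) = 2 * a.toReal by field_simp,
      ENNReal.ofReal_mul (by norm_num), ENNReal.ofReal_toReal hfin]
    simp
  · gcongr
    calc ENNReal.ofReal (r ^ 2) ≤ ENNReal.ofReal (a.toReal ^ (1 / ((n : ℝ) + 1))) :=
          ENNReal.ofReal_le_ofReal hr2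
      _ = _ := by
        rw [← ENNReal.ofReal_rpow_of_pos hα, ENNReal.ofReal_toReal hfin]

end Heisenberg

/-! ### The critical Sobolev inequality by truncation -/

namespace Heisenberg

open Filter
open scoped RealInnerProductSpace Topology ENNReal

variable {n : ℕ}

lemma deriv_smoothTransition_eq_zero {x : ℝ} (hx : x ∉ Ioo (0:ℝ) 1) :
    deriv Real.smoothTransition x = 0 := by
  rcases le_or_gt x 0 with h | h
  · refine IsLocalMin.deriv_eq_zero (Eventually.of_forall fun y => ?_)
    rw [Real.smoothTransition.zero_of_nonpos h]; exact Real.smoothTransition.nonneg y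
  · have h1 : 1 ≤ x := not_lt.1 fun h1 => hx ⟨h, h1⟩
    refine IsLocalMax.deriv_eq_zero (Eventually.of_forall fun y => ?_)
    rw [Real.smoothTransition.one_of_one_le h1]; exact Real.smoothTransition.le_one y

lemma exists_deriv_smoothTransition_le : ∃ D : ℝ, 0 ≤ D ∧ ∀ x,
    |deriv Real.smoothTransition x| ≤ D := by
  have hc : Continuous (deriv Real.smoothTransition) :=
    (Real.smoothTransition.contDiff (n := 1)).continuous_deriv le_rfl
  obtain ⟨D, hD⟩ := (isCompact_Icc (a := (0:ℝ)) (b := 1)).exists_bound_of_continuousOn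
    hc.continuousOn
  have hD0 : 0 ≤ D := (norm_nonneg _).trans (hD 0 (by simp))
  refine ⟨D, hD0, fun x => ?_⟩
  by_cases hx : x ∈ Ioo (0:ℝ) 1
  · exact hD x (Ioo_subset_Icc_self hx)
  · rw [deriv_smoothTransition_eq_zero hx]; simpa using hD0

/-- A smooth function of `‖φ‖` that increases from `0` where `‖φ‖ ≤ l` to `1` where
`2 * l ≤ ‖φ‖`. -/
noncomputable def trunc (φ : Heis n → ℂ) (l : ℝ) (z : Heis n) : ℝ :=
  Real.smoothTransition (‖φ z‖ ^ 2 * (1 / (3 * l ^ 2)) - 1 / 3)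

section Trunc

variable {φ : Heis n → ℂ} {l : ℝ}

lemma trunc_arg_pos_iff (hl : 0 < l) (z : Heis n) :
    0 < ‖φ z‖ ^ 2 * (1 / (3 * l ^ 2)) - 1 / 3 ↔ l < ‖φ z‖ := by
  have : ‖φ z‖ ^ 2 * (1 / (3 * l ^ 2)) - 1 / 3 = (‖φ z‖ ^ 2 - l ^ 2) * (1 / (3 * l ^ 2)) := by
    field_simp
  rw [this, mul_pos_iff_of_pos_right (by positivity), sub_pos,
    sq_lt_sq₀ hl.le (norm_nonneg _)]

lemma trunc_arg_one_le_iff (hl : 0 < l) (z : Heis n) :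
    1 ≤ ‖φ z‖ ^ 2 * (1 / (3 * l ^ 2)) - 1 / 3 ↔ 2 * l ≤ ‖φ z‖ := by
  have : ‖φ z‖ ^ 2 * (1 / (3 * l ^ 2)) - 1 / 3 - 1
      = (‖φ z‖ ^ 2 - (2 * l) ^ 2) * (1 / (3 * l ^ 2)) := by
    field_simp; ring
  rw [← sub_nonneg, this, mul_nonneg_iff_of_pos_right (by positivity), sub_nonneg,
    sq_le_sq₀ (by positivity) (norm_nonneg _)]

lemma trunc_ne_zero_iff (hl : 0 < l) (z : Heis n) : trunc φ l z ≠ 0 ↔ l < ‖φ z‖ := by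
  rw [← trunc_arg_pos_iff hl, trunc, Ne, Real.smoothTransition.zero_iff_nonpos, not_le]

lemma trunc_eq_one_iff (hl : 0 < l) (z : Heis n) : trunc φ l z = 1 ↔ 2 * l ≤ ‖φ z‖ := by
  rw [← trunc_arg_one_le_iff hl, trunc, Real.smoothTransition.eq_one_iff_one_le]

lemma contDiff_trunc (hφ : ContDiff ℝ 1 φ) : ContDiff ℝ 1 (trunc φ l) :=
  Real.smoothTransition.contDiff.comp (((hφ.norm_sq ℝ).mul contDiff_const).sub contDiff_const)

lemma norm_fderiv_trunc_le {D : ℝ} (hD : 0 ≤ D) (hDd : ∀ x, |deriv Real.smoothTransition x| ≤ D)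
    (hφ : ContDiff ℝ 1 φ) (hl : 0 < l) (z d : Heis n) :
    ‖fderiv ℝ (trunc φ l) z d‖
      ≤ {z | l < ‖φ z‖ ∧ ‖φ z‖ ≤ 2 * l}.indicator (fun _ => 4 * D / (3 * l)) z
        * ‖fderiv ℝ φ z d‖ := by
  have h1 : HasFDerivAt φ (fderiv ℝ φ z) z :=
    (hφ.differentiable one_ne_zero).differentiableAt.hasFDerivAt
  have h2 := (h1.norm_sq.mul_const (1 / (3 * l ^ 2))).sub_const (1 / 3)
  have h3 : HasDerivAt Real.smoothTransition
      (deriv Real.smoothTransition (‖φ z‖ ^ 2 * (1 / (3 * l ^ 2)) - 1 / 3))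
      (‖φ z‖ ^ 2 * (1 / (3 * l ^ 2)) - 1 / 3) :=
    ((Real.smoothTransition.contDiff (n := 1)).differentiable one_ne_zero).differentiableAt.hasDerivAt
  have h4 := h3.comp_hasFDerivAt z h2
  have h5 : fderiv ℝ (trunc φ l) z = _ := h4.fderiv
  rw [h5]
  by_cases hz : ‖φ z‖ ^ 2 * (1 / (3 * l ^ 2)) - 1 / 3 ∈ Ioo (0:ℝ) 1
  · have z1 : l < ‖φ z‖ := (trunc_arg_pos_iff hl z).1 hz.1
    have z2 : ‖φ z‖ ≤ 2 * l := le_of_lt (not_le.1 fun h => not_lt.2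
      ((trunc_arg_one_le_iff hl z).2 h) hz.2)
    rw [indicator_of_mem (show z ∈ {z | l < ‖φ z‖ ∧ ‖φ z‖ ≤ 2 * l} from ⟨z1, z2⟩)]
    simp only [smul_apply, ContinuousLinearMap.comp_apply, innerSL_apply_apply, smul_eq_mul,
      norm_mul, nsmul_eq_mul, Real.norm_eq_abs]
    have h6 : |⟪φ z, fderiv ℝ φ z d⟫| ≤ 2 * l * ‖fderiv ℝ φ z d‖ :=
      (abs_real_inner_le_norm _ _).trans (by gcongr)
    have h7 := hDd (‖φ z‖ ^ 2 * (1 / (3 * l ^ 2)) - 1 / 3)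
    rw [abs_of_pos (show (0:ℝ) < 1 / (3 * l ^ 2) by positivity)]
    calc _ ≤ D * (1 / (3 * l ^ 2) * (|((2 : ℕ) : ℝ)| * (2 * l * ‖fderiv ℝ φ z d‖))) := by gcongr
      _ = _ := by
        rw [Nat.abs_cast]; push_cast
        field_simp
        ring
  · rw [deriv_smoothTransition_eq_zero hz, zero_smul]
    simp only [zero_apply, norm_zero]
    exact mul_nonneg (indicator_nonneg (fun _ _ => by positivity) _) (norm_nonneg _)

lemma hgrad_trunc_le {D : ℝ} (hD : 0 ≤ D) (hDd : ∀ x, |deriv Real.smoothTransition x| ≤ D)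
    (hφ : ContDiff ℝ 1 φ) (hl : 0 < l) (z : Heis n) :
    hgrad (trunc φ l) z ≤ {z | l < ‖φ z‖ ∧ ‖φ z‖ ≤ 2 * l}.indicator (fun _ => 4 * D / (3 * l)) z
        * hgrad φ z := by
  rw [hgrad, hgrad, Finset.mul_sum]
  refine Finset.sum_le_sum fun j _ => ?_
  rw [mul_add]
  exact add_le_add (norm_fderiv_trunc_le hD hDd hφ hl _ _) (norm_fderiv_trunc_le hD hDd hφ hl _ _)

end Trunc

/-- The weak-type step of the Sobolev inequality: the measure of a superlevel set is controlled by
that of a lower one and the horizontal gradient in between. -/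
lemma exists_volume_superlevel_le (n : ℕ) (hn : 1 ≤ n) :
    ∃ C : ℝ≥0∞, C ≠ ⊤ ∧ ∀ φ : Heis n → ℂ, ContDiff ℝ 1 φ → HasCompactSupport φ →
      ∀ l : ℝ, 0 < l → volume {z | 2 * l < ‖φ z‖} ≤
        C * volume {z | l < ‖φ z‖} ^ (1 / ((n : ℝ) + 1)) * ENNReal.ofReal (l ^ (-2 : ℝ))
          * ∫⁻ z in {z | l < ‖φ z‖ ∧ ‖φ z‖ ≤ 2 * l}, ‖hgrad φ z‖ₑ ^ 2 := by
  obtain ⟨D, hD, hDd⟩ := exists_deriv_smoothTransition_le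
  refine ⟨50 * ENNReal.ofReal ((4 * D / 3) ^ 2), by finiteness, fun φ hφ hφs l hl => ?_⟩
  have hφc := hφ.continuous
  have hsupp : {z | trunc φ l z ≠ 0} = {z | l < ‖φ z‖} := by
    ext z; exact trunc_ne_zero_iff hl z
  have hfin : volume {z | trunc φ l z ≠ 0} ≠ ⊤ := by
    rw [hsupp]
    refine ((measure_mono fun z hz => ?_).trans_lt hφs.isCompact.measure_lt_top).ne
    refine subset_tsupport _ (Function.mem_support.2 fun h0 => ?_)
    have hz : l < ‖φ z‖ := hz
    rw [h0, norm_zero] at hz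
    exact absurd hz (not_lt.2 hl.le)
  have h := volume_eq_one_le hn (contDiff_trunc (l := l) hφ) hfin
  rw [hsupp] at h
  set A := {z | l < ‖φ z‖ ∧ ‖φ z‖ ≤ 2 * l} with hA
  have hAm : MeasurableSet A :=
    ((isOpen_lt continuous_const hφc.norm).measurableSet).inter
      (isClosed_le hφc.norm continuous_const).measurableSet
  have hgr : ∫⁻ z, ‖hgrad (trunc φ l) z‖ₑ ^ 2
      ≤ ENNReal.ofReal ((4 * D / 3) ^ 2) * ENNReal.ofReal (l ^ (-2 : ℝ))
        * ∫⁻ z in A, ‖hgrad φ z‖ₑ ^ 2 := by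
    rw [← ENNReal.ofReal_mul (by positivity), ← lintegral_indicator hAm,
      ← lintegral_const_mul' _ _ ENNReal.ofReal_ne_top]
    refine lintegral_mono fun z => ?_
    have h1 := hgrad_trunc_le hD hDd hφ hl z
    by_cases hz : z ∈ A
    · rw [indicator_of_mem hz] at h1 ⊢
      rw [Real.enorm_of_nonneg (hgrad_nonneg _ _), Real.enorm_of_nonneg (hgrad_nonneg _ _),
        ← ENNReal.ofReal_pow (hgrad_nonneg _ _), ← ENNReal.ofReal_pow (hgrad_nonneg _ _),
        ← ENNReal.ofReal_mul (by positivity)]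
      apply ENNReal.ofReal_le_ofReal
      have h2 := pow_le_pow_left₀ (hgrad_nonneg _ _) h1 2
      refine h2.trans (le_of_eq ?_)
      rw [Real.rpow_neg hl.le, Real.rpow_two]
      field_simp
    · rw [indicator_of_notMem hz, zero_mul] at h1
      rw [le_antisymm h1 (hgrad_nonneg _ _)]
      simp
  calc volume {z | 2 * l < ‖φ z‖} ≤ volume {z | trunc φ l z = 1} :=
        measure_mono fun z hz => (trunc_eq_one_iff hl z).2 (le_of_lt hz)
    _ ≤ _ := h.trans (mul_le_mul_right hgr _)
    _ = _ := by ring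

lemma exists_zpow_two_mem {x : ℝ} (hx : 0 < x) : ∃ k : ℤ, (2:ℝ) ^ k < x ∧ x ≤ 2 * (2:ℝ) ^ k := by
  obtain ⟨k, hk⟩ := exists_mem_Ioc_zpow hx (one_lt_two (α := ℝ))
  exact ⟨k, hk.1, hk.2.trans (le_of_eq (by rw [zpow_add_one₀ two_ne_zero, mul_comm]))⟩

/-- The critical Sobolev inequality on the Heisenberg group, for test functions: the exponent is
`2 + 2 / n = 2 Q / (Q - 2)`, where `Q = 2 n + 2` is the homogeneous dimension. The proof sums the
weak-type inequalities over the dyadic levels `2 ^ k`; the powers of `2 ^ k` cancel precisely for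
the critical exponent. -/
theorem exists_sobolev (n : ℕ) (hn : 1 ≤ n) :
    ∃ C : ℝ≥0∞, C ≠ ⊤ ∧ ∀ φ : Heis n → ℂ, ContDiff ℝ 1 φ → HasCompactSupport φ →
      (∫⁻ z, ‖φ z‖ₑ ^ (2 + 2 / (n : ℝ))) ^ ((n : ℝ) / (n + 1)) ≤ C * ∫⁻ z, ‖hgrad φ z‖ₑ ^ 2 := by
  obtain ⟨C, hC, hweak⟩ := exists_volume_superlevel_le n hn
  have hn0 : (0:ℝ) < n := by exact_mod_cast hn
  set q : ℝ := 2 + 2 / (n : ℝ) with hq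
  set θ : ℝ := 1 / ((n : ℝ) + 1) with hθ
  have hq0 : 0 < q := by positivity
  have hθ0 : 0 < θ := by positivity
  have hcrit : q - q * θ - 2 = 0 := by
    rw [hq, hθ]; field_simp; ring
  have hθ' : (n : ℝ) / (n + 1) = 1 - θ := by rw [hθ]; field_simp; ring
  refine ⟨C * ENNReal.ofReal (4 ^ q), by finiteness, fun φ hφ hφs => ?_⟩
  have hφc := hφ.continuous
  set I := ∫⁻ z, ‖φ z‖ₑ ^ q with hI
  set E := ∫⁻ z, ‖hgrad φ z‖ₑ ^ 2 with hE
  have hmeasq : Measurable fun z => ‖φ z‖ₑ ^ q := hφc.enorm.measurable.pow_const q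
  have hIfin : I ≠ ⊤ := by
    have h1 : MemLp φ (ENNReal.ofReal q) volume := hφc.memLp_of_hasCompactSupport hφs
    have h2 := lintegral_rpow_enorm_lt_top_of_eLpNorm_lt_top
      (by simpa using hq0) ENNReal.ofReal_ne_top h1.2
    rw [ENNReal.toReal_ofReal hq0.le] at h2
    exact h2.ne
  set A : ℤ → Set (Heis n) := fun k => {z | (2:ℝ) ^ k < ‖φ z‖ ∧ ‖φ z‖ ≤ 2 * (2:ℝ) ^ k} with hA
  have hAm : ∀ k, MeasurableSet (A k) := fun k =>
    ((isOpen_lt continuous_const hφc.norm).measurableSet).inter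
      (isClosed_le hφc.norm continuous_const).measurableSet
  have hAd : Pairwise (Function.onFun Disjoint A) := by
    have key : ∀ i j : ℤ, i < j → Disjoint (A i) (A j) := by
      intro i j hij
      rw [Set.disjoint_left]
      rintro z ⟨-, h1⟩ ⟨h2, -⟩
      have h3 : (2:ℝ) * 2 ^ i ≤ 2 ^ j := by
        rw [mul_comm, ← zpow_add_one₀ two_ne_zero]
        exact zpow_le_zpow_right₀ one_le_two hij
      linarith
    intro i j hij
    rcases lt_or_gt_of_ne hij with h | h
    · exact key i j h
    · exact (key j i h).symm
  set a : ℤ → ℝ≥0∞ := fun k => volume {z | (2:ℝ) ^ k < ‖φ z‖} with ha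
  have hpow : ∀ k : ℤ, (0:ℝ) < 2 ^ k := fun k => zpow_pos two_pos k
  have hcheb : ∀ k, a k ≤ ENNReal.ofReal (((2:ℝ) ^ k) ^ (-q)) * I := by
    intro k
    have h1 := mul_meas_ge_le_lintegral₀ hmeasq.aemeasurable (ENNReal.ofReal (((2:ℝ) ^ k) ^ q))
      (μ := volume)
    have h2 : a k ≤ volume {z | ENNReal.ofReal (((2:ℝ) ^ k) ^ q) ≤ ‖φ z‖ₑ ^ q} := by
      refine measure_mono fun z hz => ?_
      have hz : (2:ℝ) ^ k < ‖φ z‖ := hz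
      rw [mem_ofPred_eq, ← ENNReal.ofReal_rpow_of_pos (hpow k), ← ofReal_norm]
      gcongr
    have h3 : ENNReal.ofReal (((2:ℝ) ^ k) ^ (-q)) * ENNReal.ofReal (((2:ℝ) ^ k) ^ q) = 1 := by
      rw [← ENNReal.ofReal_mul (Real.rpow_pos_of_pos (hpow k) _).le,
        ← Real.rpow_add (hpow k), neg_add_cancel, Real.rpow_zero, ENNReal.ofReal_one]
    calc a k = ENNReal.ofReal (((2:ℝ) ^ k) ^ (-q)) * (ENNReal.ofReal (((2:ℝ) ^ k) ^ q) * a k) := by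
            rw [← mul_assoc, h3, one_mul]
      _ ≤ _ := by gcongr; exact (mul_le_mul_right h2 _).trans h1
  have hterm : ∀ k : ℤ, ∫⁻ z in A (k + 1), ‖φ z‖ₑ ^ q
      ≤ C * ENNReal.ofReal (4 ^ q) * I ^ θ * ∫⁻ z in A k, ‖hgrad φ z‖ₑ ^ 2 := by
    intro k
    set l : ℝ := (2:ℝ) ^ k with hl
    have hl0 : 0 < l := hpow k
    have hl1 : (2:ℝ) ^ (k + 1) = 2 * l := by rw [zpow_add_one₀ two_ne_zero, mul_comm]
    have h1 : ∫⁻ z in A (k + 1), ‖φ z‖ₑ ^ q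
        ≤ ENNReal.ofReal ((4 * l) ^ q) * volume {z | 2 * l < ‖φ z‖} := by
      calc _ ≤ ∫⁻ _ in A (k + 1), ENNReal.ofReal ((4 * l) ^ q) := by
            refine setLIntegral_mono' (hAm _) fun z hz => ?_
            rw [← ENNReal.ofReal_rpow_of_pos (by positivity), ← ofReal_norm]
            have h2 : ‖φ z‖ ≤ 2 * (2:ℝ) ^ (k + 1) := hz.2
            rw [hl1] at h2
            gcongr
            linarith
        _ = ENNReal.ofReal ((4 * l) ^ q) * volume (A (k + 1)) := setLIntegral_const _ _
        _ ≤ _ := by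
            gcongr
            intro z hz
            have h2 : (2:ℝ) ^ (k + 1) < ‖φ z‖ := hz.1
            rwa [hl1] at h2
    have h2 := hweak φ hφ hφs l hl0
    have h3 : volume {z | l < ‖φ z‖} ^ θ ≤ ENNReal.ofReal (l ^ (-(q * θ))) * I ^ θ := by
      have h4 : a k ^ θ ≤ (ENNReal.ofReal (l ^ (-q)) * I) ^ θ := by
        have := hcheb k; gcongr
      rwa [ENNReal.mul_rpow_of_nonneg _ _ hθ0.le,
        ENNReal.ofReal_rpow_of_pos (Real.rpow_pos_of_pos hl0 _), ← Real.rpow_mul hl0.le,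
        neg_mul] at h4
    have h5 : ENNReal.ofReal ((4 * l) ^ q) * ENNReal.ofReal (l ^ (-(q * θ)))
        * ENNReal.ofReal (l ^ (-2 : ℝ)) = ENNReal.ofReal (4 ^ q) := by
      rw [← ENNReal.ofReal_mul (by positivity), ← ENNReal.ofReal_mul (by positivity),
        Real.mul_rpow (by norm_num) hl0.le, mul_assoc, mul_assoc, ← Real.rpow_add hl0,
        ← Real.rpow_add hl0, show q + (-(q * θ) + -2) = 0 by linarith, Real.rpow_zero, mul_one]
    calc _ ≤ ENNReal.ofReal ((4 * l) ^ q) * (C * (ENNReal.ofReal (l ^ (-(q * θ))) * I ^ θ)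
            * ENNReal.ofReal (l ^ (-2 : ℝ)) * ∫⁻ z in A k, ‖hgrad φ z‖ₑ ^ 2) := by
            refine h1.trans (mul_le_mul_right (h2.trans ?_) _)
            gcongr
      _ = C * (ENNReal.ofReal ((4 * l) ^ q) * ENNReal.ofReal (l ^ (-(q * θ)))
            * ENNReal.ofReal (l ^ (-2 : ℝ))) * I ^ θ * ∫⁻ z in A k, ‖hgrad φ z‖ₑ ^ 2 := by ring
      _ = _ := by rw [h5]
  have hsplit : I = ∑' k : ℤ, ∫⁻ z in A k, ‖φ z‖ₑ ^ q := by
    rw [← lintegral_iUnion hAm hAd, hI, ← setLIntegral_eq_of_support_subset]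
    intro z hz
    have h0 : φ z ≠ 0 := by
      intro h0
      apply hz
      simp [h0, hq0]
    obtain ⟨k, hk⟩ := exists_zpow_two_mem (norm_pos_iff.2 h0)
    exact mem_iUnion.2 ⟨k, hk⟩
  have hsum : ∑' k : ℤ, ∫⁻ z in A k, ‖hgrad φ z‖ₑ ^ 2 ≤ E := by
    rw [← lintegral_iUnion hAm hAd]
    exact setLIntegral_le_lintegral _ _
  have hmain : I ≤ I ^ θ * (C * ENNReal.ofReal (4 ^ q) * E) := by
    calc I = ∑' k : ℤ, ∫⁻ z in A (k + 1), ‖φ z‖ₑ ^ q := by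
          rw [hsplit]; exact ((Equiv.addRight (1:ℤ)).tsum_eq _).symm
      _ ≤ ∑' k : ℤ, C * ENNReal.ofReal (4 ^ q) * I ^ θ * ∫⁻ z in A k, ‖hgrad φ z‖ₑ ^ 2 :=
          ENNReal.tsum_le_tsum hterm
      _ = C * ENNReal.ofReal (4 ^ q) * I ^ θ * ∑' k : ℤ, ∫⁻ z in A k, ‖hgrad φ z‖ₑ ^ 2 :=
          ENNReal.tsum_mul_left
      _ ≤ C * ENNReal.ofReal (4 ^ q) * I ^ θ * E := by gcongr
      _ = _ := by ring
  rw [hθ']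
  rcases eq_or_ne I 0 with h0 | h0
  · have hθ1 : 0 < 1 - θ := by rw [← hθ']; positivity
    rw [h0, ENNReal.zero_rpow_of_pos hθ1]; exact zero_le
  · have h1 : I = I ^ θ * I ^ (1 - θ) := by
      rw [← ENNReal.rpow_add _ _ h0 hIfin]; simp
    have h2 : I ^ θ * I ^ (1 - θ) ≤ I ^ θ * (C * ENNReal.ofReal (4 ^ q) * E) := by rwa [← h1]
    exact (ENNReal.mul_le_mul_iff_right (by simp [h0, hIfin])
      (ENNReal.rpow_ne_top_of_nonneg hθ0.le hIfin)).1 h2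

end Heisenberg

/-! ### Test functions and integration by parts -/

namespace Heisenberg

open Filter
open scoped RealInnerProductSpace Topology ENNReal

variable {n : ℕ}

instance : (volume : Measure (Heis n)).IsAddHaarMeasure :=
  have : (volume : Measure ((Fin n → ℝ) × ℝ)).IsAddHaarMeasure :=
    Measure.prod.instIsAddHaarMeasure _ _
  Measure.prod.instIsAddHaarMeasure _ _

section TestFunctions

variable {φ ψ : Heis n → ℂ}

lemma IsTest.continuous (h : IsTest φ) : Continuous φ := h.1.continuous

lemma IsTest.differentiable (h : IsTest φ) : Differentiable ℝ φ :=
  h.1.differentiable (by simp)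

lemma IsTest.memLp (h : IsTest φ) (p : ℝ≥0∞) : MemLp φ p (volume : Measure (Heis n)) :=
  h.continuous.memLp_of_hasCompactSupport h.2

lemma IsTest.integrable (h : IsTest φ) : Integrable φ (volume : Measure (Heis n)) :=
  h.continuous.integrable_of_hasCompactSupport h.2

lemma isTest_zero : IsTest (fun _ : Heis n => (0 : ℂ)) :=
  ⟨contDiff_const, HasCompactSupport.zero⟩

lemma IsTest.add (h : IsTest φ) (h' : IsTest ψ) : IsTest (fun z => φ z + ψ z) :=
  ⟨h.1.add h'.1, h.2.add h'.2⟩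

lemma IsTest.mul (h : IsTest φ) (h' : IsTest ψ) : IsTest (fun z => φ z * ψ z) :=
  ⟨h.1.mul h'.1, h.2.mul_right⟩

lemma IsTest.const_mul (h : IsTest φ) (c : ℂ) : IsTest (fun z => c * φ z) :=
  ⟨contDiff_const.mul h.1, h.2.mul_left⟩

lemma IsTest.neg (h : IsTest φ) : IsTest (fun z => -φ z) := by
  simpa using h.const_mul (-1)

lemma IsTest.sub (h : IsTest φ) (h' : IsTest ψ) : IsTest (fun z => φ z - ψ z) := by
  simpa [sub_eq_add_neg] using h.add h'.neg

lemma IsTest.sum {ι : Type*} (s : Finset ι) {φ : ι → Heis n → ℂ} (h : ∀ i, IsTest (φ i)) :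
    IsTest (fun z => ∑ i ∈ s, φ i z) := by
  classical
  induction s using Finset.induction_on with
  | empty => simpa using isTest_zero
  | insert a s ha ih => simpa [Finset.sum_insert ha] using (h a).add ih

lemma IsTest.conj (h : IsTest φ) : IsTest (fun z => starRingEnd ℂ (φ z)) :=
  ⟨Complex.conjCLE.contDiff.comp h.1, h.2.comp_left (map_zero _)⟩

lemma IsTest.fderiv_apply (h : IsTest φ) {v : Heis n → Heis n} (hv : ContDiff ℝ ∞ v) :
    IsTest (fun z => fderiv ℝ φ z (v z)) := by
  refine ⟨(h.1.fderiv_right (m := ∞) (by simp)).clm_apply hv, ?_⟩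
  refine (h.2.fderiv (𝕜 := ℝ)).mono fun z hz h0 => hz ?_
  simp only [h0, zero_apply]

lemma IsTest.X (h : IsTest φ) (j : Fin n) : IsTest (X j φ) :=
  h.fderiv_apply (by fun_prop)

lemma IsTest.Y (h : IsTest φ) (j : Fin n) : IsTest (Y j φ) :=
  h.fderiv_apply (by fun_prop)

lemma IsTest.subLaplacian (h : IsTest φ) : IsTest (subLaplacian φ) :=
  IsTest.sum _ fun j => ((h.X j).X j).add ((h.Y j).Y j)

lemma fderiv_conj (h : IsTest φ) (z v : Heis n) :
    fderiv ℝ (fun z => starRingEnd ℂ (φ z)) z v = starRingEnd ℂ (fderiv ℝ φ z v) := by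
  have := (Complex.conjCLE.hasFDerivAt.comp z (h.differentiable z).hasFDerivAt).fderiv
  exact DFunLike.congr_fun this v

lemma X_conj (h : IsTest φ) (j : Fin n) :
    X j (fun z => starRingEnd ℂ (φ z)) = fun z => starRingEnd ℂ (X j φ z) :=
  funext fun z => fderiv_conj h z _

lemma Y_conj (h : IsTest φ) (j : Fin n) :
    Y j (fun z => starRingEnd ℂ (φ z)) = fun z => starRingEnd ℂ (Y j φ z) :=
  funext fun z => fderiv_conj h z _

lemma subLaplacian_conj (h : IsTest φ) :
    subLaplacian (fun z => starRingEnd ℂ (φ z)) = fun z => starRingEnd ℂ (subLaplacian φ z) := by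
  funext z
  simp only [subLaplacian, X_conj h, Y_conj h, X_conj (h.X _), Y_conj (h.Y _), map_sum, map_add]

/-- A test function has vanishing integral after differentiation along a vector field
`v + a ∂_t` whose coefficient `a` does not depend on `t`. -/
lemma integral_fderiv_eq_zero (h : IsTest φ) (v : Heis n) {a : Heis n → ℝ}
    (ha : ContDiff ℝ ∞ a) (hat : ∀ z, fderiv ℝ a z (0, 0, 1) = 0) :
    ∫ z, fderiv ℝ φ z (v + a z • ((0, 0, 1) : Heis n)) = 0 := by
  have hcon : ∀ v : Heis n, IsTest fun z => fderiv ℝ φ z v := fun v => h.fderiv_apply contDiff_const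
  have h1 : ∫ z, fderiv ℝ φ z v = 0 := by
    have := integral_mul_fderiv_eq_neg_fderiv_mul_of_integrable (μ := (volume : Measure (Heis n)))
      (f := fun _ => (1 : ℂ)) (g := φ) (v := v) (by simp) (by simpa using (hcon v).integrable)
      (by simpa using h.integrable) (fun x _ => differentiableAt_const _)
      (fun x _ => h.differentiable x)
    simpa using this
  set e : Heis n := (0, 0, 1) with he
  have hac : ContDiff ℝ ∞ fun z => (a z : ℂ) := Complex.ofRealCLM.contDiff.comp ha
  have hmul : ∀ {ψ : Heis n → ℂ}, IsTest ψ → IsTest fun z => (a z : ℂ) * ψ z := fun hψ =>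
    ⟨hac.mul hψ.1, hψ.2.mul_left⟩
  have hae : ∀ z, fderiv ℝ (fun z => (a z : ℂ)) z e = 0 := by
    intro z
    have h2 := (Complex.ofRealCLM.hasFDerivAt.comp z
      ((ha.differentiable (by simp)) z).hasFDerivAt).fderiv
    have h3 : fderiv ℝ (fun z => (a z : ℂ)) z e = ((fderiv ℝ a z e : ℝ) : ℂ) :=
      DFunLike.congr_fun h2 e
    rw [h3, hat, Complex.ofReal_zero]
  have h2 : ∫ z, (a z : ℂ) * fderiv ℝ φ z e = 0 := by
    have := integral_mul_fderiv_eq_neg_fderiv_mul_of_integrable (μ := (volume : Measure (Heis n)))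
      (f := fun z => (a z : ℂ)) (g := φ) (v := e) (by simp [hae]) (hmul (hcon e)).integrable
      (hmul h).integrable (fun x _ => (hac.differentiable (by simp)) x)
      (fun x _ => h.differentiable x)
    simpa [hae] using this
  simp only [map_add, map_smul, Complex.real_smul]
  rw [integral_add (hcon v).integrable (hmul (hcon e)).integrable, h1, h2, add_zero]

lemma integral_X_eq_zero (h : IsTest φ) (j : Fin n) : ∫ z, X j φ z = 0 := by
  have := integral_fderiv_eq_zero h ((Pi.single j 1, 0, 0) : Heis n)
    (a := fun z => -(z.2.1 j) / 2) (by fun_prop) (fun z => by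
      have : HasFDerivAt (fun z : Heis n => -(z.2.1 j) / 2)
          ((2⁻¹ : ℝ) • -((ContinuousLinearMap.proj j).comp
            ((ContinuousLinearMap.fst ℝ (Fin n → ℝ) ℝ).comp
              (ContinuousLinearMap.snd ℝ (Fin n → ℝ) ((Fin n → ℝ) × ℝ))))) z := by
        refine (ContinuousLinearMap.hasFDerivAt _).congr_of_eventuallyEq
          (Eventually.of_forall fun y => ?_)
        simp; ring
      rw [this.fderiv]; simp)
  simpa [X] using this

lemma integral_Y_eq_zero (h : IsTest φ) (j : Fin n) : ∫ z, Y j φ z = 0 := by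
  have := integral_fderiv_eq_zero h ((0, Pi.single j 1, 0) : Heis n)
    (a := fun z => z.1 j / 2) (by fun_prop) (fun z => by
      have : HasFDerivAt (fun z : Heis n => z.1 j / 2)
          ((2⁻¹ : ℝ) • ((ContinuousLinearMap.proj j).comp
              (ContinuousLinearMap.fst ℝ (Fin n → ℝ) ((Fin n → ℝ) × ℝ)))) z := by
        refine (ContinuousLinearMap.hasFDerivAt _).congr_of_eventuallyEq
          (Eventually.of_forall fun y => ?_)
        simp; ring
      rw [this.fderiv]; simp)
  simpa [Y] using this

lemma fderiv_mul_apply (h : IsTest φ) (h' : IsTest ψ) (z v : Heis n) :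
    fderiv ℝ (fun z => φ z * ψ z) z v = φ z * fderiv ℝ ψ z v + fderiv ℝ φ z v * ψ z := by
  have := ((h.differentiable z).hasFDerivAt.fun_mul (h'.differentiable z).hasFDerivAt).fderiv
  have h2 := DFunLike.congr_fun this v
  simpa [mul_comm (ψ z)] using h2

lemma integral_mul_X (h : IsTest φ) (h' : IsTest ψ) (j : Fin n) :
    ∫ z, φ z * X j ψ z = -∫ z, X j φ z * ψ z := by
  have h1 := integral_X_eq_zero (h.mul h') j
  have h2 : X j (fun z => φ z * ψ z) = fun z => φ z * X j ψ z + X j φ z * ψ z :=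
    funext fun z => fderiv_mul_apply h h' z _
  rw [h2, integral_add (h.mul (h'.X j)).integrable ((h.X j).mul h').integrable] at h1
  exact eq_neg_of_add_eq_zero_left h1

lemma integral_mul_Y (h : IsTest φ) (h' : IsTest ψ) (j : Fin n) :
    ∫ z, φ z * Y j ψ z = -∫ z, Y j φ z * ψ z := by
  have h1 := integral_Y_eq_zero (h.mul h') j
  have h2 : Y j (fun z => φ z * ψ z) = fun z => φ z * Y j ψ z + Y j φ z * ψ z :=
    funext fun z => fderiv_mul_apply h h' z _
  rw [h2, integral_add (h.mul (h'.Y j)).integrable ((h.Y j).mul h').integrable] at h1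
  exact eq_neg_of_add_eq_zero_left h1

end TestFunctions

/-- The class of a test function in `L²`. -/
noncomputable def testLp (φ : Heis n → ℂ) (h : IsTest φ) : L2 n := (h.memLp 2).toLp φ

lemma coeFn_testLp {φ : Heis n → ℂ} (h : IsTest φ) : testLp φ h =ᵐ[volume] φ := MemLp.coeFn_toLp _

/-- The inner product is conjugate-linear in its first argument. -/
lemma inner_testLp_left {φ : Heis n → ℂ} (h : IsTest φ) (u : L2 n) :
    inner ℂ (testLp φ h) u = ∫ z, u z * starRingEnd ℂ (φ z) := by
  rw [L2.inner_def]
  refine integral_congr_ae ?_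
  filter_upwards [coeFn_testLp h] with z hz
  rw [hz, RCLike.inner_apply]

lemma inner_testLp {φ ψ : Heis n → ℂ} (h : IsTest φ) (h' : IsTest ψ) :
    inner ℂ (testLp φ h) (testLp ψ h') = ∫ z, ψ z * starRingEnd ℂ (φ z) := by
  rw [inner_testLp_left]
  refine integral_congr_ae ?_
  filter_upwards [coeFn_testLp h'] with z hz
  rw [hz]

lemma inner_testLp_X {φ ψ : Heis n → ℂ} (h : IsTest φ) (h' : IsTest ψ) (j : Fin n) :
    inner ℂ (testLp _ (h.X j)) (testLp _ (h'.X j)) = -inner ℂ (testLp _ ((h.X j).X j)) (testLp ψ h') := by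
  rw [inner_testLp, inner_testLp]
  have := integral_mul_X (h.X j).conj h' j
  rw [X_conj (h.X j)] at this
  simpa only [mul_comm] using this

lemma inner_testLp_Y {φ ψ : Heis n → ℂ} (h : IsTest φ) (h' : IsTest ψ) (j : Fin n) :
    inner ℂ (testLp _ (h.Y j)) (testLp _ (h'.Y j)) = -inner ℂ (testLp _ ((h.Y j).Y j)) (testLp ψ h') := by
  rw [inner_testLp, inner_testLp]
  have := integral_mul_Y (h.Y j).conj h' j
  rw [Y_conj (h.Y j)] at this
  simpa only [mul_comm] using this

/-- The class in `L²` of `φ - 𝓛 φ`. -/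
noncomputable def helmholtz (φ : Heis n → ℂ) (h : IsTest φ) : L2 n :=
  testLp _ (h.sub h.subLaplacian)

lemma helmholtz_eq {φ : Heis n → ℂ} (h : IsTest φ) : helmholtz φ h = testLp φ h
    - ∑ j, (testLp _ ((h.X j).X j) + testLp _ ((h.Y j).Y j)) := by
  refine Lp.ext ?_
  have hs : ∀ᵐ z : Heis n, ∀ j : Fin n, testLp _ ((h.X j).X j) z = X j (X j φ) z ∧
      testLp _ ((h.Y j).Y j) z = Y j (Y j φ) z :=
    ae_all_iff.2 fun j => (coeFn_testLp _).and (coeFn_testLp _)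
  have hadd : ∀ᵐ z : Heis n, ∀ j : Fin n,
      (testLp _ ((h.X j).X j) + testLp _ ((h.Y j).Y j) : L2 n) z
        = testLp _ ((h.X j).X j) z + testLp _ ((h.Y j).Y j) z :=
    ae_all_iff.2 fun j => Lp.coeFn_add _ _
  have hfs := Lp.coeFn_finsetSum Finset.univ
    (fun j => (testLp _ ((h.X j).X j) + testLp _ ((h.Y j).Y j) : L2 n))
  filter_upwards [coeFn_testLp (h.sub h.subLaplacian), coeFn_testLp h, hs, hadd, hfs,
    Lp.coeFn_sub (testLp φ h) (∑ j, (testLp _ ((h.X j).X j) + testLp _ ((h.Y j).Y j)))]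
    with z h1 h2 h3 h4 h5 h6
  rw [helmholtz, h1, h6, Pi.sub_apply, h2, h5, Finset.sum_apply]
  congr 1
  refine Finset.sum_congr rfl fun j _ => ?_
  rw [h4, (h3 j).1, (h3 j).2]

/-- The tuple `(φ, X φ, Y φ)`. -/
noncomputable def gradTuple (φ : Heis n → ℂ) (h : IsTest φ) : GradSpace n :=
  WithLp.toLp 2 fun o => match o with
    | none => testLp φ h
    | some (Sum.inl j) => testLp _ (h.X j)
    | some (Sum.inr j) => testLp _ (h.Y j)

lemma inner_gradTuple {φ : Heis n → ℂ} (h : IsTest φ) (w : GradSpace n) :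
    inner ℂ (gradTuple φ h) w = inner ℂ (testLp φ h) (w none)
      + ∑ j, (inner ℂ (testLp _ (h.X j)) (w (some (Sum.inl j)))
        + inner ℂ (testLp _ (h.Y j)) (w (some (Sum.inr j)))) := by
  rw [PiLp.inner_apply, Fintype.sum_option, Fintype.sum_sum_type, Finset.sum_add_distrib]
  rfl

lemma inner_gradTuple_gradTuple {φ ψ : Heis n → ℂ} (h : IsTest φ) (h' : IsTest ψ) :
    inner ℂ (gradTuple φ h) (gradTuple ψ h') = inner ℂ (helmholtz φ h) (testLp ψ h') := by
  rw [inner_gradTuple, helmholtz_eq, inner_sub_left, sum_inner, sub_eq_add_neg,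
    ← Finset.sum_neg_distrib]
  congr 1
  refine Finset.sum_congr rfl fun j _ => ?_
  rw [inner_add_left, neg_add, ← inner_testLp_X h, ← inner_testLp_Y h]
  rfl

/-- The set spanning a dense subspace of the form domain is already a linear subspace. -/
lemma exists_test_of_mem_span {w : GradSpace n}
    (hw : w ∈ Submodule.span ℂ {w : GradSpace n | ∃ φ : Heis n → ℂ, IsTest φ ∧
      w none =ᵐ[volume] φ ∧
      ∀ j : Fin n, w (some (Sum.inl j)) =ᵐ[volume] X j φ ∧
        w (some (Sum.inr j)) =ᵐ[volume] Y j φ}) :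
    ∃ φ, ∃ h : IsTest φ, w = gradTuple φ h := by
  have key : ∃ φ : Heis n → ℂ, IsTest φ ∧ w none =ᵐ[volume] φ ∧
      ∀ j : Fin n, w (some (Sum.inl j)) =ᵐ[volume] X j φ ∧
        w (some (Sum.inr j)) =ᵐ[volume] Y j φ := by
    have fadd : ∀ {φ ψ : Heis n → ℂ}, IsTest φ → IsTest ψ → ∀ z v : Heis n,
        fderiv ℝ (fun z => φ z + ψ z) z v = fderiv ℝ φ z v + fderiv ℝ ψ z v := by
      intro φ ψ hφ hψ z v
      rw [((hφ.differentiable z).hasFDerivAt.fun_add (hψ.differentiable z).hasFDerivAt).fderiv]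
      rfl
    have fsmul : ∀ {φ : Heis n → ℂ}, IsTest φ → ∀ (c : ℂ) (z v : Heis n),
        fderiv ℝ (fun z => c * φ z) z v = c * fderiv ℝ φ z v := by
      intro φ hφ c z v
      rw [((hφ.differentiable z).hasFDerivAt.const_mul c).fderiv]
      rfl
    induction hw using Submodule.span_induction with
    | mem w hw => exact hw
    | zero =>
      refine ⟨_, isTest_zero, Lp.coeFn_zero _ _ _, fun j => ⟨?_, ?_⟩⟩
      · refine (Lp.coeFn_zero _ _ _).trans (ae_of_all _ fun z => ?_)
        simp [X]
      · refine (Lp.coeFn_zero _ _ _).trans (ae_of_all _ fun z => ?_)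
        simp [Y]
    | add w w' _ _ hw hw' =>
      obtain ⟨φ, hφ, h0, hj⟩ := hw
      obtain ⟨ψ, hψ, h0', hj'⟩ := hw'
      refine ⟨_, hφ.add hψ, (Lp.coeFn_add _ _).trans (h0.add h0'), fun j => ⟨?_, ?_⟩⟩
      · refine (Lp.coeFn_add _ _).trans (((hj j).1.add (hj' j).1).trans (ae_of_all _ fun z => ?_))
        exact (fadd hφ hψ z _).symm
      · refine (Lp.coeFn_add _ _).trans (((hj j).2.add (hj' j).2).trans (ae_of_all _ fun z => ?_))
        exact (fadd hφ hψ z _).symm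
    | smul c w _ hw =>
      obtain ⟨φ, hφ, h0, hj⟩ := hw
      refine ⟨_, hφ.const_mul c, (Lp.coeFn_smul _ _).trans (h0.const_smul c), fun j => ⟨?_, ?_⟩⟩
      · refine (Lp.coeFn_smul _ _).trans (((hj j).1.const_smul c).trans (ae_of_all _ fun z => ?_))
        exact (fsmul hφ c z _).symm
      · refine (Lp.coeFn_smul _ _).trans (((hj j).2.const_smul c).trans (ae_of_all _ fun z => ?_))
        exact (fsmul hφ c z _).symm
  obtain ⟨φ, hφ, h0, hj⟩ := key
  refine ⟨φ, hφ, ?_⟩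
  ext1 o
  match o with
  | none => exact Lp.ext (h0.trans (coeFn_testLp hφ).symm)
  | some (Sum.inl j) => exact Lp.ext ((hj j).1.trans (coeFn_testLp (hφ.X j)).symm)
  | some (Sum.inr j) => exact Lp.ext ((hj j).2.trans (coeFn_testLp (hφ.Y j)).symm)

lemma gradTuple_mem {φ : Heis n → ℂ} (h : IsTest φ) : gradTuple φ h ∈ formDomain n :=
  Submodule.le_topologicalClosure _ (Submodule.subset_span
    ⟨φ, h, coeFn_testLp h, fun j => ⟨coeFn_testLp (h.X j), coeFn_testLp (h.Y j)⟩⟩)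

/-- Closed conditions on the form domain can be checked on the tuples of test functions. -/
lemma formDomain_subset_of_isClosed {A : Set (GradSpace n)} (hA : IsClosed A)
    (h : ∀ φ (hφ : IsTest φ), gradTuple φ hφ ∈ A) {w : GradSpace n} (hw : w ∈ formDomain n) :
    w ∈ A := by
  refine closure_minimal (fun w hw => ?_) hA hw
  obtain ⟨φ, hφ, rfl⟩ := exists_test_of_mem_span hw
  exact h φ hφ

lemma inner_gradTuple_formDomain {φ : Heis n → ℂ} (h : IsTest φ) (w : formDomain n) :
    inner ℂ (gradTuple φ h) (w : GradSpace n) = inner ℂ (helmholtz φ h) (formEmbedding n w) := by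
  have hcl : IsClosed {w : GradSpace n | inner ℂ (gradTuple φ h) w
      = inner ℂ (helmholtz φ h) (w none)} :=
    isClosed_eq (by fun_prop) (continuous_const.inner
      (PiLp.continuous_apply 2 (fun _ : Option (Fin n ⊕ Fin n) => L2 n) none))
  exact formDomain_subset_of_isClosed hcl (fun ψ hψ => inner_gradTuple_gradTuple h hψ) w.2

lemma adjoint_helmholtz {φ : Heis n → ℂ} (h : IsTest φ) :
    ContinuousLinearMap.adjoint (formEmbedding n) (helmholtz φ h)
      = ⟨gradTuple φ h, gradTuple_mem h⟩ := by
  refine ext_inner_right ℂ fun w => ?_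
  rw [ContinuousLinearMap.adjoint_inner_left, ← inner_gradTuple_formDomain]
  rfl

/-- Integration by parts in operator form: `(I - 𝓛)⁻¹ (φ - 𝓛 φ) = φ` for test functions. -/
lemma resolvent_helmholtz {φ : Heis n → ℂ} (h : IsTest φ) :
    resolvent n (helmholtz φ h) = testLp φ h := by
  rw [resolvent, ContinuousLinearMap.comp_apply, adjoint_helmholtz]
  rfl

end Heisenberg

/-! ### The operators of the form domain, Sobolev embedding and the nonlinearity -/

namespace Heisenberg

open Filter
open scoped RealInnerProductSpace Topology ENNReal

variable {n : ℕ}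

lemma real_inner_eq_re (u v : L2 n) : inner ℝ u v = (inner ℂ u v).re := by
  have h := integral_re (𝕜 := ℂ) (L2.integrable_inner (𝕜 := ℂ) u v)
  rw [L2.inner_def, L2.inner_def]
  refine Eq.trans ?_ h
  refine integral_congr_ae (ae_of_all _ fun z => ?_)
  simp [Complex.inner]

section Operators

lemma opSqrt_isPositive {H : Type*} [NormedAddCommGroup H] [InnerProductSpace ℂ H]
    [CompleteSpace H] (T : H →L[ℂ] H) : (opSqrt T).IsPositive :=
  (ContinuousLinearMap.nonneg_iff_isPositive _).1 (CFC.sqrt_nonneg _)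

lemma opSqrt_mul_self {H : Type*} [NormedAddCommGroup H] [InnerProductSpace ℂ H]
    [CompleteSpace H] {T : H →L[ℂ] H} (hT : T.IsPositive) : opSqrt T * opSqrt T = T :=
  CFC.sqrt_mul_sqrt_self T ((ContinuousLinearMap.nonneg_iff_isPositive _).2 hT)

lemma formEmbedding_norm_le (w : formDomain n) : ‖formEmbedding n w‖ ≤ ‖w‖ :=
  PiLp.norm_apply_le (w : GradSpace n) none

lemma resolvent_isPositive (n : ℕ) : (resolvent n).IsPositive :=
  ContinuousLinearMap.isPositive_self_comp_adjoint _

lemma invSqrt_isPositive (n : ℕ) : (invSqrt n).IsPositive :=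
  opSqrt_isPositive _

lemma invSqrt_invSqrt (u : L2 n) : invSqrt n (invSqrt n u) = resolvent n u :=
  DFunLike.congr_fun (opSqrt_mul_self (resolvent_isPositive n)) u

lemma inner_invSqrt (u v : L2 n) : inner ℂ (invSqrt n u) v = inner ℂ u (invSqrt n v) :=
  (invSqrt_isPositive n).isSymmetric u v

/-- `(I - 𝓛)^{-1/2} u ↦ J† u` is isometric, since both sides have the square norm
`⟪(I - 𝓛)⁻¹ u, u⟫`. -/
lemma norm_invSqrt (u : L2 n) :
    ‖invSqrt n u‖ = ‖ContinuousLinearMap.adjoint (formEmbedding n) u‖ := by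
  have h : inner ℂ (invSqrt n u) (invSqrt n u)
      = inner ℂ (ContinuousLinearMap.adjoint (formEmbedding n) u)
        (ContinuousLinearMap.adjoint (formEmbedding n) u) := by
    rw [inner_invSqrt, invSqrt_invSqrt, ContinuousLinearMap.adjoint_inner_left]
    rfl
  rw [norm_eq_sqrt_re_inner (𝕜 := ℂ) (invSqrt n u), h]
  exact (norm_eq_sqrt_re_inner (𝕜 := ℂ) (ContinuousLinearMap.adjoint (formEmbedding n) u)).symm

lemma norm_invSqrt_le (u : L2 n) : ‖invSqrt n u‖ ≤ ‖u‖ := by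
  rw [norm_invSqrt]
  refine (ContinuousLinearMap.le_opNorm _ _).trans ?_
  rw [LinearIsometryEquiv.norm_map]
  have : ‖formEmbedding n‖ ≤ 1 := ContinuousLinearMap.opNorm_le_bound _ zero_le_one fun w => by
    rw [one_mul]; exact formEmbedding_norm_le w
  nlinarith [norm_nonneg u]

lemma eq_zero_of_inner_testLp {u : L2 n} (h : ∀ φ (hφ : IsTest φ), inner ℂ (testLp φ hφ) u = 0) :
    u = 0 := by
  refine Lp.ext (EventuallyEq.trans ?_ (Lp.coeFn_zero _ _ _).symm)
  refine ae_eq_zero_of_integral_contDiff_smul_eq_zero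
    ((Lp.memLp u).locallyIntegrable (by norm_num)) fun g hg hgs => ?_
  have hφ : IsTest fun z => (g z : ℂ) :=
    ⟨Complex.ofRealCLM.contDiff.comp hg, hgs.comp_left Complex.ofReal_zero⟩
  have h1 := h _ hφ
  rw [inner_testLp_left] at h1
  simpa [mul_comm] using h1

lemma invSqrt_injective (n : ℕ) : Function.Injective (invSqrt n) := by
  rw [injective_iff_map_eq_zero]
  intro u hu
  have h1 : ContinuousLinearMap.adjoint (formEmbedding n) u = 0 := by
    rw [← norm_eq_zero, ← norm_invSqrt, hu, norm_zero]
  refine eq_zero_of_inner_testLp fun φ hφ => ?_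
  have h2 : inner ℂ (⟨gradTuple φ hφ, gradTuple_mem hφ⟩ : formDomain n)
      (ContinuousLinearMap.adjoint (formEmbedding n) u) = 0 := by rw [h1, inner_zero_right]
  rw [ContinuousLinearMap.adjoint_inner_right] at h2
  exact h2

/-- `(I - 𝓛)^{-1/2}` as an operator of the real Hilbert space underlying `L²`. -/
noncomputable def realInvSqrt (n : ℕ) : L2 n →L[ℝ] L2 n := (invSqrt n).restrictScalars ℝ

@[simp] lemma realInvSqrt_apply (u : L2 n) : realInvSqrt n u = invSqrt n u := rfl

lemma isPosContraction_realInvSqrt (n : ℕ) : DampedWave.IsPosContraction (realInvSqrt n) where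
  symm x y := by
    rw [realInvSqrt_apply, realInvSqrt_apply, real_inner_eq_re, real_inner_eq_re, inner_invSqrt]
  nonneg x := by
    rw [realInvSqrt_apply, real_inner_eq_re]
    exact (invSqrt_isPositive n).re_inner_nonneg_left x
  norm_le := norm_invSqrt_le
  inj := invSqrt_injective n

lemma denseRange_invSqrt (n : ℕ) : DenseRange (invSqrt n) :=
  (isPosContraction_realInvSqrt n).denseRange

/-- The isometry of `L²` into the form domain that factors `(I - 𝓛)^{-1/2}` through the inclusion
of the form domain, obtained by extending `(I - 𝓛)^{-1/2} u ↦ J† u`. -/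
noncomputable def formLift (n : ℕ) : L2 n →L[ℂ] formDomain n :=
  (ContinuousLinearMap.adjoint (formEmbedding n) : L2 n →ₗ[ℂ] formDomain n).extendOfNorm
    (invSqrt n : L2 n →ₗ[ℂ] L2 n)

lemma formLift_invSqrt (u : L2 n) :
    formLift n (invSqrt n u) = ContinuousLinearMap.adjoint (formEmbedding n) u :=
  LinearMap.extendOfNorm_eq (denseRange_invSqrt n) ⟨1, fun u => by
    rw [one_mul]; exact (norm_invSqrt u).ge⟩ u

lemma norm_formLift_le (u : L2 n) : ‖formLift n u‖ ≤ ‖u‖ := by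
  have := LinearMap.norm_extendOfNorm_apply_le
    (f := (ContinuousLinearMap.adjoint (formEmbedding n) : L2 n →ₗ[ℂ] formDomain n))
    (e := (invSqrt n : L2 n →ₗ[ℂ] L2 n)) (denseRange_invSqrt n) 1 (fun u => by
      rw [one_mul]; exact (norm_invSqrt u).ge) u
  rwa [one_mul] at this

lemma formEmbedding_formLift (u : L2 n) : formEmbedding n (formLift n u) = invSqrt n u := by
  refine (denseRange_invSqrt n).induction_on
    (p := fun u => formEmbedding n (formLift n u) = invSqrt n u) u ?_ fun v => ?_
  · exact isClosed_eq ((formEmbedding n).continuous.comp (formLift n).continuous)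
      (invSqrt n).continuous
  · rw [formLift_invSqrt, invSqrt_invSqrt]; rfl

/-- The vectors `(I - 𝓛)^{-1/2} (φ - 𝓛 φ)`, with `φ` a test function, are total in `L²`. -/
lemma eq_zero_of_inner_invSqrt_helmholtz {u : L2 n}
    (h : ∀ φ (hφ : IsTest φ), inner ℂ (invSqrt n (helmholtz φ hφ)) u = 0) : u = 0 := by
  have h1 : ∀ φ (hφ : IsTest φ), inner ℂ (gradTuple φ hφ) (formLift n u : GradSpace n) = 0 := by
    intro φ hφ
    rw [inner_gradTuple_formDomain, formEmbedding_formLift, ← inner_invSqrt, h]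
  have h2 : inner ℂ (formLift n u : GradSpace n) (formLift n u : GradSpace n) = 0 :=
    formDomain_subset_of_isClosed
      (A := {w | inner ℂ w (formLift n u : GradSpace n) = 0})
      (isClosed_eq (by fun_prop) continuous_const) h1 (formLift n u).2
  have h3 : formLift n u = 0 := Subtype.ext (inner_self_eq_zero.1 h2)
  apply invSqrt_injective n
  rw [← formEmbedding_formLift, h3, map_zero, map_zero]

lemma sqrtOneSub_invSqrt (σ : L2 n) : sqrtOneSub (invSqrt n σ) = σ :=
  Function.leftInverse_invFun (invSqrt_injective n) σ

lemma invSqrt_sqrtOneSub {u : L2 n} (h : MemH1 u) : invSqrt n (sqrtOneSub u) = u :=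
  Function.invFun_eq h

end Operators

section Sobolev

lemma eLpNorm_test_le {φ : Heis n → ℂ} (h : IsTest φ) {c : ℝ} (hc : ‖testLp φ h‖ ≤ c) :
    eLpNorm φ 2 volume ≤ ENNReal.ofReal c := by
  have : ‖testLp φ h‖ₑ = eLpNorm φ 2 volume := Lp.enorm_toLp _
  rw [← this, ← ofReal_norm]
  exact ENNReal.ofReal_le_ofReal hc

lemma eLpNorm_hgrad_le {φ : Heis n → ℂ} (h : IsTest φ) (h1 : ‖gradTuple φ h‖ ≤ 1) :
    eLpNorm (hgrad φ) 2 volume ≤ 2 * n := by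
  have hX : ∀ j, eLpNorm (fun z => ‖X j φ z‖) 2 volume ≤ 1 := fun j => by
    rw [eLpNorm_norm, ← ENNReal.ofReal_one]
    exact eLpNorm_test_le (h.X j)
      ((PiLp.norm_apply_le (gradTuple φ h) (some (Sum.inl j))).trans h1)
  have hY : ∀ j, eLpNorm (fun z => ‖Y j φ z‖) 2 volume ≤ 1 := fun j => by
    rw [eLpNorm_norm, ← ENNReal.ofReal_one]
    exact eLpNorm_test_le (h.Y j)
      ((PiLp.norm_apply_le (gradTuple φ h) (some (Sum.inr j))).trans h1)
  have hXm : ∀ j, AEStronglyMeasurable (fun z => ‖X j φ z‖) volume := fun j =>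
    (h.X j).continuous.norm.aestronglyMeasurable
  have hYm : ∀ j, AEStronglyMeasurable (fun z => ‖Y j φ z‖) volume := fun j =>
    (h.Y j).continuous.norm.aestronglyMeasurable
  have heq : hgrad φ = ∑ j, ((fun z => ‖X j φ z‖) + fun z => ‖Y j φ z‖) := by
    funext z
    rw [Finset.sum_apply]
    rfl
  rw [heq]
  refine (eLpNorm_sum_le (fun j _ => (hXm j).add (hYm j)) (by norm_num)).trans ?_
  calc _ ≤ ∑ _j : Fin n, (1 + 1 : ℝ≥0∞) := Finset.sum_le_sum fun j _ =>
        (eLpNorm_add_le (hXm j) (hYm j) (by norm_num)).trans (add_le_add (hX j) (hY j))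
    _ = 2 * n := by
        rw [Finset.sum_const, Finset.card_univ, Fintype.card_fin, nsmul_eq_mul, one_add_one_eq_two,
          mul_comm]

lemma rpow_le_rpow_add_rpow {x : ℝ≥0∞} {a r q : ℝ} (har : a ≤ r) (hrq : r ≤ q) :
    x ^ r ≤ x ^ a + x ^ q := by
  rcases le_total x 1 with h | h
  · exact (ENNReal.rpow_le_rpow_of_exponent_ge h har).trans le_self_add
  · exact (ENNReal.rpow_le_rpow_of_exponent_le h hrq).trans le_add_self

/-- For test functions of norm at most `1` in the form domain, the norm in `L^{2p}` is bounded, by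
interpolation between `L²` and the critical exponent `2 + 2 / n`. -/
lemma exists_sobolev_test (n : ℕ) (hn : 1 ≤ n) {p : ℝ} (hp1 : 1 < p) (hp2 : p ≤ 1 + 1 / (n : ℝ)) :
    ∃ K : ℝ≥0∞, K ≠ ⊤ ∧ ∀ (φ : Heis n → ℂ) (h : IsTest φ), ‖gradTuple φ h‖ ≤ 1 →
      eLpNorm φ (ENNReal.ofReal (2 * p)) volume ≤ K := by
  obtain ⟨C, hC, hsob⟩ := exists_sobolev n hn
  have hn0 : (0:ℝ) < n := by exact_mod_cast hn
  set q : ℝ := 2 + 2 / (n : ℝ) with hq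
  set κ : ℝ := ((n : ℝ) + 1) / n with hκ
  have hκ0 : 0 ≤ κ := by positivity
  have hp0 : 0 < 2 * p := by linarith
  have hK1 : (C * (2 * n) ^ 2) ^ κ ≠ ⊤ :=
    ENNReal.rpow_ne_top_of_nonneg hκ0 (by finiteness)
  refine ⟨(1 + (C * (2 * n) ^ 2) ^ κ) ^ (1 / (2 * p)),
    ENNReal.rpow_ne_top_of_nonneg (by positivity) (by finiteness), fun φ h h1 => ?_⟩
  have hI : ∫⁻ z, ‖φ z‖ₑ ^ q ≤ (C * (2 * n) ^ 2) ^ κ := by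
    have h2 := hsob φ (h.1.of_le (by simp)) h.2
    rw [← eLpNorm_two_sq] at h2
    have h3 : (∫⁻ z, ‖φ z‖ₑ ^ q) ^ ((n : ℝ) / (n + 1)) ≤ C * (2 * n) ^ 2 :=
      h2.trans (by gcongr; exact eLpNorm_hgrad_le h h1)
    have h4 := ENNReal.rpow_le_rpow h3 hκ0
    rwa [← ENNReal.rpow_mul, hκ, div_mul_div_comm, mul_comm (n : ℝ), div_self (by positivity),
      ENNReal.rpow_one] at h4
  have h2 : ∫⁻ z, ‖φ z‖ₑ ^ (2:ℝ) ≤ 1 := by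
    have h3 : eLpNorm φ 2 volume ≤ ENNReal.ofReal 1 :=
      eLpNorm_test_le h ((PiLp.norm_apply_le (gradTuple φ h) none).trans h1)
    have h4 := eLpNorm_two_sq volume φ
    simp only [ENNReal.rpow_two]
    rw [← h4]
    rw [ENNReal.ofReal_one] at h3
    exact pow_le_one₀ zero_le h3
  rw [eLpNorm_eq_lintegral_rpow_enorm_toReal (by simpa using hp0) ENNReal.ofReal_ne_top,
    ENNReal.toReal_ofReal hp0.le]
  refine ENNReal.rpow_le_rpow ?_ (by positivity)
  calc _ ≤ ∫⁻ z, (‖φ z‖ₑ ^ (2:ℝ) + ‖φ z‖ₑ ^ q) := lintegral_mono fun z =>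
        rpow_le_rpow_add_rpow (by linarith) (by
          rw [hq]
          have : 2 * (1 + 1 / (n : ℝ)) = 2 + 2 / n := by ring
          linarith)
    _ = (∫⁻ z, ‖φ z‖ₑ ^ (2:ℝ)) + ∫⁻ z, ‖φ z‖ₑ ^ q :=
        lintegral_add_left (h.continuous.enorm.measurable.pow_const _) _
    _ ≤ _ := add_le_add h2 hI

/-- The Sobolev inequality for `H¹_𝓛`, in terms of `σ = (I - 𝓛)^{1/2} u`. -/
theorem exists_sobolev_invSqrt (n : ℕ) (hn : 1 ≤ n) {p : ℝ} (hp1 : 1 < p)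
    (hp2 : p ≤ 1 + 1 / (n : ℝ)) :
    ∃ K : ℝ, 0 ≤ K ∧ ∀ σ : L2 n,
      eLpNorm (invSqrt n σ) (ENNReal.ofReal (2 * p)) volume ≤ ENNReal.ofReal (K * ‖σ‖) := by
  obtain ⟨K, hK, htest⟩ := exists_sobolev_test n hn hp1 hp2
  set r := ENNReal.ofReal (2 * p) with hr
  have hform : ∀ w : formDomain n, ‖w‖ < 1 → eLpNorm (formEmbedding n w) r volume ≤ K := by
    intro w hw
    have hcl : (w : GradSpace n) ∈ closure (Submodule.span ℂ {w : GradSpace n |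
        ∃ φ : Heis n → ℂ, IsTest φ ∧ w none =ᵐ[volume] φ ∧
        ∀ j : Fin n, w (some (Sum.inl j)) =ᵐ[volume] X j φ ∧
          w (some (Sum.inr j)) =ᵐ[volume] Y j φ} : Set (GradSpace n)) := w.2
    obtain ⟨x, hx, hxlim⟩ := mem_closure_iff_seq_limit.1 hcl
    have hx1 : ∀ᶠ k in atTop, ‖x k‖ < 1 := (hxlim.norm).eventually_lt_const hw
    have hlim2 : Tendsto (fun k => x k none) atTop (𝓝 (formEmbedding n w)) :=
      ((PiLp.continuous_apply 2 (fun _ : Option (Fin n ⊕ Fin n) => L2 n) none).tendsto _).comp hxlim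
    obtain ⟨ns, hns, hae⟩ := (tendstoInMeasure_of_tendsto_Lp hlim2).exists_seq_tendsto_ae
    refine (Lp.eLpNorm_lim_le_liminf_eLpNorm (fun k => (Lp.memLp (x (ns k) none)).1) _ hae).trans ?_
    have hev : ∀ᶠ k in atTop, eLpNorm (x (ns k) none) r volume ≤ K := by
      filter_upwards [hns.tendsto_atTop.eventually hx1] with k hk
      obtain ⟨φ, hφ, hφe⟩ := exists_test_of_mem_span (hx (ns k))
      rw [hφe] at hk ⊢
      refine le_trans (le_of_eq ?_) (htest φ hφ hk.le)
      exact eLpNorm_congr_ae (coeFn_testLp hφ)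
    exact (liminf_le_liminf hev).trans (le_of_eq (liminf_const K))
  refine ⟨2 * K.toReal, by positivity, fun σ => ?_⟩
  rcases eq_or_ne σ 0 with h0 | h0
  · rw [h0, map_zero, norm_zero, mul_zero, ENNReal.ofReal_zero, eLpNorm_congr_ae
      (Lp.coeFn_zero ℂ 2 (volume : Measure (Heis n)))]
    simp
  have hσ : 0 < ‖σ‖ := norm_pos_iff.2 h0
  set c : ℝ := 2 * ‖σ‖ with hc
  have hc0 : 0 < c := by positivity
  set σ' : L2 n := c⁻¹ • σ with hσ'
  have h1 : ‖formLift n σ'‖ < 1 := by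
    refine (norm_formLift_le σ').trans_lt ?_
    rw [hσ', norm_smul, norm_inv, Real.norm_of_nonneg hc0.le, hc]
    have : (2 * ‖σ‖)⁻¹ * ‖σ‖ = 1 / 2 := by field_simp
    rw [this]; norm_num
  have h2 := hform _ h1
  rw [formEmbedding_formLift] at h2
  have h3 : invSqrt n σ = c • invSqrt n σ' := by
    show realInvSqrt n σ = c • realInvSqrt n σ'
    rw [hσ', map_smul, smul_inv_smul₀ hc0.ne']
  rw [h3, eLpNorm_congr_ae (Lp.coeFn_smul _ _), eLpNorm_const_smul]
  calc _ ≤ ‖c‖ₑ * K := by gcongr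
    _ = ENNReal.ofReal c * ENNReal.ofReal K.toReal := by
        rw [Real.enorm_of_nonneg hc0.le, ENNReal.ofReal_toReal hK]
    _ = _ := by rw [← ENNReal.ofReal_mul hc0.le, hc]; ring_nf

end Sobolev

section Nonlinearity

lemma holderTriple_of_one_lt {p : ℝ} (hp : 1 < p) :
    ENNReal.HolderTriple (ENNReal.ofReal (2 * p / (p - 1))) (ENNReal.ofReal (2 * p)) 2 := by
  have h1 : 0 < p - 1 := by linarith
  have h0 : 0 < p := by linarith
  constructor
  rw [← ENNReal.ofReal_inv_of_pos (by positivity), ← ENNReal.ofReal_inv_of_pos (by positivity),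
    ← ENNReal.ofReal_add (by positivity) (by positivity)]
  have : (2 * p / (p - 1))⁻¹ + (2 * p)⁻¹ = 2⁻¹ := by field_simp; ring
  rw [this, ENNReal.ofReal_inv_of_pos two_pos]
  simp

variable {p C : ℝ} {f : ℂ → ℂ}

/-- Hölder's inequality with the exponents `2 p / (p - 1)` and `2 p`, for `f ∘ u - f ∘ v`. -/
lemma eLpNorm_comp_sub_le (hp : 1 < p)
    (hf : ∀ u v : ℂ, ‖f u - f v‖ ≤ C * (‖u‖ ^ (p - 1) + ‖v‖ ^ (p - 1)) * ‖u - v‖)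
    {u v : Heis n → ℂ} (hu : AEStronglyMeasurable u volume) (hv : AEStronglyMeasurable v volume) :
    eLpNorm (fun z => f (u z) - f (v z)) 2 volume ≤ ENNReal.ofReal |C|
      * ((eLpNorm u (ENNReal.ofReal (2 * p)) volume ^ (p - 1)
        + eLpNorm v (ENNReal.ofReal (2 * p)) volume ^ (p - 1))
        * eLpNorm (u - v) (ENNReal.ofReal (2 * p)) volume) := by
  have hp0 : 0 < p - 1 := by linarith
  have hpc : Continuous fun x : ℂ => ‖x‖ ^ (p - 1) :=
    continuous_norm.rpow_const fun _ => Or.inr hp0.le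
  set s := ENNReal.ofReal (2 * p / (p - 1)) with hs
  have hsr : s * ENNReal.ofReal (p - 1) = ENNReal.ofReal (2 * p) := by
    rw [hs, ← ENNReal.ofReal_mul (by positivity)]
    congr 1; field_simp
  have hs1 : 1 ≤ s := by
    rw [hs, ENNReal.one_le_ofReal, le_div_iff₀ hp0]; linarith
  have hmu := hpc.comp_aestronglyMeasurable hu
  have hmv := hpc.comp_aestronglyMeasurable hv
  set g : Heis n → ℝ := (fun z => ‖u z‖ ^ (p - 1)) + fun z => ‖v z‖ ^ (p - 1) with hg
  have := holderTriple_of_one_lt hp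
  have h1 : eLpNorm (fun z => f (u z) - f (v z)) 2 volume
      ≤ ENNReal.ofReal |C| * eLpNorm (g • (u - v)) 2 volume := by
    refine eLpNorm_le_mul_eLpNorm_of_ae_le_mul (ae_of_all _ fun z => ?_) 2
    have hg0 : 0 ≤ g z := by simp only [hg, Pi.add_apply]; positivity
    rw [Pi.smul_apply', norm_smul, Real.norm_of_nonneg hg0, ← mul_assoc]
    refine (hf _ _).trans ?_
    show C * g z * ‖u z - v z‖ ≤ |C| * g z * ‖u z - v z‖
    gcongr
    exact le_abs_self C
  refine h1.trans ?_
  gcongr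
  refine (eLpNorm_smul_le_mul_eLpNorm (p := s) (q := ENNReal.ofReal (2 * p)) (hu.sub hv)
    (hmu.add hmv)).trans ?_
  gcongr
  refine (eLpNorm_add_le hmu hmv hs1).trans (le_of_eq ?_)
  rw [← hsr, ← eLpNorm_norm_rpow u hp0, ← eLpNorm_norm_rpow v hp0]

open Classical in
/-- The map `u ↦ f ∘ u` on `L²`, with the value `0` when `f ∘ u` is not in `L²`. -/
noncomputable def nemytskii (f : ℂ → ℂ) (u : L2 n) : L2 n :=
  if h : MemLp (fun z => f (u z)) 2 volume then h.toLp _ else 0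

/-- The nonlinearity maps `H¹_𝓛` to `L²`, with the Lipschitz bound of `f`. -/
lemma exists_nemytskii_lipschitz (n : ℕ) (hn : 1 ≤ n) (hp1 : 1 < p) (hp2 : p ≤ 1 + 1 / (n : ℝ))
    (hf0 : f 0 = 0)
    (hf : ∀ u v : ℂ, ‖f u - f v‖ ≤ C * (‖u‖ ^ (p - 1) + ‖v‖ ^ (p - 1)) * ‖u - v‖) :
    (∀ σ : L2 n, MemLp (fun z => f (invSqrt n σ z)) 2 volume) ∧
    ∃ L : ℝ, 0 ≤ L ∧ ∀ σ τ : L2 n, ‖nemytskii f (invSqrt n σ) - nemytskii f (invSqrt n τ)‖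
      ≤ L * (‖σ‖ ^ (p - 1) + ‖τ‖ ^ (p - 1)) * ‖σ - τ‖ := by
  obtain ⟨K, hK, hsob⟩ := exists_sobolev_invSqrt n hn hp1 hp2
  have hp0 : 0 < p - 1 := by linarith
  have hfc : Continuous f := DampedWave.continuous_of_power_lipschitz hp0 hf
  have hmeas : ∀ u : L2 n, AEStronglyMeasurable u volume := fun u => (Lp.memLp u).1
  have hfin : ∀ σ : L2 n, eLpNorm (invSqrt n σ) (ENNReal.ofReal (2 * p)) volume ≠ ⊤ := fun σ =>
    ((hsob σ).trans_lt ENNReal.ofReal_lt_top).ne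
  have hmem : ∀ σ : L2 n, MemLp (fun z => f (invSqrt n σ z)) 2 volume := by
    intro σ
    refine ⟨hfc.comp_aestronglyMeasurable (hmeas _), ?_⟩
    have h := eLpNorm_comp_sub_le hp1 hf (hmeas (invSqrt n σ))
      (aestronglyMeasurable_const (b := (0 : ℂ)))
    simp only [hf0, sub_zero] at h
    refine h.trans_lt ?_
    have h2 : (⇑(invSqrt n σ) : Heis n → ℂ) - (fun _ => (0:ℂ)) = ⇑(invSqrt n σ) := by
      funext z; simp
    rw [h2]
    have h3 := ENNReal.rpow_ne_top_of_nonneg hp0.le (hfin σ)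
    have h4 := hfin σ
    have h5 : eLpNorm (fun _ : Heis n => (0:ℂ)) (ENNReal.ofReal (2 * p)) volume = 0 := by simp
    rw [h5, ENNReal.zero_rpow_of_pos hp0, add_zero]
    finiteness
  refine ⟨hmem, |C| * K ^ (p - 1) * K, by positivity, fun σ τ => ?_⟩
  rw [nemytskii, nemytskii, dif_pos (hmem σ), dif_pos (hmem τ), ← MemLp.toLp_sub, Lp.norm_toLp]
  refine ENNReal.toReal_le_of_le_ofReal (by positivity) ?_
  refine (eLpNorm_comp_sub_le hp1 hf (hmeas _) (hmeas _)).trans ?_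
  have hsub : eLpNorm (⇑(invSqrt n σ) - ⇑(invSqrt n τ) : Heis n → ℂ) (ENNReal.ofReal (2 * p)) volume
      ≤ ENNReal.ofReal (K * ‖σ - τ‖) := by
    rw [← eLpNorm_congr_ae (Lp.coeFn_sub (invSqrt n σ) (invSqrt n τ)), ← map_sub]
    exact hsob _
  have hpow : ∀ σ : L2 n, eLpNorm (invSqrt n σ) (ENNReal.ofReal (2 * p)) volume ^ (p - 1)
      ≤ ENNReal.ofReal (K ^ (p - 1) * ‖σ‖ ^ (p - 1)) := by
    intro σ
    rw [← Real.mul_rpow hK (norm_nonneg _),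
      ← ENNReal.ofReal_rpow_of_nonneg (by positivity) hp0.le]
    exact ENNReal.rpow_le_rpow (hsob σ) hp0.le
  calc _ ≤ ENNReal.ofReal |C| * ((ENNReal.ofReal (K ^ (p - 1) * ‖σ‖ ^ (p - 1))
          + ENNReal.ofReal (K ^ (p - 1) * ‖τ‖ ^ (p - 1))) * ENNReal.ofReal (K * ‖σ - τ‖)) := by
          gcongr
          · exact hpow σ
          · exact hpow τ
    _ = _ := by
      rw [← ENNReal.ofReal_add (by positivity) (by positivity),
        ← ENNReal.ofReal_mul (by positivity), ← ENNReal.ofReal_mul (by positivity)]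
      congr 1; ring

lemma coeFn_nemytskii {u : L2 n} (h : MemLp (fun z => f (u z)) 2 volume) :
    nemytskii f u =ᵐ[volume] fun z => f (u z) := by
  rw [nemytskii, dif_pos h]; exact MemLp.coeFn_toLp _

end Nonlinearity

end Heisenberg

/-! ### From the integrated system to the Cauchy problem -/

namespace DampedWave

open Filter
open scoped RealInnerProductSpace Topology

variable {H : Type*} [NormedAddCommGroup H] [InnerProductSpace ℝ H] [CompleteSpace H]

/-- The integrated equation written out in its two components. -/
lemma integrated_eq_iff {S : H →L[ℝ] H} {b m : ℝ} {N : H → H} (hN : Continuous N) {x : H × H}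
    {U : ℝ → H × H} (hU : ContinuousOn U (Ici 0)) {t : ℝ} (ht : 0 ≤ t) :
    diag S (U t) = diag S x + ∫ s in (0:ℝ)..t, (waveOp S b m (U s) + diag S (0, N (U s).1)) ↔
      S (U t).1 = S x.1 + (∫ s in (0:ℝ)..t, (U s).2) ∧
      S (U t).2 = S x.2 + ∫ s in (0:ℝ)..t,
        (-stiffness S m (U s).1 - b • S (U s).2 + S (N (U s).1)) := by
  have hc : ContinuousOn (fun s => waveOp S b m (U s) + diag S (0, N (U s).1)) (uIcc 0 t) := by
    rw [uIcc_of_le ht]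
    have hU' := hU.mono (Icc_subset_Ici_self : Icc 0 t ⊆ Ici 0)
    exact ((waveOp S b m).continuous.comp_continuousOn hU').add
      ((diag S).continuous.comp_continuousOn
        (continuousOn_const.prodMk (hN.comp_continuousOn hU'.fst)))
  have h1 := (ContinuousLinearMap.fst ℝ H H).intervalIntegral_comp_comm
    (hc.intervalIntegrable (μ := volume))
  have h2 := (ContinuousLinearMap.snd ℝ H H).intervalIntegral_comp_comm
    (hc.intervalIntegrable (μ := volume))
  simp only [ContinuousLinearMap.coe_fst', ContinuousLinearMap.coe_snd'] at h1 h2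
  rw [Prod.ext_iff, Prod.fst_add, Prod.snd_add, ← h1, ← h2]
  simp only [waveOp_apply, diag_apply, map_zero, Prod.fst_add, Prod.snd_add, add_zero]

end DampedWave

namespace Heisenberg

open Filter
open scoped RealInnerProductSpace Topology ENNReal

open DampedWave

variable {n : ℕ}

section Pairing

lemma integral_mul_test {φ : Heis n → ℂ} (h : IsTest φ) (u : L2 n) :
    ∫ z, u z * φ z = inner ℂ (testLp _ h.conj) u := by
  rw [inner_testLp_left]
  simp

/-- The vector representing the distributional pairing with a test function `φ`:
`∫ u φ = ⟨probe φ, (I - 𝓛)^{-1/2} u⟩`. -/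
noncomputable def probe (φ : Heis n → ℂ) (h : IsTest φ) : L2 n :=
  invSqrt n (helmholtz _ h.conj)

lemma integral_mul_eq_inner_probe {φ : Heis n → ℂ} (h : IsTest φ) (u : L2 n) :
    ∫ z, u z * φ z = inner ℂ (probe φ h) (invSqrt n u) := by
  rw [integral_mul_test h, ← resolvent_helmholtz, ← invSqrt_invSqrt, inner_invSqrt]
  rfl

lemma testLp_conj_subLaplacian {φ : Heis n → ℂ} (h : IsTest φ) :
    testLp _ h.subLaplacian.conj = testLp _ h.conj - helmholtz _ h.conj := by
  refine Lp.ext ?_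
  filter_upwards [coeFn_testLp h.subLaplacian.conj, coeFn_testLp h.conj,
    coeFn_testLp (h.conj.sub h.conj.subLaplacian),
    Lp.coeFn_sub (testLp _ h.conj) (helmholtz _ h.conj)] with z h1 h2 h3 h4
  rw [h1, h4, Pi.sub_apply, h2, helmholtz, h3, subLaplacian_conj h]
  ring

lemma integral_invSqrt_mul_subLaplacian {φ : Heis n → ℂ} (h : IsTest φ) (σ : L2 n) :
    ∫ z, invSqrt n σ z * subLaplacian φ z
      = inner ℂ (probe φ h) (invSqrt n (invSqrt n σ) - σ) := by
  rw [integral_mul_test h.subLaplacian, testLp_conj_subLaplacian h, inner_sub_left, inner_sub_right,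
    ← integral_mul_test h, integral_mul_eq_inner_probe h, probe, inner_invSqrt _ σ]

/-- Distributional pairings determine `(I - 𝓛)^{-1/2} u`, hence `u`. -/
lemma eq_zero_of_inner_probe {u : L2 n} (h : ∀ φ (hφ : IsTest φ), inner ℂ (probe φ hφ) u = 0) :
    u = 0 := by
  refine eq_zero_of_inner_invSqrt_helmholtz fun φ hφ => ?_
  have := h _ hφ.conj
  rw [probe] at this
  convert this using 4
  funext z
  simp

lemma inner_real_smul (x y : L2 n) (c : ℝ) : inner ℂ x (c • y) = c * inner ℂ x y := by
  rw [← Complex.real_smul]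
  exact ((innerSL ℂ x).restrictScalars ℝ).map_smul c y

/-- The terms of the equation other than `∂_t² u`, tested against `φ`. -/
lemma equation_rhs_eq {f : ℂ → ℂ} (b m : ℝ) {φ : Heis n → ℂ} (h : IsTest φ) (σ v : L2 n)
    (hσ : MemLp (fun z => f (invSqrt n σ z)) 2 volume) :
    (∫ z, invSqrt n σ z * subLaplacian φ z) - b * (∫ z, v z * φ z)
        - m * (∫ z, invSqrt n σ z * φ z) + (∫ z, f (invSqrt n σ z) * φ z)
      = inner ℂ (probe φ h) (-stiffness (realInvSqrt n) m σ - b • realInvSqrt n v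
          + realInvSqrt n (nemytskii f (invSqrt n σ))) := by
  have hf : ∫ z, f (invSqrt n σ z) * φ z
      = inner ℂ (probe φ h) (invSqrt n (nemytskii f (invSqrt n σ))) := by
    rw [← integral_mul_eq_inner_probe]
    refine integral_congr_ae ?_
    filter_upwards [coeFn_nemytskii hσ] with z hz
    rw [hz]
  rw [hf, integral_invSqrt_mul_subLaplacian h, integral_mul_eq_inner_probe h,
    integral_mul_eq_inner_probe h, stiffness_apply]
  simp only [realInvSqrt_apply, inner_add_right, inner_sub_right, inner_neg_right,
    inner_real_smul]
  push_cast
  ring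

end Pairing

section Equivalence

variable {b m : ℝ} {f : ℂ → ℂ} {u₀ u₁ : L2 n}

/-- A solution of the integrated system in the energy variables `((I - 𝓛)^{1/2} u, ∂_t u)` gives a
solution of the Cauchy problem. -/
lemma IsSolution.of_isIntegralSolution (hmem : ∀ σ, MemLp (fun z => f (invSqrt n σ z)) 2 volume)
    (hN : Continuous fun σ : L2 n => nemytskii f (invSqrt n σ)) (hu₀ : MemH1 u₀)
    {U : ℝ → L2 n × L2 n}
    (hU : IsIntegralSolution (realInvSqrt n) b m (fun σ => nemytskii f (invSqrt n σ))
      (sqrtOneSub u₀, u₁) U) :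
    IsSolution b m f u₀ u₁ (fun t => invSqrt n (U t).1) ∧
      ∀ t, 0 ≤ t → dt (fun t => invSqrt n (U t).1) t = (U t).2 := by
  have hUc := hU.continuousOn
  have heq := fun t (ht : 0 ≤ t) => (integrated_eq_iff hN hUc ht).1 (hU.eq t ht)
  simp only [realInvSqrt_apply, invSqrt_sqrtOneSub hu₀] at heq
  have hUm := continuous_comp_max hUc
  -- Both integral equations are extended to a neighbourhood of each time by freezing `U` for
  -- negative times, so that the fundamental theorem of calculus applies.
  have hderiv : ∀ t, 0 ≤ t →
      HasDerivWithinAt (fun t => invSqrt n (U t).1) (U t).2 (Ici 0) t := by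
    intro t ht
    have h1 : HasDerivAt (fun t => u₀ + ∫ s in (0:ℝ)..t, (U (max s 0)).2) (U (max t 0)).2 t :=
      (hUm.snd.integral_hasStrictDerivAt 0 t).hasDerivAt.const_add _
    rw [max_eq_left ht] at h1
    have h2 : ∀ t ∈ Ici (0:ℝ), invSqrt n (U t).1 = u₀ + ∫ s in (0:ℝ)..t, (U (max s 0)).2 := by
      intro t ht
      rw [(heq t ht).1]
      congr 1
      refine intervalIntegral.integral_congr fun s hs => ?_
      rw [uIcc_of_le ht] at hs
      simp only [max_eq_left hs.1]
    exact h1.hasDerivWithinAt.congr h2 (h2 t ht)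
  have hdt : ∀ t, 0 ≤ t → dt (fun t => invSqrt n (U t).1) t = (U t).2 := fun t ht =>
    (hderiv t ht).derivWithin (uniqueDiffOn_Ici 0 t ht)
  have h0 : U 0 = (sqrtOneSub u₀, u₁) := by
    obtain ⟨h1, h2⟩ := heq 0 le_rfl
    rw [intervalIntegral.integral_same, add_zero] at h1 h2
    refine Prod.ext ?_ (invSqrt_injective n h2)
    rw [← sqrtOneSub_invSqrt (U 0).1, h1]
  refine ⟨⟨fun t _ => ⟨_, rfl⟩, ?_, ?_, ?_, ?_, ?_, ?_⟩, hdt⟩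
  · simp only [sqrtOneSub_invSqrt]
    exact hUc.fst
  · have h1 : ContDiffOn ℝ (0 + 1) (fun t => invSqrt n (U t).1) (Ici 0) := by
      rw [contDiffOn_succ_iff_derivWithin (uniqueDiffOn_Ici 0)]
      refine ⟨fun t ht => (hderiv t ht).differentiableWithinAt, by simp, ?_⟩
      rw [contDiffOn_zero]
      exact hUc.snd.congr hdt
    simpa using h1
  · exact fun t _ => (hmem _).locallyIntegrable (by norm_num)
  · intro φ hφ t ht
    rw [hdt t ht.le, equation_rhs_eq b m hφ _ _ (hmem _)]
    set Q : L2 n × L2 n → L2 n := fun W => -stiffness (realInvSqrt n) m W.1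
      - b • realInvSqrt n W.2 + realInvSqrt n (nemytskii f (invSqrt n W.1)) with hQ
    have hQc : Continuous Q := by
      refine Continuous.add (Continuous.sub ?_ ?_) ?_
      · exact ((stiffness (realInvSqrt n) m).continuous.comp continuous_fst).neg
      · exact ((realInvSqrt n).continuous.comp continuous_snd).const_smul b
      · exact (realInvSqrt n).continuous.comp (hN.comp continuous_fst)
    have h1 : HasDerivAt (fun t => invSqrt n u₁ + ∫ s in (0:ℝ)..t, Q (U (max s 0)))
        (Q (U (max t 0))) t :=
      ((hQc.comp hUm).integral_hasStrictDerivAt 0 t).hasDerivAt.const_add _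
    rw [max_eq_left ht.le] at h1
    have h2 : HasDerivAt (fun s => inner ℂ (probe φ hφ)
        (invSqrt n u₁ + ∫ s in (0:ℝ)..s, Q (U (max s 0)))) (inner ℂ (probe φ hφ) (Q (U t))) t :=
      ((innerSL ℂ (probe φ hφ)).restrictScalars ℝ).hasFDerivAt.comp_hasDerivAt t h1
    refine h2.congr_of_eventuallyEq ?_
    filter_upwards [lt_mem_nhds ht] with s hs
    rw [hdt s hs.le, integral_mul_eq_inner_probe hφ, (heq s hs.le).2]
    congr 2
    refine intervalIntegral.integral_congr fun r hr => ?_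
    rw [uIcc_of_le hs.le] at hr
    simp only [max_eq_left hr.1]
    rfl
  · show invSqrt n (U 0).1 = u₀
    rw [h0, invSqrt_sqrtOneSub hu₀]
  · rw [hdt 0 le_rfl, h0]

/-- The energy variables of a solution of the Cauchy problem satisfy the integrated system. -/
lemma IsSolution.isIntegralSolution (hmem : ∀ σ, MemLp (fun z => f (invSqrt n σ z)) 2 volume)
    (hN : Continuous fun σ : L2 n => nemytskii f (invSqrt n σ)) {u : ℝ → L2 n}
    (hu : IsSolution b m f u₀ u₁ u) :
    IsIntegralSolution (realInvSqrt n) b m (fun σ => nemytskii f (invSqrt n σ))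
      (sqrtOneSub u₀, u₁) (fun t => (sqrtOneSub (u t), dt u t)) := by
  have hdc : ContinuousOn (dt u) (Ici 0) :=
    hu.contDiff_L2.continuousOn_derivWithin (uniqueDiffOn_Ici 0) le_rfl
  have hUc : ContinuousOn (fun t => (sqrtOneSub (u t), dt u t)) (Ici 0) :=
    hu.continuous_H1.prodMk hdc
  refine ⟨hUc, fun t ht => (integrated_eq_iff hN hUc ht).2 ⟨?_, ?_⟩⟩
  · have hu0 : MemH1 u₀ := hu.initial ▸ hu.memH1 0 le_rfl
    simp only [realInvSqrt_apply]
    rw [invSqrt_sqrtOneSub (hu.memH1 t ht), invSqrt_sqrtOneSub hu0]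
    have h1 := intervalIntegral.integral_eq_sub_of_hasDerivAt_of_le ht
      (f := u) (f' := dt u) (hu.contDiff_L2.continuousOn.mono Icc_subset_Ici_self)
      (fun s hs => ?_) ?_
    · rw [h1, hu.initial]; abel
    · have h2 : DifferentiableWithinAt ℝ u (Ici 0) s :=
        hu.contDiff_L2.differentiableOn one_ne_zero s hs.1.le
      exact h2.hasDerivWithinAt.hasDerivAt (Ici_mem_nhds hs.1)
    · refine ContinuousOn.intervalIntegrable ?_
      rw [uIcc_of_le ht]
      exact hdc.mono Icc_subset_Ici_self
  · set Q : L2 n × L2 n → L2 n := fun W => -stiffness (realInvSqrt n) m W.1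
      - b • realInvSqrt n W.2 + realInvSqrt n (nemytskii f (invSqrt n W.1)) with hQ
    have hQc : Continuous Q := by
      refine Continuous.add (Continuous.sub ?_ ?_) ?_
      · exact ((stiffness (realInvSqrt n) m).continuous.comp continuous_fst).neg
      · exact ((realInvSqrt n).continuous.comp continuous_snd).const_smul b
      · exact (realInvSqrt n).continuous.comp (hN.comp continuous_fst)
    have hQU : ContinuousOn (fun s => Q (sqrtOneSub (u s), dt u s)) (Icc 0 t) :=
      hQc.comp_continuousOn (hUc.mono Icc_subset_Ici_self)
    have hQi : IntervalIntegrable (fun s => Q (sqrtOneSub (u s), dt u s)) volume 0 t := by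
      refine ContinuousOn.intervalIntegrable ?_
      rwa [uIcc_of_le ht]
    rw [← sub_eq_zero]
    refine eq_zero_of_inner_probe fun φ hφ => ?_
    set ℓ : L2 n →L[ℝ] ℂ := (innerSL ℂ (probe φ hφ)).restrictScalars ℝ with hℓ
    have hpair : ∀ s, ∫ z, dt u s z * φ z = ℓ (invSqrt n (dt u s)) := fun s =>
      integral_mul_eq_inner_probe hφ _
    have h1 := intervalIntegral.integral_eq_sub_of_hasDerivAt_of_le ht
      (f := fun s => ℓ (invSqrt n (dt u s))) (f' := fun s => ℓ (Q (sqrtOneSub (u s), dt u s)))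
      ?_ (fun s hs => ?_) ?_
    · rw [ℓ.intervalIntegral_comp_comm hQi, show dt u 0 = u₁ from hu.initial_dt] at h1
      show ℓ (invSqrt n (dt u t) - (invSqrt n u₁ + ∫ s in (0:ℝ)..t,
        Q (sqrtOneSub (u s), dt u s))) = 0
      rw [map_sub, map_add, h1]
      ring
    · exact ℓ.continuous.comp_continuousOn ((invSqrt n).continuous.comp_continuousOn
        (hdc.mono Icc_subset_Ici_self))
    · have h2 := hu.equation φ hφ s hs.1
      have h3 := equation_rhs_eq b m hφ (sqrtOneSub (u s)) (dt u s) (hmem _)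
      have h4 : Q (sqrtOneSub (u s), dt u s) = -stiffness (realInvSqrt n) m (sqrtOneSub (u s))
          - b • realInvSqrt n (dt u s) + realInvSqrt n (nemytskii f (u s)) := by
        simp only [hQ, invSqrt_sqrtOneSub (hu.memH1 s hs.1.le)]
      rw [invSqrt_sqrtOneSub (hu.memH1 s hs.1.le), ← h4] at h3
      rw [h3] at h2
      simp only [hpair] at h2
      exact h2
    · refine ContinuousOn.intervalIntegrable ?_
      rw [uIcc_of_le ht]
      exact ℓ.continuous.comp_continuousOn hQU

end Equivalence

end Heisenberg

theorem theorem3p2 (n : ℕ) (hn : 1 ≤ n) (b m : ℝ) (hb : 0 < b) (hm : 0 < m)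
    (p : ℝ) (hp1 : 1 < p) (hp2 : p ≤ 1 + 1 / (n : ℝ))
    (C : ℝ) (f : ℂ → ℂ) (hf0 : f 0 = 0)
    (hf : ∀ u v : ℂ, ‖f u - f v‖ ≤ C * (‖u‖ ^ (p - 1) + ‖v‖ ^ (p - 1)) * ‖u - v‖) :
    ∃ ε₀ : ℝ, 0 < ε₀ ∧ ∃ δ₀ : ℝ, 0 < δ₀ ∧ ∃ K : ℝ,
      ∀ u₀ u₁ : Heisenberg.L2 n, Heisenberg.MemH1 u₀ →
        Heisenberg.normH1 u₀ + ‖u₁‖ ≤ ε₀ →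
        ∃ u : ℝ → Heisenberg.L2 n,
          Heisenberg.IsSolution b m f u₀ u₁ u ∧
          (∀ v : ℝ → Heisenberg.L2 n, Heisenberg.IsSolution b m f u₀ u₁ v →
            Set.EqOn v u (Set.Ici 0)) ∧
          ∀ t : ℝ, 0 ≤ t →
            ‖u t‖ ≤ K * Real.exp (-δ₀ * t) ∧
            ‖Heisenberg.sqrtNeg (u t)‖ ≤ K * Real.exp (-δ₀ * t) ∧
            ‖Heisenberg.dt u t‖ ≤ K * Real.exp (-δ₀ * t) := by
  open Heisenberg in
  obtain ⟨hmem, L, hL, hlip⟩ := exists_nemytskii_lipschitz n hn hp1 hp2 hf0 hf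
  have hq : 0 < p - 1 := by linarith
  have hS := isPosContraction_realInvSqrt n
  have hN0 : nemytskii f (invSqrt n 0) = 0 := by
    refine Lp.ext ((coeFn_nemytskii (hmem 0)).trans ?_)
    rw [map_zero]
    filter_upwards [Lp.coeFn_zero ℂ 2 (volume : Measure (Heis n))] with z hz
    rw [hz, Pi.zero_apply, hf0]
  have hNc : Continuous fun σ : L2 n => nemytskii f (invSqrt n σ) :=
    DampedWave.continuous_of_power_lipschitz hq hlip
  obtain ⟨ε₀, hε₀, δ₀, hδ₀, K, hK, hglob⟩ := DampedWave.exists_global_solution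
    (N := fun σ => nemytskii f (invSqrt n σ)) hS hb hm hL hq hN0 hlip
  refine ⟨ε₀, hε₀, δ₀, hδ₀, (1 + ‖opSqrt (1 - resolvent n)‖) * K, fun u₀ u₁ hu₀ hsmall => ?_⟩
  have hx : ‖(sqrtOneSub u₀, u₁)‖ ≤ ε₀ := by
    refine (max_le ?_ ?_ : max ‖sqrtOneSub u₀‖ ‖u₁‖ ≤ ε₀)
    · exact (le_add_of_nonneg_right (norm_nonneg _)).trans hsmall
    · exact (le_add_of_nonneg_left (norm_nonneg _)).trans hsmall
  obtain ⟨U, hU, hdecay⟩ := hglob _ hx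
  obtain ⟨hsol, hdt⟩ := IsSolution.of_isIntegralSolution hmem hNc hu₀ hU
  refine ⟨_, hsol, fun v hv t ht => ?_, fun t ht => ?_⟩
  · have h := (hv.isIntegralSolution hmem hNc).eqOn hS hb hm hL hq hlip hU ht
    show v t = invSqrt n (U t).1
    rw [← h, invSqrt_sqrtOneSub (hv.memH1 t ht)]
  · have h1 : ‖(U t).1‖ ≤ K * Real.exp (-δ₀ * t) := (norm_fst_le _).trans (hdecay t ht)
    have h2 : ‖(U t).2‖ ≤ K * Real.exp (-δ₀ * t) := (norm_snd_le _).trans (hdecay t ht)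
    have h3 : K * Real.exp (-δ₀ * t)
        ≤ (1 + ‖opSqrt (1 - resolvent n)‖) * K * Real.exp (-δ₀ * t) := by
      rw [mul_assoc]
      exact le_mul_of_one_le_left (by positivity) (by linarith [norm_nonneg (opSqrt (1 - resolvent n))])
    refine ⟨((norm_invSqrt_le _).trans h1).trans h3, ?_, ?_⟩
    · rw [sqrtNeg, sqrtOneSub_invSqrt, mul_assoc]
      refine (ContinuousLinearMap.le_opNorm _ _).trans ?_
      gcongr
      linarith
    · rw [hdt t ht]
      exact h2.trans h3
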